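/- For a discrete group $H$, let $\mathrm{cd}(H)=\inf\{m:\mathrm{Ext}^i_{\mathbb{Z}H}(\mathbb{Z},-)=0\text{ for all }i>m\}$ and $\mathrm{hd}(H)=\inf\{m:\mathrm{Tor}_i^{\mathbb{Z}H}(\mathbb{Z},-)=0\text{ for all }i>m\}$, each being $\infty$ if there is no such $m$. Let $G$ be a discrete group acting freely and properly on an $e$-dimensional CW-complex $E$. (Here, as usual for CW-complexes, $G$ acts by homeomorphisms permuting the open cells; the action is proper if for all compact $K,L\subseteq E$ only finitely many $g\in G$ satisfy $gK\cap L\neq\emptyset$.) Suppose that there is an integer $n\le e$ such that $H_i(E;\mathbb{Z})=0$ for all $i>n$ and $H_n(E;\mathbb{Z})\cong\mathbb{Z}$, and set $k=e-n$. Then $G$ has jump cohomology and jump homology of height $k$: every subgroup $H\le G$ with $\mathrm{cd}(H)<\infty$ satisfies $\mathrm{cd}(H)\le k$, and every subgroup $H\le G$ with $\mathrm{hd}(H)<\infty$ satisfies $\mathrm{hd}(H)\le k$. -/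

import Mathlib

open CategoryTheory Topology

universe u

noncomputable section

/-- The group `Ext^i_{RG}(R, M)`, where `R` is the trivial representation of `G` over `R` and
`M` is an `RG`-module, regarded as an `R`-linear representation of `G`. -/
def extTrivial (R G : Type u) [CommRing R] [Group G] (i : ℕ) (M : Rep.{u} R G) : ModuleCat R :=
  ((Ext R (Rep.{u} R G) i).obj (Opposite.op (Rep.trivial R G R))).obj M

/-- The group `Tor_i^{RG}(R, M)`: the `i`-th homology of the complex `(M ⊗_R P)_G`, where `P` is a
projective resolution of the trivial representation `R`. Here `(M ⊗_R P)_G` is the tensor product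
of `M` and `P` over `RG`, with left and right modules exchanged through `g ↦ g⁻¹`. -/
def torTrivial (R G : Type u) [CommRing R] [Group G] (i : ℕ) (M : Rep.{u} R G) : ModuleCat R :=
  ((Rep.Tor R G i).obj M).obj (Rep.trivial R G R)

/-- The cohomological dimension `cd_R G`, the infimum of all `n` such that `Ext^i_{RG}(R, -) = 0`
for every `i > n`; it is `⊤` if no natural number `n` has this property. -/
def cohomologicalDimension (R G : Type u) [CommRing R] [Group G] : ℕ∞ :=
  sInf {n : ℕ∞ | ∀ i : ℕ, n < i → ∀ M : Rep.{u} R G, Limits.IsZero (extTrivial R G i M)}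

/-- The homological dimension `hd_R G`, the infimum of all `n` such that `Tor_i^{RG}(R, -) = 0`
for every `i > n`; it is `⊤` if no natural number `n` has this property. -/
def homologicalDimension (R G : Type u) [CommRing R] [Group G] : ℕ∞ :=
  sInf {n : ℕ∞ | ∀ i : ℕ, n < i → ∀ M : Rep.{u} R G, Limits.IsZero (torTrivial R G i M)}

/-- `G` has jump cohomology of height `k` over `R`: every subgroup of finite cohomological
dimension over `R` has cohomological dimension at most `k` over `R`. -/
def HasJumpCohomology (R G : Type u) [CommRing R] [Group G] (k : ℕ) : Prop :=
  ∀ H : Subgroup G, cohomologicalDimension R H < ⊤ → cohomologicalDimension R H ≤ k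

/-- `G` has jump homology of height `k` over `R`: every subgroup of finite homological
dimension over `R` has homological dimension at most `k` over `R`. -/
def HasJumpHomology (R G : Type u) [CommRing R] [Group G] (k : ℕ) : Prop :=
  ∀ H : Subgroup G, homologicalDimension R H < ⊤ → homologicalDimension R H ≤ k

/-- The singular homology `H_i(E, R)`. -/
def singularHomology (R : Type u) [CommRing R] (i : ℕ) (E : Type u) [TopologicalSpace E] :
    ModuleCat.{u} R :=
  ((AlgebraicTopology.singularHomologyFunctor (ModuleCat.{u} R) i).obj (ModuleCat.of R R)).obj
    (TopCat.of E)

/-- The ring of integers, as a type in the universe `u`. -/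
abbrev IntU : Type u := ULift.{u} ℤ

/-- The CW-complex `E` has dimension `e`. -/
structure HasCWDimension (E : Type u) [TopologicalSpace E] [CWComplex (Set.univ : Set E)]
    (e : ℕ) : Prop where
  isEmpty_cell : ∀ m : ℕ, e < m → IsEmpty (RelCWComplex.cell (Set.univ : Set E) m)
  nonempty_cell : Nonempty (RelCWComplex.cell (Set.univ : Set E) e)

/-- The discrete group `G` acts freely and properly on the CW-complex `E`. The action on a
CW-complex is by homeomorphisms which permute the open cells (equivalently, which preserve all
skeleta). It is free if no `g ≠ 1` has a fixed point, and proper if, for all compact sets `K` and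
`L`, only finitely many `g` satisfy `g K ∩ L ≠ ∅`. -/
structure ActsFreelyAndProperly (G E : Type u) [Group G] [TopologicalSpace E]
    [CWComplex (Set.univ : Set E)] [MulAction G E] : Prop where
  continuous : ContinuousConstSMul G E
  permutes_cells : ∀ (g : G) (m : ℕ) (i : RelCWComplex.cell (Set.univ : Set E) m),
    ∃ j : RelCWComplex.cell (Set.univ : Set E) m,
      (fun x => g • x) '' RelCWComplex.openCell m i = RelCWComplex.openCell m j
  free : ∀ (g : G) (x : E), g • x = x → g = 1
  proper : ProperlyDiscontinuousSMul G E

end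

noncomputable section

/-- A semi-simplicial set. -/
structure FaceSystem where
  obj : ℕ → Type*
  face : ∀ {n}, Fin (n + 2) → obj (n + 1) → obj n
  face_face : ∀ {n} (i j : Fin (n + 2)) (x : obj (n + 2)), i ≤ j →
    face i (face j.succ x) = face j (face i.castSucc x)

namespace FaceSystem

variable (F : FaceSystem)

/-- Integral chains. -/
abbrev Chain (n : ℕ) : Type _ := F.obj n →₀ ℤ

/-- The boundary operator. -/
def d (n : ℕ) : F.Chain (n + 1) →ₗ[ℤ] F.Chain n :=
  Finsupp.linearCombination ℤ fun x => ∑ j : Fin (n + 2),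
    (-1 : ℤ) ^ (j : ℕ) • Finsupp.single (F.face j x) 1

variable {F}

lemma d_single {n : ℕ} (x : F.obj (n + 1)) :
    F.d n (Finsupp.single x 1) =
      ∑ j : Fin (n + 2), (-1 : ℤ) ^ (j : ℕ) • Finsupp.single (F.face j x) 1 := by
  simp [d]

/-- The coboundary of a cochain with values in an abelian group. -/
def cob {N : Type*} [AddCommGroup N] {n : ℕ} (φ : F.obj n → N) (x : F.obj (n + 1)) : N :=
  ∑ j : Fin (n + 2), (-1 : ℤ) ^ (j : ℕ) • φ (F.face j x)

lemma linearCombination_d {N : Type*} [AddCommGroup N] {n : ℕ} (φ : F.obj n → N)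
    (c : F.Chain (n + 1)) :
    Finsupp.linearCombination ℤ φ (F.d n c) = Finsupp.linearCombination ℤ (cob φ) c := by
  suffices Finsupp.linearCombination ℤ φ ∘ₗ F.d n = Finsupp.linearCombination ℤ (cob φ) from
    LinearMap.congr_fun this c
  ext x
  simp [cob, d]

lemma cob_cob {N : Type*} [AddCommGroup N] {n : ℕ} (φ : F.obj n → N)
    (x : F.obj (n + 2)) : cob (cob φ) x = 0 := by
  simp only [cob, Finset.smul_sum, smul_smul, ← pow_add]
  rw [Finset.sum_comm, ← Finset.sum_product']
  let P := Fin (n + 2) × Fin (n + 3)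
  let S : Finset P := {ij : P | (ij.2 : ℕ) ≤ (ij.1 : ℕ)}
  rw [Finset.univ_product_univ, ← Finset.sum_add_sum_compl S, ← eq_neg_iff_add_eq_zero,
    ← Finset.sum_neg_distrib]
  let f : ∀ ij : P, ij ∈ S → P := fun ij hij =>
    (Fin.castLT ij.2 (lt_of_le_of_lt (Finset.mem_filter.mp hij).right (Fin.is_lt ij.1)), ij.1.succ)
  apply Finset.sum_bij f
  · intro ij hij
    simp_rw [S, f, Finset.compl_filter, Finset.mem_filter_univ, Fin.val_succ,
      Fin.val_castLT] at hij ⊢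
    lia
  · rintro ⟨i, j⟩ hij ⟨i', j'⟩ hij' h
    rw [Prod.mk_inj]
    exact ⟨by simpa [f] using! congr_arg Prod.snd h,
      by simpa [f, Fin.castSucc_castLT] using! congr_arg Fin.castSucc (congr_arg Prod.fst h)⟩
  · rintro ⟨i', j'⟩ hij'
    simp_rw [S, Finset.compl_filter, Finset.mem_filter_univ, not_le] at hij'
    refine ⟨(j'.pred <| ?_, Fin.castSucc i'), ?_, ?_⟩
    · rintro rfl
      simp only [Fin.val_zero, not_lt_zero] at hij'
    · simpa [S] using! Nat.le_sub_one_of_lt hij'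
    · simp only [f, Fin.castLT_castSucc, Fin.succ_pred]
  · rintro ⟨i, j⟩ hij
    have hij2 : (j : ℕ) ≤ i := (Finset.mem_filter.mp hij).right
    dsimp only [f]
    rw [F.face_face _ _ _ (by rw [Fin.le_iff_val_le_val]; simpa using hij2), Fin.castSucc_castLT,
      ← neg_smul]
    congr 1
    simp only [Fin.val_succ, Fin.val_castLT]
    ring

lemma d_d {n : ℕ} (c : F.Chain (n + 2)) : F.d n (F.d (n + 1) c) = 0 := by
  have : F.d n (F.d (n + 1) c) =
      Finsupp.linearCombination ℤ (cob (cob fun x => (Finsupp.single x 1 : F.Chain n))) c := by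
    rw [← linearCombination_d, ← linearCombination_d]
    have : Finsupp.linearCombination ℤ (fun x => (Finsupp.single x 1 : F.Chain n)) =
      LinearMap.id := by ext; simp
    rw [this]; rfl
  rw [this]
  have h : cob (cob fun x => (Finsupp.single x 1 : F.Chain n)) = (fun _ => 0) :=
    funext fun x => cob_cob _ x
  rw [h]
  simp [Finsupp.linearCombination_apply]

/-- A cochain is a coboundary on the family of simplices `L`; the primitive is required to satisfy
`P`. In degree zero this means that the cochain vanishes on `L`. -/
def IsCob (L : ∀ n, Set (F.obj n)) {N : Type*} [AddCommGroup N]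
    (P : ∀ n, (F.obj n → N) → Prop) : ∀ n, (F.obj n → N) → Prop
  | 0, φ => ∀ x ∈ L 0, φ x = 0
  | n + 1, φ => ∃ ψ : F.obj n → N, P n ψ ∧ ∀ x ∈ L (n + 1), φ x = cob ψ x

/-- Chains supported on a family of simplices. -/
abbrev chainsIn (L : ∀ n, Set (F.obj n)) (n : ℕ) : Submodule ℤ (F.Chain n) :=
  Finsupp.supported ℤ ℤ (L n)

/-- A family of simplices which is closed under faces. -/
def FaceClosed (L : ∀ n, Set (F.obj n)) : Prop :=
  ∀ n (j : Fin (n + 2)), ∀ x ∈ L (n + 1), F.face j x ∈ L n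

lemma single_mem_chainsIn {L : ∀ n, Set (F.obj n)} {n : ℕ} {x : F.obj n} (hx : x ∈ L n) (a : ℤ) :
    (Finsupp.single x a : F.Chain n) ∈ chainsIn L n :=
  Finsupp.single_mem_supported _ _ hx

/-- A linear map on chains sends chains in `L` to a submodule if it does so for simplices. -/
lemma map_mem_of_chainsIn {L : ∀ n, Set (F.obj n)} {n : ℕ} {M : Type*} [AddCommGroup M]
    (f : F.Chain n →ₗ[ℤ] M) (W : Submodule ℤ M)
    (h : ∀ x ∈ L n, f (Finsupp.single x 1) ∈ W) {c : F.Chain n} (hc : c ∈ chainsIn L n) :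
    f c ∈ W := by
  rw [chainsIn, Finsupp.supported_eq_span_single] at hc
  have : Submodule.span ℤ ((fun i => (Finsupp.single i (1:ℤ) : F.Chain n)) '' L n) ≤
      W.comap f := by
    rw [Submodule.span_le]
    rintro _ ⟨x, hx, rfl⟩
    exact h x hx
  exact this hc

lemma d_mem {L : ∀ n, Set (F.obj n)} (hL : FaceClosed L) {n : ℕ} {c : F.Chain (n + 1)}
    (hc : c ∈ chainsIn L (n + 1)) : F.d n c ∈ chainsIn L n := by
  refine map_mem_of_chainsIn _ _ (fun x hx => ?_) hc
  rw [d_single]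
  exact Submodule.sum_mem _ fun j _ => Submodule.smul_mem _ _ (single_mem_chainsIn (hL _ _ _ hx) _)

/-- Vanishing of the homology of the pair `(L, K)`. -/
structure RelAcyclic (L K : ∀ n, Set (F.obj n)) : Prop where
  zero : ∀ c ∈ chainsIn L 0, ∃ b ∈ chainsIn L 1, c - F.d 0 b ∈ chainsIn K 0
  succ : ∀ n, ∀ c ∈ chainsIn L (n + 1), F.d n c ∈ chainsIn K n →
    ∃ b ∈ chainsIn L (n + 2), c - F.d (n + 1) b ∈ chainsIn K (n + 1)

section Equivariant

variable (H : Type*) [Group H] [∀ n, MulAction H (F.obj n)]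

/-- Equivariant maps. -/
def Equivar {X Y : Type*} [SMul H X] [SMul H Y] (f : X → Y) : Prop := ∀ (g : H) x, f (g • x) = g • f x

/-- For a free action, an invariant total relation contains an equivariant map. -/
lemma exists_equivar {H X Y : Type*} [Group H] [MulAction H X] [MulAction H Y]
    (hfree : ∀ (g : H) (x : X), g • x = x → g = 1) (R : X → Y → Prop)
    (hR : ∀ (g : H) x y, R x y → R (g • x) (g • y)) (hex : ∀ x, ∃ y, R x y) :
    ∃ f : X → Y, Equivar H f ∧ ∀ x, R x (f x) := by
  choose y hy using hex
  let rep : X → X := fun x => (Quotient.mk (MulAction.orbitRel H X) x).out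
  have hrep : ∀ x, ∃ g : H, g • rep x = x := fun x => by
    have : MulAction.orbitRel H X (rep x) x := Quotient.mk_out (s := MulAction.orbitRel H X) x
    obtain ⟨g, hg⟩ := MulAction.orbitRel_apply.mp ((MulAction.orbitRel H X).symm this)
    exact ⟨g, hg⟩
  choose γ hγ using hrep
  have hrep_smul : ∀ (g : H) x, rep (g • x) = rep x := fun g x => by
    have : Quotient.mk (MulAction.orbitRel H X) (g • x) = Quotient.mk (MulAction.orbitRel H X) x :=
      Quotient.sound (MulAction.orbitRel_apply.mpr ⟨g, rfl⟩)
    simp only [rep, this]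
  refine ⟨fun x => γ x • y (rep x), fun g x => ?_, fun x => ?_⟩
  · have h1 : γ (g • x) = g * γ x := by
      have h2 : (γ x)⁻¹ * (g⁻¹ * γ (g • x)) = 1 := by
        apply hfree _ (rep x)
        have h3 := hγ (g • x)
        rw [hrep_smul] at h3
        rw [mul_smul, mul_smul, h3, inv_smul_smul]
        nth_rw 2 [← hγ x]
        rw [inv_smul_smul]
      rw [inv_mul_eq_one, eq_inv_mul_iff_mul_eq] at h2
      exact h2.symm
    simp only [h1, hrep_smul, mul_smul]
  · have := hR (γ x) _ _ (hy (rep x))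
    rwa [hγ] at this

/-- The vanishing in degrees at least `q` of the equivariant cohomology of `L` with arbitrary
coefficients. -/
def EquivariantVanishing (L : ∀ n, Set (F.obj n)) (q : ℕ) : Prop :=
  ∀ (N : Type u) [AddCommGroup N] [DistribMulAction H N] (n : ℕ), q ≤ n →
    ∀ φ : F.obj n → N, Equivar H φ → (∀ x ∈ L (n + 1), cob φ x = 0) →
      IsCob L (fun _ => Equivar H) n φ

end Equivariant
end FaceSystem

namespace FaceSystem
variable {F : FaceSystem}

section Algebra
variable {N : Type*} [AddCommGroup N] {n : ℕ}

lemma cob_add (φ ψ : F.obj n → N) (x : F.obj (n + 1)) : cob (φ + ψ) x = cob φ x + cob ψ x := by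
  simp [cob, Finset.sum_add_distrib]

lemma cob_sub (φ ψ : F.obj n → N) (x : F.obj (n + 1)) : cob (φ - ψ) x = cob φ x - cob ψ x := by
  simp [cob, smul_sub, Finset.sum_sub_distrib]

lemma cob_congr {φ ψ : F.obj n → N} {x : F.obj (n + 1)}
    (h : ∀ j : Fin (n + 2), φ (F.face j x) = ψ (F.face j x)) : cob φ x = cob ψ x := by
  simp [cob, h]

lemma linearCombination_eq_zero {L : ∀ n, Set (F.obj n)} {φ : F.obj n → N}
    (h : ∀ x ∈ L n, φ x = 0) {c : F.Chain n} (hc : c ∈ chainsIn L n) :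
    Finsupp.linearCombination ℤ φ c = 0 := by
  simpa using map_mem_of_chainsIn (Finsupp.linearCombination ℤ φ) ⊥ (by simpa using h) hc

lemma linearCombination_d_single {N : Type*} [AddCommGroup N] {n : ℕ} (φ : F.obj n → N)
    (x : F.obj (n + 1)) :
    Finsupp.linearCombination ℤ φ (F.d n (Finsupp.single x 1)) = cob φ x := by
  rw [linearCombination_d]; simp

end Algebra

section Equivariant

variable (H : Type*) [Group H] [∀ n, MulAction H (F.obj n)]

/-- The action on chains. -/
@[reducible]
def chainMulAction (n : ℕ) : MulAction H (F.Chain n) where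
  smul g c := Finsupp.lmapDomain ℤ ℤ (g • ·) c
  one_smul c := by
    change Finsupp.mapDomain _ c = c
    simp only [one_smul]; exact Finsupp.mapDomain_id
  mul_smul g h c := by
    change Finsupp.mapDomain _ c = Finsupp.mapDomain _ (Finsupp.mapDomain _ c)
    rw [← Finsupp.mapDomain_comp]
    congr 1
    funext x
    exact mul_smul g h x

attribute [local instance] chainMulAction

variable {H}

lemma smul_chain {n : ℕ} (g : H) (c : F.Chain n) :
    g • c = Finsupp.lmapDomain ℤ ℤ (g • ·) c := rfl

/-- The faces commute with the group action. -/
def FaceEquivar (F : FaceSystem) (H : Type*) [Group H] [∀ n, MulAction H (F.obj n)] : Prop :=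
  ∀ (n : ℕ) (j : Fin (n + 2)) (g : H) (x : F.obj (n + 1)), F.face j (g • x) = g • F.face j x

lemma d_smul (hF : FaceEquivar F H) {n : ℕ} (g : H) (c : F.Chain (n + 1)) :
    F.d n (g • c) = g • F.d n c := by
  rw [smul_chain, smul_chain]
  suffices F.d n ∘ₗ Finsupp.lmapDomain ℤ ℤ (g • ·) =
      Finsupp.lmapDomain ℤ ℤ (g • ·) ∘ₗ F.d n from LinearMap.congr_fun this c
  ext x : 2
  simp only [LinearMap.comp_apply, Finsupp.lsingle_apply, Finsupp.lmapDomain_apply,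
    Finsupp.mapDomain_single, d_single, hF n _ g x]
  rw [← Finsupp.lmapDomain_apply ℤ ℤ, map_sum]
  simp only [map_smul, Finsupp.lmapDomain_apply, Finsupp.mapDomain_single]

lemma smul_mem_chainsIn {L : ∀ n, Set (F.obj n)} (hL : ∀ n (g : H), ∀ x ∈ L n, g • x ∈ L n)
    {n : ℕ} (g : H) {c : F.Chain n} (hc : c ∈ chainsIn L n) : g • c ∈ chainsIn L n := by
  refine map_mem_of_chainsIn (Finsupp.lmapDomain ℤ ℤ (g • ·)) _ (fun x hx => ?_) hc
  simpa [Finsupp.mapDomain_single] using single_mem_chainsIn (hL n g x hx) 1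

lemma smul_sub_chain {n : ℕ} (g : H) (c c' : F.Chain n) : g • (c - c') = g • c - g • c' := by
  simp only [smul_chain, map_sub]

lemma linearCombination_smul {N : Type*} [AddCommGroup N] [DistribMulAction H N] {n : ℕ}
    {φ : F.obj n → N} (hφ : Equivar H φ) (g : H) (c : F.Chain n) :
    Finsupp.linearCombination ℤ φ (g • c) = g • Finsupp.linearCombination ℤ φ c := by
  rw [smul_chain]
  suffices Finsupp.linearCombination ℤ φ ∘ₗ Finsupp.lmapDomain ℤ ℤ (g • ·) =
    (DistribSMul.toAddMonoidHom N g).toIntLinearMap ∘ₗ Finsupp.linearCombination ℤ φ from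
    LinearMap.congr_fun this c
  ext x
  simp [Finsupp.mapDomain_single, hφ g x]

lemma linearCombination_smul' {n m : ℕ}
    {h : F.obj n → F.Chain m} (hφ : Equivar H h) (g : H) (c : F.Chain n) :
    Finsupp.linearCombination ℤ h (g • c) = g • Finsupp.linearCombination ℤ h c := by
  rw [smul_chain, smul_chain]
  suffices Finsupp.linearCombination ℤ h ∘ₗ Finsupp.lmapDomain ℤ ℤ (g • ·) =
    Finsupp.lmapDomain ℤ ℤ (g • ·) ∘ₗ Finsupp.linearCombination ℤ h from
    LinearMap.congr_fun this c
  ext x : 2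
  simp [Finsupp.mapDomain_single, hφ g x, smul_chain]

lemma smul_single {n : ℕ} (g : H) (x : F.obj n) :
    g • (Finsupp.single x 1 : F.Chain n) = Finsupp.single (g • x) 1 := by
  simp [smul_chain, Finsupp.mapDomain_single]

/-- Absolute cycles. -/
def IsCycle : ∀ n, F.Chain n → Prop
  | 0, _ => True
  | n + 1, c => F.d n c = 0

lemma isCycle_d {n : ℕ} (c : F.Chain (n + 1)) : IsCycle n (F.d n c) := by
  cases n with
  | zero => trivial
  | succ n => exact d_d c

variable {L K : ∀ n, Set (F.obj n)}

lemma exists_equivariant_contraction (hF : FaceEquivar F H)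
    (hfree : ∀ n (g : H) (x : F.obj n), g • x = x → g = 1)
    (hLf : FaceClosed L) (hL : ∀ n (g : H), ∀ x ∈ L n, g • x ∈ L n)
    (hK : ∀ n (g : H), ∀ x ∈ K n, g • x ∈ K n)
    (hLK : RelAcyclic L K) (n : ℕ) :
    ∃ h : F.obj n → F.Chain (n + 1), Equivar H h ∧ (∀ x ∈ L n, h x ∈ chainsIn L (n + 1)) ∧
      ∀ c ∈ chainsIn L n, IsCycle n c →
        c - F.d n (Finsupp.linearCombination ℤ h c) ∈ chainsIn K n := by
  induction n with
  | zero =>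
    obtain ⟨h, hh, hR⟩ := exists_equivar (H := H) (X := F.obj 0) (Y := F.Chain 1) (hfree 0)
      (fun x b => x ∈ L 0 → b ∈ chainsIn L 1 ∧ Finsupp.single x 1 - F.d 0 b ∈ chainsIn K 0)
      (fun g x b hx hgx => by
        have hx' : x ∈ L 0 := by simpa using hL 0 g⁻¹ _ hgx
        refine ⟨smul_mem_chainsIn hL g (hx hx').1, ?_⟩
        rw [d_smul hF, ← smul_single, ← smul_sub_chain]
        exact smul_mem_chainsIn hK g (hx hx').2)
      (fun x => by
        by_cases hx : x ∈ L 0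
        · obtain ⟨b, hb, hb'⟩ := hLK.zero _ (single_mem_chainsIn hx 1)
          exact ⟨b, fun _ => ⟨hb, hb'⟩⟩
        · exact ⟨0, fun h => absurd h hx⟩)
    refine ⟨h, hh, fun x hx => (hR x hx).1, fun c hc _ => ?_⟩
    refine map_mem_of_chainsIn (LinearMap.id - F.d 0 ∘ₗ Finsupp.linearCombination ℤ h) _
      (fun x hx => ?_) hc
    simpa using (hR x hx).2
  | succ n ih =>
    obtain ⟨k, hk, hkL, hkc⟩ := ih
    obtain ⟨h, hh, hR⟩ := exists_equivar (H := H) (X := F.obj (n + 1)) (Y := F.Chain (n + 2))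
      (hfree (n + 1))
      (fun x b => x ∈ L (n + 1) → b ∈ chainsIn L (n + 2) ∧
        (Finsupp.single x 1 - Finsupp.linearCombination ℤ k (F.d n (Finsupp.single x 1)))
          - F.d (n + 1) b ∈ chainsIn K (n + 1))
      (fun g x b hx hgx => by
        have hx' : x ∈ L (n + 1) := by simpa using hL _ g⁻¹ _ hgx
        refine ⟨smul_mem_chainsIn hL g (hx hx').1, ?_⟩
        rw [d_smul hF, ← smul_single, d_smul hF, linearCombination_smul' hk, ← smul_sub_chain,
          ← smul_sub_chain]
        exact smul_mem_chainsIn hK g (hx hx').2)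
      (fun x => by
        by_cases hx : x ∈ L (n + 1)
        · have hdx := d_mem hLf (single_mem_chainsIn hx 1)
          obtain ⟨b, hb, hb'⟩ := hLK.succ n
            (Finsupp.single x 1 - Finsupp.linearCombination ℤ k (F.d n (Finsupp.single x 1)))
            (Submodule.sub_mem _ (single_mem_chainsIn hx 1)
              (map_mem_of_chainsIn _ _ (by simpa using hkL) hdx))
            (by rw [map_sub]; exact hkc _ hdx (isCycle_d _))
          exact ⟨b, fun _ => ⟨hb, hb'⟩⟩
        · exact ⟨0, fun h => absurd h hx⟩)
    refine ⟨h, hh, fun x hx => (hR x hx).1, fun c hc hcyc => ?_⟩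
    have := map_mem_of_chainsIn (LinearMap.id - Finsupp.linearCombination ℤ k ∘ₗ F.d n
      - F.d (n + 1) ∘ₗ Finsupp.linearCombination ℤ h) (chainsIn K (n + 1))
      (fun x hx => by simpa using (hR x hx).2) hc
    have h0 : F.d n c = 0 := hcyc
    simpa [h0] using this

/-- Vanishing of equivariant cohomology only depends on the homology of the family of
simplices. -/
theorem EquivariantVanishing.of_relAcyclic (hF : FaceEquivar F H)
    (hfree : ∀ n (g : H) (x : F.obj n), g • x = x → g = 1)
    (hLf : FaceClosed L) (hL : ∀ n (g : H), ∀ x ∈ L n, g • x ∈ L n)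
    (hK : ∀ n (g : H), ∀ x ∈ K n, g • x ∈ K n) (hKL : ∀ n, K n ⊆ L n)
    (hLK : RelAcyclic L K) {q : ℕ} (h : EquivariantVanishing.{u} H K q) :
    EquivariantVanishing.{u} H L q := by
  intro N _ _ n hn φ hφ hcoc
  have hφK := h N n hn φ hφ fun x hx => hcoc x (hKL _ hx)
  cases n with
  | zero =>
    intro x hx
    obtain ⟨b, hb, hb'⟩ := hLK.zero _ (single_mem_chainsIn hx 1)
    have h1 := linearCombination_eq_zero hφK hb'
    rw [map_sub, linearCombination_d, linearCombination_eq_zero hcoc hb] at h1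
    simpa using h1
  | succ n =>
    obtain ⟨α, hα, hφα⟩ := hφK
    obtain ⟨k, hk, hkL, hkc⟩ := exists_equivariant_contraction hF hfree hLf hL hK hLK n
    have hcobα : Equivar H (cob α) := fun g x => by
      simp only [cob, Finset.smul_sum, hF n _ g x, hα g]
      exact Finset.sum_congr rfl fun j _ => (smul_comm _ _ _)
    set φ' := φ - cob α with hφ'
    have hφ'e : Equivar H φ' := fun g x => by
      simp [φ', hφ g x, hcobα g x, smul_sub]
    have hφ'K : ∀ x ∈ K (n + 1), φ' x = 0 := fun x hx => by simp [φ', hφα x hx]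
    have hφ'c : ∀ x ∈ L (n + 2), cob φ' x = 0 := fun x hx => by
      rw [hφ', cob_sub, hcoc x hx, cob_cob, sub_zero]
    refine ⟨α + fun x => Finsupp.linearCombination ℤ φ' (k x), fun g x => ?_, fun x hx => ?_⟩
    · simp only [Pi.add_apply, hα g x, hk g x, linearCombination_smul hφ'e, smul_add]
    · have hdx := d_mem hLf (single_mem_chainsIn hx 1)
      obtain ⟨b, hb, hb'⟩ := hLK.succ n
        (Finsupp.single x 1 - Finsupp.linearCombination ℤ k (F.d n (Finsupp.single x 1)))
        (Submodule.sub_mem _ (single_mem_chainsIn hx 1)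
          (map_mem_of_chainsIn _ _ (by simpa using hkL) hdx))
        (by rw [map_sub]; exact hkc _ hdx (isCycle_d _))
      have h1 := linearCombination_eq_zero hφ'K hb'
      rw [map_sub, map_sub, linearCombination_d φ', linearCombination_eq_zero hφ'c hb, sub_zero,
        linearCombination_d_single, sub_eq_zero] at h1
      rw [cob_add]
      have h2 : cob (fun x => Finsupp.linearCombination ℤ φ' (k x)) x =
          Finsupp.linearCombination ℤ φ' (cob k x) := by
        simp [cob]
      rw [h2, ← h1]
      simp [φ']

end Equivariant
end FaceSystem

namespace FaceSystem
variable {F : FaceSystem}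

section Equivariant
variable {H : Type*} [Group H] [∀ n, MulAction H (F.obj n)]

lemma Equivar.cob (hF : FaceEquivar F H) {N : Type*} [AddCommGroup N] [DistribMulAction H N]
    {n : ℕ} {φ : F.obj n → N} (hφ : Equivar H φ) : Equivar H (FaceSystem.cob φ) := fun g x => by
  simp only [FaceSystem.cob, Finset.smul_sum, hF n _ g x, hφ g]
  exact Finset.sum_congr rfl fun j _ => (smul_comm _ _ _)

lemma EquivariantVanishing.mono {L : ∀ n, Set (F.obj n)} {q q' : ℕ} (hq : q ≤ q')
    (h : EquivariantVanishing.{u} H L q) : EquivariantVanishing.{u} H L q' :=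
  fun N _ _ n hn => h N n (hq.trans hn)

lemma EquivariantVanishing.of_empty {L : ∀ n, Set (F.obj n)} (hL : ∀ n, L n = ∅) (q : ℕ) :
    EquivariantVanishing.{u} H L q := fun N _ _ n _ φ _ _ => by
  cases n with
  | zero => simp [IsCob, hL]
  | succ n => exact ⟨fun _ => 0, fun g x => by simp, by simp [hL]⟩

/-- Mayer–Vietoris for families of simplices. -/
theorem EquivariantVanishing.union (hF : FaceEquivar F H) {U V : ∀ n, Set (F.obj n)}
    (hU : ∀ n (g : H), ∀ x ∈ U n, g • x ∈ U n) (hUf : FaceClosed U) (hVf : FaceClosed V)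
    {q : ℕ} (h₁ : EquivariantVanishing.{u} H U (q + 1))
    (h₂ : EquivariantVanishing.{u} H V (q + 1))
    (h₃ : EquivariantVanishing.{u} H (fun n => U n ∩ V n) q) :
    EquivariantVanishing.{u} H (fun n => U n ∪ V n) (q + 1) := by
  classical
  intro N _ _ n hn φ hφ hcoc
  obtain ⟨n, rfl⟩ : ∃ m, n = m + 1 := ⟨n - 1, by omega⟩
  obtain ⟨α, hα, hφα⟩ := h₁ N _ hn φ hφ fun x hx => hcoc x (Or.inl hx)
  obtain ⟨β, hβ, hφβ⟩ := h₂ N _ hn φ hφ fun x hx => hcoc x (Or.inr hx)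
  have h := h₃ N n (by omega) (α - β) (fun g x => by simp [hα g x, hβ g x, smul_sub])
    (fun x hx => by rw [cob_sub, ← hφα x hx.1, ← hφβ x hx.2, sub_self])
  obtain ⟨α', hα', hφα', hαβ⟩ : ∃ α' : F.obj n → N, Equivar H α' ∧
      (∀ x ∈ U (n + 1), φ x = cob α' x) ∧ ∀ x ∈ U n, x ∈ V n → α' x = β x := by
    cases n with
    | zero => exact ⟨α, hα, hφα, fun x hx hx' => sub_eq_zero.mp (h x ⟨hx, hx'⟩)⟩
    | succ n =>
      obtain ⟨γ, hγ, hγ'⟩ := h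
      refine ⟨α - cob γ, fun g x => ?_, fun x hx => ?_, fun x hx hx' => ?_⟩
      · simp [hα g x, hγ.cob hF g x, smul_sub]
      · rw [cob_sub, cob_cob, sub_zero, hφα x hx]
      · have := hγ' x ⟨hx, hx'⟩
        simp only [Pi.sub_apply] at this ⊢
        rw [← this]; abel
  refine ⟨fun x => if x ∈ U n then α' x else β x, fun g x => ?_, fun x hx => ?_⟩
  · have : g • x ∈ U n ↔ x ∈ U n :=
      ⟨fun h => by simpa using hU n g⁻¹ _ h, fun h => hU n g x h⟩
    simp only [this]
    split_ifs
    · exact hα' g x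
    · exact hβ g x
  · rcases hx with hx | hx
    · rw [hφα' x hx]
      refine cob_congr fun j => ?_
      simp [hUf n j x hx]
    · rw [hφβ x hx]
      refine cob_congr fun j => ?_
      split_ifs with hj
      · exact (hαβ _ hj (hVf n j x hx)).symm
      · rfl

end Equivariant

/-- The vanishing in degrees at least `q` of the cohomology of `L` with arbitrary coefficients. -/
def Vanishing (L : ∀ n, Set (F.obj n)) (q : ℕ) : Prop :=
  ∀ (N : Type u) [AddCommGroup N] (n : ℕ), q ≤ n →
    ∀ φ : F.obj n → N, (∀ x ∈ L (n + 1), cob φ x = 0) → IsCob L (fun _ _ => True) n φ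

/-- The trivial action of the trivial group. -/
@[reducible]
def trivialMulAction (X : Type*) : MulAction (Equiv.Perm Empty) X where
  smul _ x := x
  one_smul _ := rfl
  mul_smul _ _ _ := rfl

attribute [local instance] trivialMulAction

lemma vanishing_iff {L : ∀ n, Set (F.obj n)} {q : ℕ} :
    Vanishing.{u} L q ↔ EquivariantVanishing.{u} (Equiv.Perm Empty) L q := by
  constructor
  · intro h N _ _ n hn φ _ hc
    have := h N n hn φ hc
    cases n with
    | zero => exact this
    | succ n =>
      obtain ⟨ψ, -, hψ⟩ := this
      exact ⟨ψ, fun g x => by 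
        rw [Subsingleton.elim g 1, one_smul]
        exact (DistribMulAction.toMulAction.one_smul (ψ x)).symm, hψ⟩
  · intro h N _ n hn φ hc
    letI : DistribMulAction (Equiv.Perm Empty) N :=
      { trivialMulAction N with
        smul_zero := fun _ => rfl
        smul_add := fun _ _ _ => rfl }
    have := h N n hn φ (fun _ _ => rfl) hc
    cases n with
    | zero => exact this
    | succ n =>
      obtain ⟨ψ, -, hψ⟩ := this
      exact ⟨ψ, trivial, hψ⟩

theorem Vanishing.of_relAcyclic {K L : ∀ n, Set (F.obj n)}
    (hLf : FaceClosed L) (hKL : ∀ n, K n ⊆ L n)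
    (hLK : RelAcyclic L K) {q : ℕ} (h : Vanishing.{u} K q) : Vanishing.{u} L q :=
  vanishing_iff.mpr <| EquivariantVanishing.of_relAcyclic (fun _ _ _ _ => rfl)
    (fun _ _ _ _ => Subsingleton.elim _ _) hLf (fun _ _ _ h => h) (fun _ _ _ h => h) hKL hLK
    (vanishing_iff.mp h)

theorem Vanishing.union {U V : ∀ n, Set (F.obj n)} (hUf : FaceClosed U) (hVf : FaceClosed V)
    {q : ℕ} (h₁ : Vanishing.{u} U (q + 1)) (h₂ : Vanishing.{u} V (q + 1))
    (h₃ : Vanishing.{u} (fun n => U n ∩ V n) q) :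
    Vanishing.{u} (fun n => U n ∪ V n) (q + 1) :=
  vanishing_iff.mpr <| EquivariantVanishing.union (fun _ _ _ _ => rfl) (fun _ _ _ h => h)
    hUf hVf (vanishing_iff.mp h₁) (vanishing_iff.mp h₂) (vanishing_iff.mp h₃)

lemma Vanishing.mono {L : ∀ n, Set (F.obj n)} {q q' : ℕ} (hq : q ≤ q')
    (h : Vanishing.{u} L q) : Vanishing.{u} L q' :=
  fun N _ n hn => h N n (hq.trans hn)

lemma Vanishing.of_empty {L : ∀ n, Set (F.obj n)} (hL : ∀ n, L n = ∅) (q : ℕ) :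
    Vanishing.{u} L q := vanishing_iff.mpr (EquivariantVanishing.of_empty hL q)

/-- If a group permutes freely the members of a disjoint family, then the equivariant cohomology of
the union vanishes if the cohomology of the members does. -/
theorem EquivariantVanishing.of_disjoint_family {H : Type*} [Group H]
    [∀ n, MulAction H (F.obj n)] (hF : FaceEquivar F H) {T : Type*} [MulAction H T]
    (hfree : ∀ (g : H) (t : T), g • t = t → g = 1) (L : T → ∀ n, Set (F.obj n))
    (hf : ∀ t, FaceClosed (L t)) (hL : ∀ (g : H) t n, ∀ x ∈ L t n, g • x ∈ L (g • t) n)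
    (hdisj : ∀ n, ∀ x : F.obj n, ∀ s t, x ∈ L s n → x ∈ L t n → s = t) {q : ℕ}
    (h : ∀ t, Vanishing.{u} (L t) q) :
    EquivariantVanishing.{u} H (fun n => ⋃ t, L t n) q := by
  classical
  intro N _ _ n hn φ hφ hcoc
  have hφt := fun t => h t N n hn φ fun x hx => hcoc x (Set.mem_iUnion_of_mem t hx)
  cases n with
  | zero =>
    intro x hx
    obtain ⟨t, ht⟩ := Set.mem_iUnion.mp hx
    exact hφt t x ht
  | succ n =>
    choose α _ hα using hφt
    obtain ⟨γ, hγ, -⟩ := exists_equivar (Y := H) hfree (fun _ _ => True)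
      (fun _ _ _ _ => trivial) (fun _ => ⟨1, trivial⟩)
    have hγ' : ∀ (g : H) t, γ (g • t) = g * γ t := hγ
    let ψ : F.obj n → N := fun x => if hx : ∃ t, x ∈ L t n then
      γ hx.choose • α ((γ hx.choose)⁻¹ • hx.choose) ((γ hx.choose)⁻¹ • x) else 0
    have hψ : ∀ t, ∀ x ∈ L t n, ψ x = γ t • α ((γ t)⁻¹ • t) ((γ t)⁻¹ • x) := fun t x hx => by
      have hex : ∃ t, x ∈ L t n := ⟨t, hx⟩
      have : hex.choose = t := hdisj n x _ _ hex.choose_spec hx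
      simp only [ψ, dif_pos hex, this]
    refine ⟨ψ, fun g x => ?_, fun x hx => ?_⟩
    · by_cases hx : ∃ t, x ∈ L t n
      · obtain ⟨t, ht⟩ := hx
        rw [hψ t x ht, hψ _ _ (hL g t n x ht), hγ']
        simp [mul_smul]
      · have hgx : ¬ ∃ t, g • x ∈ L t n := fun ⟨t, ht⟩ =>
          hx ⟨g⁻¹ • t, by simpa using hL g⁻¹ t n _ ht⟩
        simp only [ψ, dif_neg hx, dif_neg hgx, smul_zero]
    · obtain ⟨t, ht⟩ := Set.mem_iUnion.mp hx
      have h1 : cob ψ x = γ t • cob (α ((γ t)⁻¹ • t)) ((γ t)⁻¹ • x) := by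
        simp only [cob, Finset.smul_sum]
        refine Finset.sum_congr rfl fun j _ => ?_
        rw [hψ t _ (hf t n j x ht), hF n j, smul_comm]
      rw [h1, ← hα _ _ (hL (γ t)⁻¹ t _ x ht), hφ, smul_inv_smul]

end FaceSystem

namespace FaceSystem

lemma d_lmapDomain {F F' : FaceSystem} (f : ∀ n, F.obj n → F'.obj n)
    (hf : ∀ n (j : Fin (n + 2)) x, F'.face j (f (n + 1) x) = f n (F.face j x)) (n : ℕ)
    (c : F.Chain (n + 1)) :
    F'.d n (Finsupp.lmapDomain ℤ ℤ (f (n + 1)) c) =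
      Finsupp.lmapDomain ℤ ℤ (f n) (F.d n c) := by
  suffices F'.d n ∘ₗ Finsupp.lmapDomain ℤ ℤ (f (n + 1)) =
      Finsupp.lmapDomain ℤ ℤ (f n) ∘ₗ F.d n from LinearMap.congr_fun this c
  ext x : 2
  simp only [LinearMap.comp_apply, Finsupp.lsingle_apply, Finsupp.lmapDomain_apply,
    Finsupp.mapDomain_single, d_single, hf n _ x]
  rw [← Finsupp.lmapDomain_apply ℤ ℤ, map_sum]
  simp only [map_smul, Finsupp.lmapDomain_apply, Finsupp.mapDomain_single]

/-- The sum of the coefficients of a chain. -/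
def aug (F : FaceSystem) (n : ℕ) : F.Chain n →ₗ[ℤ] ℤ :=
  Finsupp.linearCombination ℤ fun _ => 1

lemma aug_d {F : FaceSystem} (c : F.Chain 1) : F.aug 0 (F.d 0 c) = 0 := by
  rw [aug, linearCombination_d]
  have : cob (fun _ : F.obj 0 => (1 : ℤ)) = fun _ => 0 := by
    funext x
    simp [cob, Fin.sum_univ_two]
  rw [this]
  simp [Finsupp.linearCombination_apply]

lemma aug_lmapDomain {F F' : FaceSystem} {n : ℕ} (f : F.obj n → F'.obj n) (c : F.Chain n) :
    F'.aug n (Finsupp.lmapDomain ℤ ℤ f c) = F.aug n c := by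
  suffices F'.aug n ∘ₗ Finsupp.lmapDomain ℤ ℤ f = F.aug n from LinearMap.congr_fun this c
  ext x
  simp [aug, Finsupp.mapDomain_single]

end FaceSystem

open FaceSystem

lemma Fin.succ_succAbove_succAbove {n : ℕ} (i j : Fin (n + 2)) (h : i ≤ j) (k : Fin (n + 1)) :
    j.succ.succAbove (i.succAbove k) = i.castSucc.succAbove (j.succAbove k) := by
  dsimp [Fin.succAbove]
  rcases i with ⟨i, _⟩
  rcases j with ⟨j, _⟩
  rcases k with ⟨k, _⟩
  split_ifs <;> · simp at * <;> lia

/-- The semi-simplicial set of ordered tuples of elements of `K`. -/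
@[reducible] def tuples (K : Type*) : FaceSystem where
  obj n := Fin (n + 1) → K
  face j w := w ∘ j.succAbove
  face_face i j w h := by
    funext k
    exact congrArg w (Fin.succ_succAbove_succAbove i j h k)

/-- The semi-simplicial set of singular simplices of `E`. -/
@[reducible] def singularSimplices (E : Type*) [TopologicalSpace E] : FaceSystem where
  obj n := C(stdSimplex ℝ (Fin (n + 1)), E)
  face j σ := σ.comp ⟨stdSimplex.map j.succAbove, stdSimplex.continuous_map _⟩
  face_face i j σ h := by
    ext t
    simp only [ContinuousMap.comp_apply, ContinuousMap.coe_mk, stdSimplex.map_comp_apply]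
    congr 2
    funext k
    exact Fin.succ_succAbove_succAbove i j h k

section Cone

variable {K K' : Type*}

/-- The functoriality of chains of tuples. -/
def tuplesMap (f : K → K') (n : ℕ) : (tuples K).Chain n →ₗ[ℤ] (tuples K').Chain n :=
  Finsupp.lmapDomain ℤ ℤ fun w => f ∘ w

lemma tuplesMap_single (f : K → K') (n : ℕ) (w : Fin (n + 1) → K) :
    tuplesMap f n (Finsupp.single w 1) =
      (Finsupp.single (f ∘ w : Fin (n + 1) → K') 1 : (tuples K').Chain n) := by
  exact Finsupp.mapDomain_single

lemma d_tuplesMap (f : K → K') (n : ℕ) (c : (tuples K).Chain (n + 1)) :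
    (tuples K').d n (tuplesMap f (n + 1) c) = tuplesMap f n ((tuples K).d n c) :=
  d_lmapDomain (F := tuples K) (F' := tuples K') (fun _ w => f ∘ w) (fun _ _ _ => rfl) n c

/-- The cone over a chain. -/
def cone (b : K) (n : ℕ) : (tuples K).Chain n →ₗ[ℤ] (tuples K).Chain (n + 1) :=
  Finsupp.lmapDomain ℤ ℤ fun w : Fin (n + 1) → K => (Fin.cons b w : Fin (n + 2) → K)

lemma cone_single (b : K) (n : ℕ) (w : Fin (n + 1) → K) :
    cone b n (Finsupp.single w 1) =
      (Finsupp.single (Fin.cons b w : Fin (n + 2) → K) 1 : (tuples K).Chain (n + 1)) := by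
  exact Finsupp.mapDomain_single

lemma tuplesMap_cone (f : K → K') (b : K) (n : ℕ) (c : (tuples K).Chain n) :
    tuplesMap f (n + 1) (cone b n c) = cone (f b) n (tuplesMap f n c) := by
  suffices tuplesMap f (n + 1) ∘ₗ cone b n = cone (f b) n ∘ₗ tuplesMap f n from
    LinearMap.congr_fun this c
  refine Finsupp.lhom_ext' fun w => LinearMap.ext_ring ?_
  simp only [LinearMap.comp_apply, Finsupp.lsingle_apply]
  erw [cone_single, tuplesMap_single, tuplesMap_single, cone_single]
  congr 1
  exact Fin.comp_cons f b w

lemma cons_comp_succAbove_zero (b : K) {n : ℕ} (w : Fin n → K) :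
    (Fin.cons b w : Fin (n + 1) → K) ∘ Fin.succAbove 0 = w := by
  funext k; simp

lemma cons_comp_succAbove_succ (b : K) {n : ℕ} (w : Fin (n + 1) → K) (j : Fin (n + 1)) :
    (Fin.cons b w : Fin (n + 2) → K) ∘ j.succ.succAbove =
      (Fin.cons b (w ∘ j.succAbove) : Fin (n + 1) → K) := by
  funext k
  refine Fin.cases ?_ (fun k => ?_) k <;> simp

lemma d_cone (b : K) (n : ℕ) (c : (tuples K).Chain (n + 1)) :
    (tuples K).d (n + 1) (cone b (n + 1) c) = c - cone b n ((tuples K).d n c) := by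
  suffices (tuples K).d (n + 1) ∘ₗ cone b (n + 1) =
    LinearMap.id - cone b n ∘ₗ (tuples K).d n from LinearMap.congr_fun this c
  refine Finsupp.lhom_ext' fun w => LinearMap.ext_ring ?_
  simp only [LinearMap.comp_apply, Finsupp.lsingle_apply, LinearMap.sub_apply, LinearMap.id_apply]
  erw [cone_single, d_single, d_single, Fin.sum_univ_succ]
  simp only [tuples, cons_comp_succAbove_zero, cons_comp_succAbove_succ, map_sum, map_smul, Fin.val_zero, pow_zero, one_smul, Fin.val_succ]
  rw [sub_eq_add_neg, ← Finset.sum_neg_distrib]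
  congr 1
  refine Finset.sum_congr rfl fun j _ => ?_
  erw [cone_single]
  rw [pow_succ, mul_neg_one, neg_smul]

lemma d_cone_zero (b : K) (c : (tuples K).Chain 0) :
    (tuples K).d 0 (cone b 0 c) =
      c - (tuples K).aug 0 c • (Finsupp.single (fun _ => b) 1 : (tuples K).Chain 0) := by
  suffices (tuples K).d 0 ∘ₗ cone b 0 = LinearMap.id -
      ((tuples K).aug 0).smulRight (Finsupp.single (fun _ => b) 1 : (tuples K).Chain 0) from
    LinearMap.congr_fun this c
  refine Finsupp.lhom_ext' fun w => LinearMap.ext_ring ?_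
  simp only [LinearMap.comp_apply, Finsupp.lsingle_apply, LinearMap.sub_apply, LinearMap.id_apply,
    LinearMap.smulRight_apply]
  erw [cone_single, d_single, Fin.sum_univ_two]
  have h0 : (tuples K).face 0 (Fin.cons b w : Fin 2 → K) = w := cons_comp_succAbove_zero b w
  have : (tuples K).face 1 (Fin.cons b w : Fin 2 → K) = (fun _ => b) := by
    funext k
    fin_cases k
    rfl
  rw [this, h0]
  simp [aug, sub_eq_add_neg]

/-- The chain homotopy between zero and a chain map `D` constructed by coning. -/
def coneHomotopy (D : ∀ n, (tuples K).Chain n →ₗ[ℤ] (tuples K').Chain n)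
    (pt : ∀ n, (Fin (n + 1) → K) → K') :
    ∀ n, (tuples K).Chain n →ₗ[ℤ] (tuples K').Chain (n + 1)
  | 0 => Finsupp.linearCombination ℤ fun w => cone (pt 0 w) 0 (D 0 (Finsupp.single w 1))
  | n + 1 => Finsupp.linearCombination ℤ fun w => cone (pt (n + 1) w) (n + 1)
      (D (n + 1) (Finsupp.single w 1)
        - coneHomotopy D pt n ((tuples K).d n (Finsupp.single w 1)))

section
variable {D : ∀ n, (tuples K).Chain n →ₗ[ℤ] (tuples K').Chain n}
  {pt : ∀ n, (Fin (n + 1) → K) → K'}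

lemma d_coneHomotopy_zero (haug : ∀ c, (tuples K').aug 0 (D 0 c) = 0) (c : (tuples K).Chain 0) :
    (tuples K').d 0 (coneHomotopy D pt 0 c) = D 0 c := by
  suffices (tuples K').d 0 ∘ₗ coneHomotopy D pt 0 = D 0 from LinearMap.congr_fun this c
  refine Finsupp.lhom_ext' fun w => LinearMap.ext_ring ?_
  simp only [coneHomotopy, LinearMap.comp_apply, Finsupp.lsingle_apply,
    Finsupp.linearCombination_single, one_smul]
  rw [d_cone_zero, haug, zero_smul, sub_zero]

lemma d_coneHomotopy (haug : ∀ c, (tuples K').aug 0 (D 0 c) = 0)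
    (hD : ∀ n c, (tuples K').d n (D (n + 1) c) = D n ((tuples K).d n c)) (n : ℕ)
    (c : (tuples K).Chain (n + 1)) :
    (tuples K').d (n + 1) (coneHomotopy D pt (n + 1) c) =
      D (n + 1) c - coneHomotopy D pt n ((tuples K).d n c) := by
  suffices (tuples K').d (n + 1) ∘ₗ coneHomotopy D pt (n + 1) =
    D (n + 1) - coneHomotopy D pt n ∘ₗ (tuples K).d n from LinearMap.congr_fun this c
  induction n with
  | zero =>
    refine Finsupp.lhom_ext' fun w => LinearMap.ext_ring ?_
    simp only [coneHomotopy, LinearMap.comp_apply, Finsupp.lsingle_apply,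
      Finsupp.linearCombination_single, one_smul, LinearMap.sub_apply]
    rw [d_cone, map_sub, hD]
    have := d_coneHomotopy_zero (pt := pt) haug ((tuples K).d 0 (Finsupp.single w 1))
    simp only [coneHomotopy] at this
    rw [this, sub_self, map_zero, sub_zero]
  | succ n ih =>
    refine Finsupp.lhom_ext' fun w => LinearMap.ext_ring ?_
    rw [LinearMap.comp_apply, coneHomotopy]
    simp only [LinearMap.comp_apply, Finsupp.lsingle_apply,
      Finsupp.linearCombination_single, one_smul, LinearMap.sub_apply]
    rw [d_cone, map_sub, hD]
    have := LinearMap.congr_fun (ih ((tuples K).d _ (Finsupp.single w 1)))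
      ((tuples K).d _ (Finsupp.single w 1))
    simp only [LinearMap.comp_apply, LinearMap.sub_apply, d_d, map_zero, sub_zero] at this
    rw [this, sub_self, map_zero, sub_zero]

lemma tuplesMap_coneHomotopy {L L' : Type*}
    {D' : ∀ n, (tuples L).Chain n →ₗ[ℤ] (tuples L').Chain n}
    {pt' : ∀ n, (Fin (n + 1) → L) → L'} (f : K → L) (f' : K' → L')
    (hpt : ∀ n w, f' (pt n w) = pt' n (f ∘ w))
    (hD : ∀ n c, tuplesMap f' n (D n c) = D' n (tuplesMap f n c)) (n : ℕ)
    (c : (tuples K).Chain n) :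
    tuplesMap f' (n + 1) (coneHomotopy D pt n c) = coneHomotopy D' pt' n (tuplesMap f n c) := by
  suffices tuplesMap f' (n + 1) ∘ₗ coneHomotopy D pt n = coneHomotopy D' pt' n ∘ₗ tuplesMap f n from
    LinearMap.congr_fun this c
  induction n with
  | zero =>
    refine Finsupp.lhom_ext' fun w => LinearMap.ext_ring ?_
    simp only [LinearMap.comp_apply, Finsupp.lsingle_apply]
    erw [tuplesMap_single]
    simp only [coneHomotopy, Finsupp.linearCombination_single, one_smul]
    rw [tuplesMap_cone, hD, hpt]
    erw [tuplesMap_single]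
  | succ n ih =>
    refine Finsupp.lhom_ext' fun w => LinearMap.ext_ring ?_
    simp only [LinearMap.comp_apply, Finsupp.lsingle_apply]
    erw [tuplesMap_single]
    rw [coneHomotopy, coneHomotopy]
    simp only [Finsupp.linearCombination_single, one_smul]
    rw [tuplesMap_cone, hpt, map_sub, hD]
    have := LinearMap.congr_fun (ih ((tuples K).d _ (Finsupp.single w 1)))
      ((tuples K).d _ (Finsupp.single w 1))
    simp only [LinearMap.comp_apply] at this
    rw [this, ← d_tuplesMap]
    erw [tuplesMap_single]

end

end Cone

/-- A topological space with convex combinations. -/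
class ConvexStruct (K : Type*) [TopologicalSpace K] where
  comb : ∀ {n : ℕ}, stdSimplex ℝ (Fin (n + 1)) → (Fin (n + 1) → K) → K
  continuous_comb : ∀ {n : ℕ} (w : Fin (n + 1) → K), Continuous fun t => comb t w
  comb_map_succAbove : ∀ {n : ℕ} (j : Fin (n + 2)) (t : stdSimplex ℝ (Fin (n + 1)))
    (w : Fin (n + 2) → K), comb (stdSimplex.map j.succAbove t) w = comb t (w ∘ j.succAbove)

lemma stdSimplex.sum_map_smul {n m : ℕ} (f : Fin n → Fin m) (t : stdSimplex ℝ (Fin n))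
    {V : Type*} [AddCommGroup V] [Module ℝ V] (w : Fin m → V) :
    ∑ k, (stdSimplex.map f t) k • w k = ∑ i, t i • w (f i) := by
  simp only [stdSimplex.map_coe, FunOnFinite.linearMap_apply_apply, Finset.sum_smul]
  rw [← Finset.sum_fiberwise Finset.univ f]
  refine Finset.sum_congr rfl fun k _ => Finset.sum_congr (by ext; simp) fun i hi => ?_
  rw [(by simpa using hi : f i = k)]

/-- The convex combinations in a convex set. -/
@[reducible]
def ConvexStruct.ofConvex {V : Type*} [AddCommGroup V] [Module ℝ V] [TopologicalSpace V]
    [ContinuousAdd V] [ContinuousSMul ℝ V] {s : Set V} (hs : Convex ℝ s) : ConvexStruct s where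
  comb t w := ⟨∑ i, t i • (w i : V), hs.sum_mem (fun i _ => t.2.1 i) t.2.2 fun i _ => (w i).2⟩
  continuous_comb w := by
    refine Continuous.subtype_mk (continuous_finset_sum _ fun i _ => ?_) _
    exact ((continuous_apply i).comp continuous_subtype_val).smul continuous_const
  comb_map_succAbove j t w := Subtype.ext (stdSimplex.sum_map_smul j.succAbove t fun i => (w i : V))

instance (m : ℕ) : ConvexStruct (stdSimplex ℝ (Fin (m + 1))) :=
  ConvexStruct.ofConvex (convex_stdSimplex ℝ _)

instance : ConvexStruct unitInterval := ConvexStruct.ofConvex (convex_Icc 0 1)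

instance {K L : Type*} [TopologicalSpace K] [TopologicalSpace L] [ConvexStruct K]
    [ConvexStruct L] : ConvexStruct (K × L) where
  comb t w := (ConvexStruct.comb t fun i => (w i).1, ConvexStruct.comb t fun i => (w i).2)
  continuous_comb w := (ConvexStruct.continuous_comb _).prodMk (ConvexStruct.continuous_comb _)
  comb_map_succAbove j t w := by
    rw [ConvexStruct.comb_map_succAbove, ConvexStruct.comb_map_succAbove]; rfl

namespace ConvexStruct

variable {K L E : Type*} [TopologicalSpace K] [TopologicalSpace L] [TopologicalSpace E]
  [ConvexStruct K] [ConvexStruct L]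

/-- The affine simplex with given vertices. -/
def affineSimplex {n : ℕ} (w : Fin (n + 1) → K) : C(stdSimplex ℝ (Fin (n + 1)), K) :=
  ⟨fun t => comb t w, continuous_comb w⟩

/-- Maps preserving convex combinations. -/
def IsAff (f : K → L) : Prop :=
  ∀ (n : ℕ) (t : stdSimplex ℝ (Fin (n + 1))) (w : Fin (n + 1) → K), f (comb t w) = comb t (f ∘ w)

lemma comb_coe {n m : ℕ} (t : stdSimplex ℝ (Fin (n + 1)))
    (w : Fin (n + 1) → stdSimplex ℝ (Fin (m + 1))) (k : Fin (m + 1)) :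
    (comb t w) k = ∑ i, t i * w i k := by
  change (∑ i, t i • (w i : Fin (m + 1) → ℝ)) k = _
  simp only [Finset.sum_apply, Pi.smul_apply, smul_eq_mul]

lemma isAff_affineSimplex {n m : ℕ} (w : Fin (n + 1) → stdSimplex ℝ (Fin (m + 1))) :
    IsAff (affineSimplex w) := fun l t s => by
  ext k
  change comb (comb t s) w k = comb t (fun i => comb (s i) w) k
  simp only [comb_coe, Finset.sum_mul, Finset.mul_sum]
  rw [Finset.sum_comm]
  simp only [mul_assoc]

/-- The vertices of the standard simplex. -/
def vertices (n : ℕ) : Fin (n + 1) → stdSimplex ℝ (Fin (n + 1)) := fun i => stdSimplex.vertex i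

lemma comb_vertices {n : ℕ} (t : stdSimplex ℝ (Fin (n + 1))) : comb t (vertices n) = t := by
  ext k
  rw [comb_coe, Finset.sum_eq_single k]
  · simp [vertices]
  · intro i _ hi
    simp [vertices, hi.symm]
  · simp

lemma affineSimplex_vertices (n : ℕ) : affineSimplex (vertices n) = ContinuousMap.id _ := by
  ext1 t; exact comb_vertices t

lemma comb_vertex {m : ℕ} {n : ℕ} (w : Fin (n + 1) → stdSimplex ℝ (Fin (m + 1)))
    (i : Fin (n + 1)) : comb (vertices n i) w = w i := by
  ext k
  rw [comb_coe, Finset.sum_eq_single i]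
  · simp [vertices]
  · intro j _ hj
    simp [vertices, hj]
  · simp

/-- The coface map of the standard simplex. -/
def coface {n : ℕ} (j : Fin (n + 2)) :
    C(stdSimplex ℝ (Fin (n + 1)), stdSimplex ℝ (Fin (n + 2))) :=
  ⟨stdSimplex.map j.succAbove, stdSimplex.continuous_map _⟩

lemma coface_eq {n : ℕ} (j : Fin (n + 2)) :
    coface j = affineSimplex (vertices (n + 1) ∘ j.succAbove) := by
  ext1 t
  change stdSimplex.map j.succAbove t = comb t _
  rw [← comb_map_succAbove, comb_vertices]

lemma isAff_coface {n : ℕ} (j : Fin (n + 2)) : IsAff (coface j) := by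
  rw [coface_eq]; exact isAff_affineSimplex _

lemma coface_comp_vertices {n : ℕ} (j : Fin (n + 2)) :
    coface j ∘ vertices n = vertices (n + 1) ∘ j.succAbove := by
  rw [coface_eq]
  funext i
  exact comb_vertex _ _

/-- The singular chain realizing a chain of tuples. -/
def realize (f : C(K, E)) (n : ℕ) : (tuples K).Chain n →ₗ[ℤ] (singularSimplices E).Chain n :=
  Finsupp.lmapDomain ℤ ℤ fun w => f.comp (affineSimplex w)

lemma realize_single (f : C(K, E)) (n : ℕ) (w : Fin (n + 1) → K) :
    realize f n (Finsupp.single w 1) = Finsupp.single (f.comp (affineSimplex w)) 1 :=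
  Finsupp.mapDomain_single

lemma realize_vertices {n : ℕ} (σ : C(stdSimplex ℝ (Fin (n + 1)), E)) :
    realize σ n (Finsupp.single (vertices n) 1) = Finsupp.single σ 1 := by
  rw [realize_single, affineSimplex_vertices, ContinuousMap.comp_id]

lemma d_realize (f : C(K, E)) (n : ℕ) (c : (tuples K).Chain (n + 1)) :
    (singularSimplices E).d n (realize f (n + 1) c) = realize f n ((tuples K).d n c) :=
  d_lmapDomain (F := tuples K) (F' := singularSimplices E)
    (fun _ w => f.comp (affineSimplex w))
    (fun n j w => by
      ext t
      exact congrArg f (comb_map_succAbove j t w)) n c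

lemma realize_tuplesMap (f : C(L, E)) (g : C(K, L)) (hg : IsAff g) (n : ℕ)
    (c : (tuples K).Chain n) : realize f n (tuplesMap g n c) = realize (f.comp g) n c := by
  suffices realize f n ∘ₗ tuplesMap g n = realize (f.comp g) n from LinearMap.congr_fun this c
  refine Finsupp.lhom_ext' fun w => LinearMap.ext_ring ?_
  simp only [LinearMap.comp_apply, Finsupp.lsingle_apply]
  erw [tuplesMap_single, realize_single, realize_single]
  congr 1
  ext t
  exact congrArg f (hg n t w).symm

/-- The singular simplices with image in a given set. -/
def _root_.simplicesIn {E : Type*} [TopologicalSpace E] (X : Set E) (n : ℕ) :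
    Set ((singularSimplices E).obj n) := {σ | ∀ t, σ t ∈ X}

lemma _root_.faceClosed_simplicesIn (X : Set E) : FaceClosed (simplicesIn X) :=
  fun _ _ _ hσ _ => hσ _

lemma realize_mem (f : C(K, E)) {X : Set E} (hf : ∀ x, f x ∈ X) (n : ℕ)
    (c : (tuples K).Chain n) : realize f n c ∈ chainsIn (simplicesIn X) n := by
  have : c ∈ chainsIn (F := tuples K) (fun _ => Set.univ) n := by simp
  refine map_mem_of_chainsIn _ _ (fun w _ => ?_) this
  rw [realize_single]
  exact single_mem_chainsIn (L := simplicesIn X) (fun t => hf _) 1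

section Operators

variable {X : ℕ → Type*} [∀ m, TopologicalSpace (X m)] [∀ m, ConvexStruct (X m)]
  {E' : Type*} [TopologicalSpace E'] {r : ℕ}

/-- The operator on singular chains induced by a natural operator on chains of tuples. -/
def singularOp (Φ : ∀ m, C(stdSimplex ℝ (Fin (m + 1)), E) → C(X m, E'))
    (Θ : ∀ m n, (tuples (stdSimplex ℝ (Fin (m + 1)))).Chain n →ₗ[ℤ] (tuples (X m)).Chain (n + r))
    (n : ℕ) : (singularSimplices E).Chain n →ₗ[ℤ] (singularSimplices E').Chain (n + r) :=
  Finsupp.linearCombination ℤ fun σ =>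
    realize (Φ n σ) (n + r) (Θ n n (Finsupp.single (vertices n) 1))

lemma singularOp_single (Φ : ∀ m, C(stdSimplex ℝ (Fin (m + 1)), E) → C(X m, E'))
    (Θ : ∀ m n, (tuples (stdSimplex ℝ (Fin (m + 1)))).Chain n →ₗ[ℤ] (tuples (X m)).Chain (n + r))
    (n : ℕ) (σ : C(stdSimplex ℝ (Fin (n + 1)), E)) :
    singularOp Φ Θ n (Finsupp.single σ 1) =
      realize (Φ n σ) (n + r) (Θ n n (Finsupp.single (vertices n) 1)) := by
  simp [singularOp]

lemma singularOp_d (Φ : ∀ m, C(stdSimplex ℝ (Fin (m + 1)), E) → C(X m, E'))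
    (Θ : ∀ m n, (tuples (stdSimplex ℝ (Fin (m + 1)))).Chain n →ₗ[ℤ] (tuples (X m)).Chain (n + r))
    (κ : ∀ m, Fin (m + 2) → C(X m, X (m + 1))) (hκ : ∀ m j, IsAff (κ m j))
    (hΦ : ∀ m j σ, Φ m (σ.comp (coface j)) = (Φ (m + 1) σ).comp (κ m j))
    (hΘ : ∀ m n j c, tuplesMap (κ m j) (n + r) (Θ m n c) =
      Θ (m + 1) n (tuplesMap (coface j) n c))
    (n : ℕ) (σ : C(stdSimplex ℝ (Fin (n + 2)), E)) :
    singularOp Φ Θ n ((singularSimplices E).d n (Finsupp.single σ 1)) =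
      realize (Φ (n + 1) σ) (n + r) (Θ (n + 1) n ((tuples _).d n
        (Finsupp.single (vertices (n + 1)) 1))) := by
  rw [d_single, d_single]
  simp only [map_sum, map_smul]
  refine Finset.sum_congr rfl fun j _ => ?_
  congr 1
  erw [singularOp_single, hΦ, ← realize_tuplesMap _ _ (hκ n j), hΘ, tuplesMap_single,
    coface_comp_vertices]

lemma singularOp_mem (Φ : ∀ m, C(stdSimplex ℝ (Fin (m + 1)), E) → C(X m, E'))
    (Θ : ∀ m n, (tuples (stdSimplex ℝ (Fin (m + 1)))).Chain n →ₗ[ℤ] (tuples (X m)).Chain (n + r))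
    {A : Set E} {B : Set E'} (h : ∀ m σ, (∀ t, σ t ∈ A) → ∀ x, Φ m σ x ∈ B) {n : ℕ}
    {c : (singularSimplices E).Chain n} (hc : c ∈ chainsIn (simplicesIn A) n) :
    singularOp Φ Θ n c ∈ chainsIn (simplicesIn B) (n + r) := by
  refine map_mem_of_chainsIn _ _ (fun σ hσ => ?_) hc
  rw [singularOp_single]
  exact realize_mem _ (h n σ hσ) _ _

end Operators

end ConvexStruct

namespace ConvexStruct

section Subdivision
variable {K L : Type*} [TopologicalSpace K] [TopologicalSpace L] [ConvexStruct K] [ConvexStruct L]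

/-- The barycenter of a tuple. -/
def bary {n : ℕ} (w : Fin (n + 1) → K) : K := comb stdSimplex.barycenter w

/-- Barycentric subdivision of chains of tuples. -/
def subdiv (K : Type*) [TopologicalSpace K] [ConvexStruct K] :
    ∀ n, (tuples K).Chain n →ₗ[ℤ] (tuples K).Chain n
  | 0 => LinearMap.id
  | n + 1 => Finsupp.linearCombination ℤ fun w => cone (bary w) n
      (subdiv K n ((tuples K).d n (Finsupp.single w 1)))

lemma subdiv_succ_single (n : ℕ) (w : Fin (n + 2) → K) :
    subdiv K (n + 1) (Finsupp.single w 1) =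
      cone (bary w) n (subdiv K n ((tuples K).d n (Finsupp.single w 1))) := by
  simp [subdiv]

lemma d_subdiv (n : ℕ) (c : (tuples K).Chain (n + 1)) :
    (tuples K).d n (subdiv K (n + 1) c) = subdiv K n ((tuples K).d n c) := by
  suffices (tuples K).d n ∘ₗ subdiv K (n + 1) = subdiv K n ∘ₗ (tuples K).d n from
    LinearMap.congr_fun this c
  induction n with
  | zero =>
    refine Finsupp.lhom_ext' fun w => LinearMap.ext_ring ?_
    simp only [LinearMap.comp_apply, Finsupp.lsingle_apply]
    rw [subdiv_succ_single, d_cone_zero]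
    simp only [subdiv, LinearMap.id_apply]
    rw [aug_d, zero_smul, sub_zero]
  | succ n ih =>
    refine Finsupp.lhom_ext' fun w => LinearMap.ext_ring ?_
    simp only [LinearMap.comp_apply, Finsupp.lsingle_apply]
    rw [subdiv_succ_single, d_cone]
    have := LinearMap.congr_fun (ih ((tuples K).d _ (Finsupp.single w 1)))
      ((tuples K).d _ (Finsupp.single w 1))
    simp only [LinearMap.comp_apply, d_d, map_zero] at this
    rw [this, map_zero, sub_zero]

lemma tuplesMap_subdiv (f : K → L) (hf : IsAff f) (n : ℕ) (c : (tuples K).Chain n) :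
    tuplesMap f n (subdiv K n c) = subdiv L n (tuplesMap f n c) := by
  suffices tuplesMap f n ∘ₗ subdiv K n = subdiv L n ∘ₗ tuplesMap f n from
    LinearMap.congr_fun this c
  induction n with
  | zero => rfl
  | succ n ih =>
    refine Finsupp.lhom_ext' fun w => LinearMap.ext_ring ?_
    simp only [LinearMap.comp_apply, Finsupp.lsingle_apply]
    rw [subdiv_succ_single, tuplesMap_single, subdiv_succ_single, tuplesMap_cone]
    have := LinearMap.congr_fun (ih ((tuples K).d _ (Finsupp.single w 1)))
      ((tuples K).d _ (Finsupp.single w 1))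
    simp only [LinearMap.comp_apply] at this
    rw [this, ← d_tuplesMap, tuplesMap_single]
    exact congrArg (fun b => cone b n _) (hf _ _ _)

/-- The chain homotopy between the identity and the subdivision. -/
def subdivHomotopy (K : Type*) [TopologicalSpace K] [ConvexStruct K] :
    ∀ n, (tuples K).Chain n →ₗ[ℤ] (tuples K).Chain (n + 1) :=
  coneHomotopy (fun n => LinearMap.id - subdiv K n) fun _ w => w 0

lemma d_subdivHomotopy_zero (c : (tuples K).Chain 0) :
    (tuples K).d 0 (subdivHomotopy K 0 c) = c - subdiv K 0 c :=
  d_coneHomotopy_zero (D := fun n => LinearMap.id - subdiv K n) (fun c => by simp [subdiv]) c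

lemma d_subdivHomotopy (n : ℕ) (c : (tuples K).Chain (n + 1)) :
    (tuples K).d (n + 1) (subdivHomotopy K (n + 1) c) =
      c - subdiv K (n + 1) c - subdivHomotopy K n ((tuples K).d n c) :=
  d_coneHomotopy (D := fun n => LinearMap.id - subdiv K n) (fun c => by simp [subdiv])
    (fun n c => by simp [d_subdiv]) n c

lemma tuplesMap_subdivHomotopy (f : K → L) (hf : IsAff f) (n : ℕ) (c : (tuples K).Chain n) :
    tuplesMap f (n + 1) (subdivHomotopy K n c) = subdivHomotopy L n (tuplesMap f n c) :=
  tuplesMap_coneHomotopy _ _ (fun _ _ => rfl) (fun n c => by simp [tuplesMap_subdiv f hf]) n c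

/-- The chain homotopy between the two ends of a cylinder. -/
def prism (K : Type*) : ∀ n, (tuples K).Chain n →ₗ[ℤ] (tuples (K × unitInterval)).Chain (n + 1) :=
  coneHomotopy (fun n => tuplesMap (fun x => (x, (1 : unitInterval))) n
    - tuplesMap (fun x => (x, (0 : unitInterval))) n) fun _ w => (w 0, 0)

lemma aug_prism_diff {K : Type*} (c : (tuples K).Chain 0) :
    (tuples (K × unitInterval)).aug 0 ((tuplesMap (fun x : K => (x, (1 : unitInterval))) 0
      - tuplesMap (fun x : K => (x, (0 : unitInterval))) 0) c) = 0 := by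
  rw [LinearMap.sub_apply, map_sub]
  have h := fun i : unitInterval => aug_lmapDomain (F := tuples K) (F' := tuples (K × unitInterval))
    (n := 0) (fun w => (fun x => (x, i)) ∘ w) c
  exact sub_eq_zero.mpr ((h 1).trans (h 0).symm)

lemma d_prism_zero {K : Type*} (c : (tuples K).Chain 0) :
    (tuples (K × unitInterval)).d 0 (prism K 0 c) =
      tuplesMap (fun x => (x, (1 : unitInterval))) 0 c
        - tuplesMap (fun x => (x, (0 : unitInterval))) 0 c :=
  d_coneHomotopy_zero (D := fun n => tuplesMap (fun x => (x, (1 : unitInterval))) n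
    - tuplesMap (fun x => (x, (0 : unitInterval))) n) aug_prism_diff c

lemma d_prism {K : Type*} (n : ℕ) (c : (tuples K).Chain (n + 1)) :
    (tuples (K × unitInterval)).d (n + 1) (prism K (n + 1) c) =
      tuplesMap (fun x => (x, (1 : unitInterval))) (n + 1) c
        - tuplesMap (fun x => (x, (0 : unitInterval))) (n + 1) c
        - prism K n ((tuples K).d n c) :=
  d_coneHomotopy (D := fun n => tuplesMap (fun x => (x, (1 : unitInterval))) n
    - tuplesMap (fun x => (x, (0 : unitInterval))) n) aug_prism_diff
    (fun n c => by rw [LinearMap.sub_apply, map_sub, d_tuplesMap, d_tuplesMap]; rfl) n c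

lemma tuplesMap_comp {K L M : Type*} (f : K → L) (g : L → M) (n : ℕ) (c : (tuples K).Chain n) :
    tuplesMap g n (tuplesMap f n c) = tuplesMap (g ∘ f) n c := by
  suffices tuplesMap g n ∘ₗ tuplesMap f n = tuplesMap (g ∘ f) n from LinearMap.congr_fun this c
  refine Finsupp.lhom_ext' fun w => LinearMap.ext_ring ?_
  simp only [LinearMap.comp_apply, Finsupp.lsingle_apply]
  rw [tuplesMap_single, tuplesMap_single, tuplesMap_single]
  rfl

lemma tuplesMap_prism {K L : Type*} (f : K → L) (n : ℕ) (c : (tuples K).Chain n) :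
    tuplesMap (Prod.map f id) (n + 1) (prism K n c) = prism L n (tuplesMap f n c) :=
  tuplesMap_coneHomotopy _ _ (fun _ _ => rfl)
    (fun n c => by simp only [LinearMap.sub_apply, map_sub, tuplesMap_comp]; rfl) n c

end Subdivision

section Singular
variable {E E' : Type*} [TopologicalSpace E] [TopologicalSpace E']

/-- Subdivision of singular chains. -/
def singularSubdiv (E : Type*) [TopologicalSpace E] (n : ℕ) :
    (singularSimplices E).Chain n →ₗ[ℤ] (singularSimplices E).Chain n :=
  singularOp (r := 0) (X := fun m => stdSimplex ℝ (Fin (m + 1))) (fun _ σ => σ)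
    (fun m n => subdiv _ n) n

/-- The homotopy between the identity and the subdivision of singular chains. -/
def singularSubdivHomotopy (E : Type*) [TopologicalSpace E] (n : ℕ) :
    (singularSimplices E).Chain n →ₗ[ℤ] (singularSimplices E).Chain (n + 1) :=
  singularOp (r := 1) (X := fun m => stdSimplex ℝ (Fin (m + 1))) (fun _ σ => σ)
    (fun m n => subdivHomotopy _ n) n

lemma d_singularSubdiv (n : ℕ) (c : (singularSimplices E).Chain (n + 1)) :
    (singularSimplices E).d n (singularSubdiv E (n + 1) c) =
      singularSubdiv E n ((singularSimplices E).d n c) := by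
  suffices (singularSimplices E).d n ∘ₗ singularSubdiv E (n + 1) =
    singularSubdiv E n ∘ₗ (singularSimplices E).d n from LinearMap.congr_fun this c
  refine Finsupp.lhom_ext' fun σ => LinearMap.ext_ring ?_
  simp only [LinearMap.comp_apply, Finsupp.lsingle_apply, singularSubdiv]
  rw [singularOp_d _ _ (fun _ => coface) (fun _ => isAff_coface) (fun _ _ _ => rfl)
    (fun m n j c => tuplesMap_subdiv _ (isAff_coface j) n c), singularOp_single]
  exact (d_realize _ _ _).trans (by rw [d_subdiv]; rfl)

lemma d_singularSubdivHomotopy_zero (c : (singularSimplices E).Chain 0) :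
    (singularSimplices E).d 0 (singularSubdivHomotopy E 0 c) = c - singularSubdiv E 0 c := by
  suffices (singularSimplices E).d 0 ∘ₗ singularSubdivHomotopy E 0 =
    LinearMap.id - singularSubdiv E 0 from LinearMap.congr_fun this c
  refine Finsupp.lhom_ext' fun σ => LinearMap.ext_ring ?_
  simp only [LinearMap.comp_apply, Finsupp.lsingle_apply, singularSubdivHomotopy, singularSubdiv,
    LinearMap.sub_apply, LinearMap.id_apply]
  rw [singularOp_single, singularOp_single]
  refine (d_realize _ _ _).trans ?_
  rw [d_subdivHomotopy_zero, map_sub, realize_vertices]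

lemma d_singularSubdivHomotopy (n : ℕ) (c : (singularSimplices E).Chain (n + 1)) :
    (singularSimplices E).d (n + 1) (singularSubdivHomotopy E (n + 1) c) =
      c - singularSubdiv E (n + 1) c
        - singularSubdivHomotopy E n ((singularSimplices E).d n c) := by
  suffices (singularSimplices E).d (n + 1) ∘ₗ singularSubdivHomotopy E (n + 1) =
    LinearMap.id - singularSubdiv E (n + 1) -
      singularSubdivHomotopy E n ∘ₗ (singularSimplices E).d n from LinearMap.congr_fun this c
  refine Finsupp.lhom_ext' fun σ => LinearMap.ext_ring ?_
  simp only [LinearMap.comp_apply, Finsupp.lsingle_apply, singularSubdivHomotopy, singularSubdiv,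
    LinearMap.sub_apply, LinearMap.id_apply]
  rw [singularOp_d _ _ (fun _ => coface) (fun _ => isAff_coface) (fun _ _ _ => rfl)
    (fun m n j c => tuplesMap_subdivHomotopy _ (isAff_coface j) n c), singularOp_single,
    singularOp_single]
  refine (d_realize _ _ _).trans ?_
  rw [d_subdivHomotopy, map_sub, map_sub, realize_vertices]

lemma singularSubdiv_realize {m : ℕ} (f : C(stdSimplex ℝ (Fin (m + 1)), E)) (n : ℕ)
    (c : (tuples (stdSimplex ℝ (Fin (m + 1)))).Chain n) :
    singularSubdiv E n (realize f n c) = realize f n (subdiv _ n c) := by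
  suffices singularSubdiv E n ∘ₗ realize f n = realize f n ∘ₗ subdiv _ n from
    LinearMap.congr_fun this c
  refine Finsupp.lhom_ext' fun w => LinearMap.ext_ring ?_
  simp only [LinearMap.comp_apply, Finsupp.lsingle_apply, singularSubdiv]
  have h : tuplesMap (affineSimplex w) n (Finsupp.single (vertices n) 1) = Finsupp.single w 1 := by
    rw [tuplesMap_single]
    congr 1
    funext i
    exact comb_vertex w i
  rw [realize_single, singularOp_single, ← realize_tuplesMap _ _ (isAff_affineSimplex w)]
  refine congrArg _ ((tuplesMap_subdiv _ (isAff_affineSimplex w) _ _).trans ?_)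
  exact congrArg (subdiv _ n) h

lemma singularSubdiv_mem {X : Set E} {n : ℕ} {c : (singularSimplices E).Chain n}
    (hc : c ∈ chainsIn (simplicesIn X) n) : singularSubdiv E n c ∈ chainsIn (simplicesIn X) n :=
  singularOp_mem (r := 0) _ _ (fun _ _ h => h) hc

lemma singularSubdivHomotopy_mem {X : Set E} {n : ℕ} {c : (singularSimplices E).Chain n}
    (hc : c ∈ chainsIn (simplicesIn X) n) :
    singularSubdivHomotopy E n c ∈ chainsIn (simplicesIn X) (n + 1) :=
  singularOp_mem (r := 1) _ _ (fun _ _ h => h) hc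

/-- The cylinder of a singular simplex, composed with a homotopy. -/
def cylinder (F : C(E × unitInterval, E')) {m : ℕ} (σ : C(stdSimplex ℝ (Fin (m + 1)), E)) :
    C(stdSimplex ℝ (Fin (m + 1)) × unitInterval, E') :=
  F.comp (σ.prodMap (ContinuousMap.id _))

/-- The prism operator of a homotopy. -/
def singularPrism (F : C(E × unitInterval, E')) (n : ℕ) :
    (singularSimplices E).Chain n →ₗ[ℤ] (singularSimplices E').Chain (n + 1) :=
  singularOp (r := 1) (X := fun m => stdSimplex ℝ (Fin (m + 1)) × unitInterval)
    (fun _ σ => cylinder F σ) (fun m n => prism _ n) n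

/-- The map on singular chains induced by a continuous map. -/
def singularMap (f : C(E, E')) (n : ℕ) :
    (singularSimplices E).Chain n →ₗ[ℤ] (singularSimplices E').Chain n :=
  Finsupp.lmapDomain ℤ ℤ fun σ => f.comp σ

lemma singularMap_single (f : C(E, E')) (n : ℕ) (σ : C(stdSimplex ℝ (Fin (n + 1)), E)) :
    singularMap f n (Finsupp.single σ 1) = Finsupp.single (f.comp σ) 1 :=
  Finsupp.mapDomain_single

lemma d_singularMap (f : C(E, E')) (n : ℕ) (c : (singularSimplices E).Chain (n + 1)) :
    (singularSimplices E').d n (singularMap f (n + 1) c) =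
      singularMap f n ((singularSimplices E).d n c) :=
  d_lmapDomain (F := singularSimplices E) (F' := singularSimplices E')
    (fun _ σ => f.comp σ) (fun _ _ _ => rfl) n c

/-- The end of a homotopy. -/
def homotopyAt (F : C(E × unitInterval, E')) (i : unitInterval) : C(E, E') :=
  F.comp ((ContinuousMap.id E).prodMk (ContinuousMap.const E i))

lemma realize_cylinder_slice (F : C(E × unitInterval, E')) {n : ℕ}
    (σ : C(stdSimplex ℝ (Fin (n + 1)), E)) (i : unitInterval) :
    realize (cylinder F σ) n (tuplesMap (fun x => (x, i)) n (Finsupp.single (vertices n) 1)) =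
      Finsupp.single ((homotopyAt F i).comp σ) 1 := by
  rw [tuplesMap_single, realize_single]
  congr 1
  ext t
  change F (σ (comb t (vertices n)), comb t fun _ => i) = F (σ t, i)
  rw [comb_vertices]
  congr 2
  ext
  change ∑ k, t k • (i : ℝ) = i
  rw [← Finset.sum_smul, stdSimplex.sum_eq_one, one_smul]

lemma d_singularPrism_zero (F : C(E × unitInterval, E')) (c : (singularSimplices E).Chain 0) :
    (singularSimplices E').d 0 (singularPrism F 0 c) =
      singularMap (homotopyAt F 1) 0 c - singularMap (homotopyAt F 0) 0 c := by
  suffices (singularSimplices E').d 0 ∘ₗ singularPrism F 0 =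
    singularMap (homotopyAt F 1) 0 - singularMap (homotopyAt F 0) 0 from
    LinearMap.congr_fun this c
  refine Finsupp.lhom_ext' fun σ => LinearMap.ext_ring ?_
  simp only [LinearMap.comp_apply, Finsupp.lsingle_apply, singularPrism, LinearMap.sub_apply]
  rw [singularOp_single]
  refine (d_realize _ _ _).trans ?_
  rw [d_prism_zero, map_sub, realize_cylinder_slice, realize_cylinder_slice]
  rw [singularMap_single, singularMap_single]

lemma d_singularPrism (F : C(E × unitInterval, E')) (n : ℕ)
    (c : (singularSimplices E).Chain (n + 1)) :
    (singularSimplices E').d (n + 1) (singularPrism F (n + 1) c) =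
      singularMap (homotopyAt F 1) (n + 1) c - singularMap (homotopyAt F 0) (n + 1) c
        - singularPrism F n ((singularSimplices E).d n c) := by
  suffices (singularSimplices E').d (n + 1) ∘ₗ singularPrism F (n + 1) =
    singularMap (homotopyAt F 1) (n + 1) - singularMap (homotopyAt F 0) (n + 1)
      - singularPrism F n ∘ₗ (singularSimplices E).d n from LinearMap.congr_fun this c
  refine Finsupp.lhom_ext' fun σ => LinearMap.ext_ring ?_
  have h1 := singularOp_d (r := 1) (X := fun m => stdSimplex ℝ (Fin (m + 1)) × unitInterval)
    (fun _ σ => cylinder F σ) (fun m n => prism _ n)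
    (fun _ j => (coface j).prodMap (ContinuousMap.id _))
    (fun _ j n t w => Prod.ext (isAff_coface j n t _) rfl) (fun _ _ _ => rfl)
    (fun m n j c => tuplesMap_prism _ n c) n σ
  have h2 := d_realize (cylinder F σ) (n + 1) (prism _ (n + 1) (Finsupp.single (vertices (n + 1)) 1))
  rw [d_prism, map_sub, map_sub, realize_cylinder_slice, realize_cylinder_slice] at h2
  simp only [LinearMap.comp_apply, Finsupp.lsingle_apply, LinearMap.sub_apply]
  rw [singularMap_single, singularMap_single]
  have h3 : singularPrism F (n + 1) (Finsupp.single σ 1) = realize (cylinder F σ) (n + 1 + 1)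
    (prism _ (n + 1) (Finsupp.single (vertices (n + 1)) 1)) := singularOp_single _ _ _ _
  rw [h3, h2]
  exact congrArg _ h1.symm

lemma singularPrism_mem (F : C(E × unitInterval, E')) {A : Set E} {B : Set E'}
    (h : ∀ x ∈ A, ∀ i, F (x, i) ∈ B) {n : ℕ} {c : (singularSimplices E).Chain n}
    (hc : c ∈ chainsIn (simplicesIn A) n) :
    singularPrism F n c ∈ chainsIn (simplicesIn B) (n + 1) :=
  singularOp_mem (r := 1) (X := fun m => stdSimplex ℝ (Fin (m + 1)) × unitInterval)
    (fun _ σ => cylinder F σ) (fun m n => prism _ n) (fun _ σ hσ x => h _ (hσ x.1) x.2) hc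

lemma singularMap_mem (f : C(E, E')) {A : Set E} {B : Set E'}
    (h : ∀ x ∈ A, f x ∈ B) {n : ℕ} {c : (singularSimplices E).Chain n}
    (hc : c ∈ chainsIn (simplicesIn A) n) :
    singularMap f n c ∈ chainsIn (simplicesIn B) n := by
  refine map_mem_of_chainsIn _ _ (fun σ hσ => ?_) hc
  rw [singularMap_single]
  exact single_mem_chainsIn (L := simplicesIn B) (fun t => h _ (hσ t)) 1

lemma singularMap_id (n : ℕ) (c : (singularSimplices E).Chain n) :
    singularMap (ContinuousMap.id E) n c = c := by
  exact Finsupp.mapDomain_id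

end Singular
end ConvexStruct

namespace ConvexStruct

section Mesh
variable {m : ℕ}

lemma dist_comb_le {n : ℕ} (t : stdSimplex ℝ (Fin (n + 1)))
    (w : Fin (n + 1) → stdSimplex ℝ (Fin (m + 1))) (x : stdSimplex ℝ (Fin (m + 1))) {r : ℝ}
    (h : ∀ i, dist x (w i) ≤ r) : dist x (comb t w) ≤ r := by
  have hc : Convex ℝ (Metric.closedBall (x : Fin (m + 1) → ℝ) r) := convex_closedBall _ _
  have := hc.sum_mem (t := Finset.univ) (w := fun i => t i) (z := fun i => (w i : Fin (m + 1) → ℝ))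
    (fun i _ => t.2.1 i) t.2.2 (fun i _ => by
      rw [Metric.mem_closedBall, dist_comm]; exact h i)
  rw [Metric.mem_closedBall, dist_comm] at this
  exact this

lemma dist_bary_le {n : ℕ} (w : Fin (n + 1) → stdSimplex ℝ (Fin (m + 1))) {ε : ℝ}
    (h : ∀ i j, dist (w i) (w j) ≤ ε) (k : Fin (n + 1)) :
    dist (bary w) (w k) ≤ n / (n + 1) * ε := by
  have h1 : ((bary w : stdSimplex ℝ (Fin (m + 1))) : Fin (m + 1) → ℝ) - w k =
      (n + 1 : ℝ)⁻¹ • ∑ i, ((w i : Fin (m + 1) → ℝ) - w k) := by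
    have : ((bary w : stdSimplex ℝ (Fin (m + 1))) : Fin (m + 1) → ℝ) =
      ∑ i, (n + 1 : ℝ)⁻¹ • (w i : Fin (m + 1) → ℝ) := by
      change ∑ i, (stdSimplex.barycenter : stdSimplex ℝ (Fin (n + 1))).val i • _ = _
      simp
      rfl
    rw [this, ← Finset.smul_sum, Finset.sum_sub_distrib, smul_sub]
    congr 1
    rw [Finset.sum_const, Finset.card_univ, Fintype.card_fin, ← Nat.cast_smul_eq_nsmul ℝ, smul_smul]
    push_cast
    rw [inv_mul_cancel₀ (by positivity), one_smul]
  rw [Subtype.dist_eq, dist_eq_norm]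
  change ‖((bary w : stdSimplex ℝ (Fin (m + 1))) : Fin (m + 1) → ℝ) - w k‖ ≤ _
  rw [h1, norm_smul, norm_inv, Real.norm_of_nonneg (by positivity)]
  have h2 : ‖∑ i, ((w i : Fin (m + 1) → ℝ) - w k)‖ ≤ n * ε := by
    rw [← Finset.add_sum_erase _ _ (Finset.mem_univ k), sub_self, zero_add]
    refine (norm_sum_le _ _).trans ?_
    refine (Finset.sum_le_card_nsmul _ _ ε fun i _ => ?_).trans ?_
    · rw [← dist_eq_norm]; exact h i k
    · simp
  calc _ ≤ (n + 1 : ℝ)⁻¹ * (n * ε) := by gcongr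
    _ = _ := by ring

/-- The tuples produced by subdividing `w`. -/
def finer {n : ℕ} (w : Fin (n + 1) → stdSimplex ℝ (Fin (m + 1))) (δ : ℝ) (k : ℕ) :
    Set ((tuples (stdSimplex ℝ (Fin (m + 1)))).obj k) :=
  {v | (∀ i j, dist (v i) (v j) ≤ δ) ∧
    ∀ i x r, (∀ l, dist x (w l) ≤ r) → dist x (v i) ≤ r}

lemma subdiv_single_mem {n : ℕ} (w : Fin (n + 1) → stdSimplex ℝ (Fin (m + 1))) {ε : ℝ}
    (hε : 0 ≤ ε) (h : ∀ i j, dist (w i) (w j) ≤ ε) :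
    subdiv _ n (Finsupp.single w 1) ∈
      chainsIn (F := tuples (stdSimplex ℝ (Fin (m + 1)))) (finer w (n / (n + 1) * ε)) n := by
  induction n with
  | zero =>
    refine single_mem_chainsIn (L := finer w _) (F := tuples (stdSimplex ℝ (Fin (m + 1))))
      ⟨fun i j => ?_, fun i x r hx => hx i⟩ 1
    rw [Subsingleton.elim (α := Fin 1) i j]; simp
  | succ n ih =>
    rw [subdiv_succ_single]
    have h1 : subdiv _ n ((tuples _).d n (Finsupp.single w 1)) ∈
        chainsIn (F := tuples (stdSimplex ℝ (Fin (m + 1)))) (finer w (n / (n + 1) * ε)) n := by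
      rw [d_single, map_sum]
      refine Submodule.sum_mem _ fun j _ => ?_
      rw [map_smul]
      refine Submodule.smul_mem _ _ (Finsupp.supported_mono ?_
        (ih (w ∘ j.succAbove) fun i j => h _ _))
      exact fun v hv => ⟨hv.1, fun i x r hx => hv.2 i x r fun l => hx _⟩
    refine map_mem_of_chainsIn _ _ (fun v hv => ?_) h1
    rw [cone_single]
    refine single_mem_chainsIn (L := finer w _) (F := tuples (stdSimplex ℝ (Fin (m + 1)))) ?_ 1
    have hb : ∀ k, dist (bary w) (w k) ≤ ((n + 1 : ℕ) : ℝ) / ((n + 1 : ℕ) + 1) * ε :=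
      dist_bary_le w h
    have hle : (n : ℝ) / (n + 1) * ε ≤ ((n + 1 : ℕ) : ℝ) / ((n + 1 : ℕ) + 1) * ε := by
      push_cast
      gcongr ?_ * ε
      rw [div_le_div_iff₀ (by positivity) (by positivity)]
      nlinarith
    refine ⟨fun i j => ?_, fun i x r hx => ?_⟩
    · refine Fin.cases ?_ (fun i => ?_) i <;> refine Fin.cases ?_ (fun j => ?_) j
      · simp only [Fin.cons_zero, dist_self]; positivity
      · simp only [Fin.cons_zero, Fin.cons_succ]
        exact hv.2 j _ _ hb
      · simp only [Fin.cons_zero, Fin.cons_succ]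
        rw [dist_comm]
        exact hv.2 i _ _ hb
      · simp only [Fin.cons_succ]
        exact (hv.1 i j).trans hle
    · refine Fin.cases ?_ (fun i => ?_) i
      · simp only [Fin.cons_zero]
        exact dist_comb_le _ _ _ hx
      · simp only [Fin.cons_succ]
        exact hv.2 i x r hx

lemma iterate_subdiv_mem {n : ℕ} (w : Fin (n + 1) → stdSimplex ℝ (Fin (m + 1))) {ε : ℝ}
    (hε : 0 ≤ ε) (h : ∀ i j, dist (w i) (w j) ≤ ε) (N : ℕ) :
    (subdiv _ n)^[N] (Finsupp.single w 1) ∈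
      chainsIn (F := tuples (stdSimplex ℝ (Fin (m + 1))))
        (fun k => {v | ∀ i j, dist (v i) (v j) ≤ ((n : ℝ) / (n + 1)) ^ N * ε}) n := by
  induction N with
  | zero =>
    exact single_mem_chainsIn (F := tuples (stdSimplex ℝ (Fin (m + 1))))
      (L := fun k => {v | ∀ i j, dist (v i) (v j) ≤ ((n : ℝ) / (n + 1)) ^ 0 * ε})
      (by simpa using h) 1
  | succ N ih =>
    rw [Function.iterate_succ_apply']
    refine map_mem_of_chainsIn _ _ (fun v hv => ?_) ih
    refine Finsupp.supported_mono ?_ (subdiv_single_mem v (by positivity) hv)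
    intro v' hv'
    have := hv'.1
    rw [← mul_assoc, ← pow_succ'] at this
    exact this

end Mesh

section Small
variable {E : Type*} [TopologicalSpace E]

/-- Sufficiently fine subdivisions are subordinate to an open cover. -/
lemma exists_iterate_subdiv_single_mem {n : ℕ} (σ : C(stdSimplex ℝ (Fin (n + 1)), E))
    (U V O₁ O₂ : Set E) (h₁ : IsOpen O₁) (h₂ : IsOpen O₂) (hσ : ∀ t, σ t ∈ O₁ ∪ O₂)
    (hU : ∀ t, σ t ∈ O₁ → σ t ∈ U) (hV : ∀ t, σ t ∈ O₂ → σ t ∈ V) :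
    ∃ N, (singularSubdiv E n)^[N] (Finsupp.single σ 1) ∈
      chainsIn (fun n => simplicesIn U n ∪ simplicesIn V n) n := by
  obtain ⟨δ, hδ, hδ'⟩ := lebesgue_number_lemma_of_metric
    (isCompact_univ (X := stdSimplex ℝ (Fin (n + 1)))) (c := fun b : Bool => σ ⁻¹' (cond b O₁ O₂))
    (fun b => by cases b; exacts [h₂.preimage σ.continuous, h₁.preimage σ.continuous])
    (fun t _ => by
      rcases hσ t with h | h
      · exact Set.mem_iUnion_of_mem true h
      · exact Set.mem_iUnion_of_mem false h)
  obtain ⟨ε, hε, hεd⟩ : ∃ ε : ℝ, 0 < ε ∧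
      ∀ i j, dist (vertices n i) (vertices n j) ≤ ε := by
    obtain ⟨C, hC⟩ := Metric.isBounded_iff.mp
      (isCompact_univ (X := stdSimplex ℝ (Fin (n + 1)))).isBounded
    exact ⟨max C 1, by positivity, fun i j => (hC trivial trivial).trans (le_max_left _ _)⟩
  obtain ⟨N, hN⟩ : ∃ N : ℕ, ((n : ℝ) / (n + 1)) ^ N < δ / ε :=
    exists_pow_lt_of_lt_one (by positivity) (by rw [div_lt_one (by positivity)]; linarith)
  rw [lt_div_iff₀ hε] at hN
  refine ⟨N, ?_⟩
  have h1 : (singularSubdiv E n)^[N] (Finsupp.single σ 1) =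
      realize σ n ((subdiv _ n)^[N] (Finsupp.single (vertices n) 1)) := by
    rw [← realize_vertices σ]
    generalize (Finsupp.single (vertices n) 1 :
      (tuples (stdSimplex ℝ (Fin (n + 1)))).Chain n) = c
    induction N generalizing c with
    | zero => rfl
    | succ N ih =>
      rw [Function.iterate_succ_apply', Function.iterate_succ_apply']
      clear hN
      have : ∀ N c, (singularSubdiv E n)^[N] (realize σ n c) = realize σ n ((subdiv _ n)^[N] c) := by
        intro N
        induction N with
        | zero => intro c; rfl
        | succ N ih =>
          intro c
          rw [Function.iterate_succ_apply, Function.iterate_succ_apply, singularSubdiv_realize, ih]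
      rw [this, singularSubdiv_realize]
  rw [h1]
  refine map_mem_of_chainsIn _ _ (fun v hv => ?_) (iterate_subdiv_mem _ hε.le hεd N)
  rw [realize_single]
  refine single_mem_chainsIn (L := fun n => simplicesIn U n ∪ simplicesIn V n) ?_ 1
  obtain ⟨b, hb⟩ := hδ' (v 0) trivial
  have h2 : ∀ t, affineSimplex v t ∈ Metric.ball (v 0) δ := fun t => by
    rw [Metric.mem_ball, dist_comm]
    exact (dist_comb_le t v (v 0) fun i => hv 0 i).trans_lt hN
  cases b
  · exact Or.inr fun t => hV _ (hb (h2 t))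
  · exact Or.inl fun t => hU _ (hb (h2 t))

/-- The theorem of small simplices. -/
theorem relAcyclic_small {X U V O₁ O₂ : Set E} (h₁ : IsOpen O₁) (h₂ : IsOpen O₂)
    (hX : X ⊆ O₁ ∪ O₂) (hU : X ∩ O₁ ⊆ U) (hV : X ∩ O₂ ⊆ V) :
    RelAcyclic (simplicesIn X) (fun n => simplicesIn U n ∪ simplicesIn V n) := by
  have hpres : ∀ n, ∀ c ∈ chainsIn (fun n => simplicesIn U n ∪ simplicesIn V n) n,
      singularSubdiv E n c ∈ chainsIn (fun n => simplicesIn U n ∪ simplicesIn V n) n := by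
    intro n c hc
    refine map_mem_of_chainsIn _ _ (fun σ hσ => ?_) hc
    rcases hσ with hσ | hσ
    · exact Finsupp.supported_mono Set.subset_union_left
        (singularSubdiv_mem (single_mem_chainsIn (L := simplicesIn U) hσ 1))
    · exact Finsupp.supported_mono Set.subset_union_right
        (singularSubdiv_mem (single_mem_chainsIn (L := simplicesIn V) hσ 1))
  have hpresT : ∀ n, ∀ c ∈ chainsIn (fun n => simplicesIn U n ∪ simplicesIn V n) n,
      singularSubdivHomotopy E n c ∈
        chainsIn (fun n => simplicesIn U n ∪ simplicesIn V n) (n + 1) := by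
    intro n c hc
    refine map_mem_of_chainsIn _ _ (fun σ hσ => ?_) hc
    rcases hσ with hσ | hσ
    · exact Finsupp.supported_mono Set.subset_union_left
        (singularSubdivHomotopy_mem (single_mem_chainsIn (L := simplicesIn U) hσ 1))
    · exact Finsupp.supported_mono Set.subset_union_right
        (singularSubdivHomotopy_mem (single_mem_chainsIn (L := simplicesIn V) hσ 1))
  have hiter : ∀ n N, ∀ c ∈ chainsIn (fun n => simplicesIn U n ∪ simplicesIn V n) n,
      (singularSubdiv E n)^[N] c ∈ chainsIn (fun n => simplicesIn U n ∪ simplicesIn V n) n := by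
    intro n N
    induction N with
    | zero => exact fun c hc => hc
    | succ N ih =>
      intro c hc
      rw [Function.iterate_succ_apply]
      exact ih _ (hpres n c hc)
  have hlin : ∀ n N (a b : (singularSimplices E).Chain n),
      (singularSubdiv E n)^[N] (a + b) =
        (singularSubdiv E n)^[N] a + (singularSubdiv E n)^[N] b := by
    intro n N
    induction N with
    | zero => exact fun _ _ => rfl
    | succ N ih => intro a b; simp only [Function.iterate_succ_apply, map_add, ih]
  have hsmul : ∀ n N (r : ℤ) (a : (singularSimplices E).Chain n),
      (singularSubdiv E n)^[N] (r • a) = r • (singularSubdiv E n)^[N] a := by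
    intro n N
    induction N with
    | zero => exact fun _ _ => rfl
    | succ N ih => intro r a; simp only [Function.iterate_succ_apply, map_smul, ih]
  have hex : ∀ n, ∀ c ∈ chainsIn (simplicesIn X) n, ∃ N, (singularSubdiv E n)^[N] c ∈
      chainsIn (fun n => simplicesIn U n ∪ simplicesIn V n) n := by
    intro n c hc
    rw [chainsIn, Finsupp.supported_eq_span_single] at hc
    induction hc using Submodule.span_induction with
    | mem c hc =>
      obtain ⟨σ, hσ, rfl⟩ := hc
      exact exists_iterate_subdiv_single_mem σ U V O₁ O₂ h₁ h₂ (fun t => hX (hσ t))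
        (fun t ht => hU ⟨hσ t, ht⟩) (fun t ht => hV ⟨hσ t, ht⟩)
    | zero => exact ⟨0, Submodule.zero_mem _⟩
    | add a b _ _ ha hb =>
      obtain ⟨N, hN⟩ := ha
      obtain ⟨M, hM⟩ := hb
      refine ⟨N + M, ?_⟩
      rw [hlin]
      refine Submodule.add_mem _ ?_ ?_
      · rw [add_comm, Function.iterate_add_apply]; exact hiter _ _ _ hN
      · rw [Function.iterate_add_apply]; exact hiter _ _ _ hM
    | smul r a _ ha =>
      obtain ⟨N, hN⟩ := ha
      exact ⟨N, by rw [hsmul]; exact Submodule.smul_mem _ _ hN⟩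
  constructor
  · intro c hc
    obtain ⟨N, hN⟩ := hex 0 c hc
    induction N generalizing c with
    | zero => exact ⟨0, Submodule.zero_mem _, by simpa using hN⟩
    | succ N ih =>
      obtain ⟨b, hb, hb'⟩ := ih _ (singularSubdiv_mem hc) hN
      refine ⟨b + singularSubdivHomotopy E 0 c,
        Submodule.add_mem _ hb (singularSubdivHomotopy_mem hc), ?_⟩
      rw [map_add, d_singularSubdivHomotopy_zero]
      convert hb' using 1
      abel
  · intro n c hc hdc
    obtain ⟨N, hN⟩ := hex (n + 1) c hc
    induction N generalizing c with
    | zero => exact ⟨0, Submodule.zero_mem _, by simpa using hN⟩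
    | succ N ih =>
      obtain ⟨b, hb, hb'⟩ := ih _ (singularSubdiv_mem hc)
        (by rw [d_singularSubdiv]; exact hpres _ _ hdc) hN
      refine ⟨b + singularSubdivHomotopy E (n + 1) c,
        Submodule.add_mem _ hb (singularSubdivHomotopy_mem hc), ?_⟩
      rw [map_add, d_singularSubdivHomotopy]
      convert Submodule.add_mem _ hb' (hpresT _ _ hdc) using 1
      abel

end Small
end ConvexStruct

namespace ConvexStruct

section Transfer
variable {E E' : Type*} [TopologicalSpace E] [TopologicalSpace E']

/-- The inclusion of a subspace. -/
def inclusion (X : Set E) : C(X, E) := ⟨Subtype.val, continuous_subtype_val⟩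

lemma inclusion_comp_injective (X : Set E) (n : ℕ) :
    Function.Injective fun σ : C(stdSimplex ℝ (Fin (n + 1)), X) => (inclusion X).comp σ :=
  fun _ _ h => ContinuousMap.ext fun t => Subtype.ext (DFunLike.congr_fun h t)

/-- The corestriction of a simplex. -/
def corestrict {X : Set E} {n : ℕ} {σ : C(stdSimplex ℝ (Fin (n + 1)), E)}
    (h : σ ∈ simplicesIn X n) : C(stdSimplex ℝ (Fin (n + 1)), X) :=
  ⟨fun t => ⟨σ t, h t⟩, σ.continuous.subtype_mk h⟩

lemma exists_singularMap_inclusion {X : Set E} {n : ℕ} {c : (singularSimplices E).Chain n}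
    (hc : c ∈ chainsIn (simplicesIn X) n) : ∃ c', singularMap (inclusion X) n c' = c := by
  have : c ∈ LinearMap.range (singularMap (inclusion X) n) := by
    refine map_mem_of_chainsIn LinearMap.id _ (fun σ hσ => ?_) hc
    refine ⟨Finsupp.single (corestrict hσ) 1, ?_⟩
    rw [singularMap_single]
    rfl
  exact this

lemma mem_of_singularMap_inclusion_mem {X A : Set E} {n : ℕ} {c : (singularSimplices X).Chain n}
    (hc : singularMap (inclusion X) n c ∈ chainsIn (simplicesIn A) n) :
    c ∈ chainsIn (simplicesIn (Subtype.val ⁻¹' A : Set X)) n := by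
  intro σ hσ t
  have h : (inclusion X).comp σ ∈ (singularMap (inclusion X) n c).support := by
    classical
    have := Finsupp.mapDomain_support_of_injective (inclusion_comp_injective X n) c
    change _ ∈ (Finsupp.mapDomain _ c).support
    rw [this]
    exact Finset.mem_image_of_mem _ hσ
  exact hc h t

/-- If `U` deforms into `A`, then the homology of the pair `(U, A)` vanishes. -/
theorem relAcyclic_of_homotopy {U A : Set E} (F : C(U × unitInterval, E))
    (h0 : ∀ x, F (x, 0) = x) (hU : ∀ x i, F (x, i) ∈ U) (hA : ∀ x : U, (x : E) ∈ A → ∀ i, F (x, i) ∈ A)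
    (h1 : ∀ x, F (x, 1) ∈ A) : RelAcyclic (simplicesIn U) (simplicesIn A) := by
  have huniv : ∀ {n : ℕ} (c : (singularSimplices U).Chain n),
      c ∈ chainsIn (simplicesIn (Set.univ : Set U)) n := fun c σ _ t => trivial
  have hF0 : homotopyAt F 0 = inclusion U := ContinuousMap.ext h0
  have hmem : ∀ {n : ℕ} (c : (singularSimplices U).Chain n),
      singularMap (homotopyAt F 1) n c ∈ chainsIn (simplicesIn A) n := fun c =>
    singularMap_mem _ (fun x _ => h1 x) (huniv c)
  constructor
  · intro c hc
    obtain ⟨c, rfl⟩ := exists_singularMap_inclusion hc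
    refine ⟨-singularPrism F 0 c, Submodule.neg_mem _
      (singularPrism_mem F (fun x _ i => hU x i) (huniv c)), ?_⟩
    rw [map_neg, d_singularPrism_zero, hF0]
    convert hmem c using 1
    abel
  · intro n c hc hdc
    obtain ⟨c, rfl⟩ := exists_singularMap_inclusion hc
    refine ⟨-singularPrism F (n + 1) c, Submodule.neg_mem _
      (singularPrism_mem F (fun x _ i => hU x i) (huniv c)), ?_⟩
    rw [d_singularMap] at hdc
    have := singularPrism_mem F (B := A) (fun x hx i => hA x hx i)
      (mem_of_singularMap_inclusion_mem hdc)
    rw [map_neg, d_singularPrism, hF0]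
    convert Submodule.sub_mem _ (hmem c) this using 1
    abel

/-- Vanishing of the cohomology of a space in degrees at least `q`. -/
def SpaceVanishing (X : Type*) [TopologicalSpace X] (q : ℕ) : Prop :=
  Vanishing.{u} (simplicesIn (Set.univ : Set X)) q

lemma vanishing_iff_spaceVanishing {X : Set E} {q : ℕ} :
    Vanishing.{u} (simplicesIn X) q ↔ SpaceVanishing.{u} X q := by
  classical
  constructor
  · intro h N _ n hn φ hφ
    let φ' : ∀ σ : C(stdSimplex ℝ (Fin (n + 1)), E), N := fun σ =>
      if hσ : σ ∈ simplicesIn X n then φ (corestrict hσ) else 0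
    have hφ' : ∀ σ, φ' ((inclusion X).comp σ) = φ σ := fun σ => by
      have : (inclusion X).comp σ ∈ simplicesIn X n := fun t => (σ t).2
      simp only [φ', dif_pos this]; rfl
    have := h N n hn φ' fun σ hσ => by
      rw [← hφ (corestrict hσ) (fun _ => trivial)]
      unfold cob
      refine Finset.sum_congr rfl fun j _ => ?_
      congr 1
      exact hφ' ((corestrict hσ).comp (coface j))
    cases n with
    | zero => 
      intro σ _
      rw [← hφ' σ]
      exact this _ fun t => (σ t).2
    | succ n =>
      obtain ⟨ψ, -, hψ⟩ := this
      refine ⟨fun σ => ψ ((inclusion X).comp σ), trivial, fun σ _ => ?_⟩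
      rw [← hφ' σ]
      exact hψ _ fun t => (σ t).2
  · intro h N _ n hn φ hφ
    have := h N n hn (fun σ => φ ((inclusion X).comp σ)) fun σ _ =>
      hφ ((inclusion X).comp σ) fun t => (σ t).2
    cases n with
    | zero => exact fun σ hσ => this (corestrict hσ) fun _ => trivial
    | succ n =>
      obtain ⟨ψ, -, hψ⟩ := this
      let ψ' : ∀ σ : C(stdSimplex ℝ (Fin (n + 1)), E), N := fun σ =>
        if hσ : σ ∈ simplicesIn X n then ψ (corestrict hσ) else 0
      refine ⟨ψ', trivial, fun σ hσ => ?_⟩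
      refine (hψ (corestrict hσ) fun _ => trivial).trans ?_
      unfold cob
      refine Finset.sum_congr rfl fun j _ => ?_
      congr 1
      have := faceClosed_simplicesIn X n j σ hσ
      simp only [ψ', dif_pos this]; rfl

/-- Homotopy invariance. -/
theorem SpaceVanishing.of_homotopy (f : C(E, E')) (g : C(E', E)) (F : C(E × unitInterval, E))
    (h0 : ∀ x, F (x, 0) = x) (h1 : ∀ x, F (x, 1) = g (f x)) {q : ℕ}
    (h : SpaceVanishing.{u} E' q) : SpaceVanishing.{u} E q := by
  intro N _ n hn φ hφ
  have hF0 : homotopyAt F 0 = ContinuousMap.id E := ContinuousMap.ext h0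
  have hF1 : homotopyAt F 1 = g.comp f := ContinuousMap.ext h1
  have hcob : ∀ c, Finsupp.linearCombination ℤ φ ((singularSimplices E).d n c) = 0 := fun c => by
    rw [linearCombination_d]
    have : cob φ = 0 := funext fun σ => hφ σ fun _ => trivial
    rw [this]; simp [Finsupp.linearCombination_apply]
  have := h N n hn (fun σ => φ (g.comp σ)) fun σ _ => hφ (g.comp σ) fun _ => trivial
  cases n with
  | zero =>
    intro σ _
    have h2 : φ (g.comp (f.comp σ)) = 0 := this (f.comp σ) fun _ => trivial
    have h3 := hcob (singularPrism F 0 (Finsupp.single σ 1))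
    rw [d_singularPrism_zero, hF0, hF1, singularMap_single, singularMap_id, map_sub] at h3
    simp only [Finsupp.linearCombination_single, one_smul] at h3
    exact (sub_eq_zero.mp h3).symm.trans h2
  | succ n =>
    obtain ⟨ψ, -, hψ⟩ := this
    refine ⟨(fun σ => ψ (f.comp σ)) - fun σ =>
      Finsupp.linearCombination ℤ φ (singularPrism F n (Finsupp.single σ 1)), trivial,
      fun σ _ => ?_⟩
    have h2 : φ (g.comp (f.comp σ)) = cob (fun σ => ψ (f.comp σ)) σ :=
      hψ (f.comp σ) fun _ => trivial
    have h3 := hcob (singularPrism F (n + 1) (Finsupp.single σ 1))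
    rw [d_singularPrism, hF0, hF1, singularMap_single, singularMap_id, map_sub, map_sub] at h3
    simp only [Finsupp.linearCombination_single, one_smul] at h3
    have h4 : Finsupp.linearCombination ℤ φ (singularPrism F n ((singularSimplices E).d n
        (Finsupp.single σ 1))) = cob (fun σ =>
      Finsupp.linearCombination ℤ φ (singularPrism F n (Finsupp.single σ 1))) σ := by
      rw [d_single]
      simp only [map_sum, map_smul]
      rfl
    rw [cob_sub, ← h2, ← h4]
    rw [ContinuousMap.comp_assoc, sub_right_comm, sub_eq_zero] at h3
    rw [← h3]

lemma SpaceVanishing.of_unique (X : Type*) [TopologicalSpace X] [Unique X] :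
    SpaceVanishing.{u} X 1 := by
  intro N _ n hn φ hφ
  obtain ⟨n, rfl⟩ : ∃ m, n = m + 1 := ⟨n - 1, by omega⟩
  have hsub : ∀ n, Subsingleton ((singularSimplices X).obj n) := fun n =>
    ⟨fun a b => ContinuousMap.ext fun t => Subsingleton.elim _ _⟩
  let pt : ∀ n, (singularSimplices X).obj n := fun n => ContinuousMap.const _ default
  have hcob : ∀ {n : ℕ} (φ : (singularSimplices X).obj n → N) x,
      cob φ x = (∑ j : Fin (n + 2), (-1 : ℤ) ^ (j : ℕ)) • φ (pt n) := fun φ x => by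
    rw [cob, Finset.sum_smul]
    refine Finset.sum_congr rfl fun j _ => ?_
    rw [(hsub _).elim ((singularSimplices X).face j x) (pt _)]
  have hsum : ∀ n : ℕ, (∑ j : Fin n, (-1 : ℤ) ^ (j : ℕ)) = if Even n then 0 else 1 := fun n => by
    rw [Fin.sum_univ_eq_sum_range (fun j => (-1 : ℤ) ^ j), neg_one_geom_sum]
  rcases Nat.even_or_odd n with hn | hn
  · refine ⟨0, trivial, fun x _ => ?_⟩
    have := hφ (pt _) fun _ => trivial
    rw [hcob, hsum, if_neg (by simpa [Nat.even_add_one] using hn), one_smul] at this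
    rw [(hsub _).elim x (pt _), this, hcob]
    simp
  · refine ⟨fun _ => φ (pt _), trivial, fun x _ => ?_⟩
    rw [hcob, hsum, if_neg (by simpa [Nat.even_add_one] using hn), one_smul,
      (hsub _).elim x (pt _)]

lemma SpaceVanishing.of_contractible (X : Type*) [TopologicalSpace X] [ContractibleSpace X] :
    SpaceVanishing.{u} X 1 := by
  obtain ⟨x, ⟨h⟩⟩ := (contractible_iff_id_nullhomotopic X).mp inferInstance
  refine SpaceVanishing.of_homotopy (E' := Unit) (ContinuousMap.const _ ()) (ContinuousMap.const _ x)
    (h.toContinuousMap.comp ⟨Prod.swap, continuous_swap⟩) (fun y => ?_) (fun y => ?_)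
    (SpaceVanishing.of_unique Unit)
  · exact h.apply_zero y
  · exact h.apply_one y

lemma simplicesIn_inter (U V : Set E) :
    simplicesIn (U ∩ V) = fun n => simplicesIn U n ∩ simplicesIn V n :=
  funext fun _ => Set.ext fun _ => forall_and

lemma simplicesIn_mono {U V : Set E} (h : U ⊆ V) (n : ℕ) : simplicesIn U n ⊆ simplicesIn V n :=
  fun _ hσ t => h (hσ t)

/-- Mayer–Vietoris. -/
theorem vanishing_of_cover {X O₁ O₂ : Set E} (h₁ : IsOpen O₁) (h₂ : IsOpen O₂)
    (hX : X ⊆ O₁ ∪ O₂) {q : ℕ} (hv₁ : Vanishing.{u} (simplicesIn (X ∩ O₁)) (q + 1))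
    (hv₂ : Vanishing.{u} (simplicesIn (X ∩ O₂)) (q + 1))
    (hv : Vanishing.{u} (simplicesIn (X ∩ (O₁ ∩ O₂))) q) :
    Vanishing.{u} (simplicesIn X) (q + 1) := by
  refine Vanishing.of_relAcyclic (faceClosed_simplicesIn X) (fun n => Set.union_subset ?_ ?_)
    (relAcyclic_small h₁ h₂ hX subset_rfl subset_rfl)
    (Vanishing.union (faceClosed_simplicesIn _) (faceClosed_simplicesIn _) hv₁ hv₂ ?_)
  · exact simplicesIn_mono Set.inter_subset_left n
  · exact simplicesIn_mono Set.inter_subset_left n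
  · rwa [Set.inter_inter_distrib_left, simplicesIn_inter] at hv

variable (H : Type*) [Group H] [MulAction H E] [ContinuousConstSMul H E]

instance singularMulAction (n : ℕ) : MulAction H ((singularSimplices E).obj n) :=
  inferInstanceAs (MulAction H C(stdSimplex ℝ (Fin (n + 1)), E))

lemma faceEquivar_singularSimplices : FaceEquivar (singularSimplices E) H :=
  fun _ _ _ _ => rfl

variable {H}

lemma smul_mem_simplicesIn {X : Set E} (hX : ∀ (g : H), ∀ x ∈ X, g • x ∈ X) (n : ℕ) (g : H)
    (σ) (hσ : σ ∈ simplicesIn X n) : g • σ ∈ simplicesIn X n := fun t => hX g _ (hσ t)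

lemma singular_free (hfree : ∀ (g : H) (x : E), g • x = x → g = 1) (n : ℕ) (g : H)
    (σ : (singularSimplices E).obj n) (h : g • σ = σ) : g = 1 :=
  hfree g (ContinuousMap.toFun σ (vertices n 0)) (DFunLike.congr_fun (F := C(stdSimplex ℝ (Fin (n + 1)), E)) h (vertices n 0))

/-- Equivariant Mayer–Vietoris. -/
theorem equivariantVanishing_of_cover (hfree : ∀ (g : H) (x : E), g • x = x → g = 1)
    {X U V O₁ O₂ : Set E} (h₁ : IsOpen O₁) (h₂ : IsOpen O₂)
    (hX : X ⊆ O₁ ∪ O₂) (hU : X ∩ O₁ = U) (hV : X ∩ O₂ = V)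
    (hHX : ∀ (g : H), ∀ x ∈ X, g • x ∈ X) (hHU : ∀ (g : H), ∀ x ∈ U, g • x ∈ U)
    (hHV : ∀ (g : H), ∀ x ∈ V, g • x ∈ V) {q : ℕ}
    (hv₁ : EquivariantVanishing.{u} H (simplicesIn U) (q + 1))
    (hv₂ : EquivariantVanishing.{u} H (simplicesIn V) (q + 1))
    (hv : EquivariantVanishing.{u} H (simplicesIn (U ∩ V)) q) :
    EquivariantVanishing.{u} H (simplicesIn X) (q + 1) := by
  refine EquivariantVanishing.of_relAcyclic (faceEquivar_singularSimplices H) 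
    (singular_free hfree) (faceClosed_simplicesIn X) (smul_mem_simplicesIn hHX) ?_
    (fun n => Set.union_subset ?_ ?_)
    (relAcyclic_small h₁ h₂ hX hU.subset hV.subset)
    (EquivariantVanishing.union (faceEquivar_singularSimplices H) (smul_mem_simplicesIn hHU)
      (faceClosed_simplicesIn _) (faceClosed_simplicesIn _) hv₁ hv₂ ?_)
  · rintro n g x (hx | hx)
    exacts [Or.inl (smul_mem_simplicesIn hHU n g x hx), Or.inr (smul_mem_simplicesIn hHV n g x hx)]
  · exact simplicesIn_mono (hU.symm.subset.trans Set.inter_subset_left) n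
  · exact simplicesIn_mono (hV.symm.subset.trans Set.inter_subset_left) n
  · rwa [simplicesIn_inter] at hv

end Transfer

section Euclidean

lemma contractible_ray_compl (d : ℕ) (s : ℝ) (hs : s ≠ 0) :
    ContractibleSpace {x : Fin (d + 1) → ℝ | 0 < s * x 0 ∨ Fin.tail x ≠ 0} := by
  have h0 : (Fin.cons s 0 : Fin (d + 1) → ℝ) ∈
      {x : Fin (d + 1) → ℝ | 0 < s * x 0 ∨ Fin.tail x ≠ 0} := Or.inl (by simpa using hs)
  refine StarConvex.contractibleSpace (x := Fin.cons s 0) ?_ ⟨_, h0⟩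
  intro y hy a b ha hb hab
  rcases eq_or_ne b 0 with rfl | hb0
  · have : a = 1 := by linarith
    subst this
    simpa using h0
  by_cases ht : Fin.tail y = 0
  · left
    have hy : 0 < s * y 0 := hy.resolve_right (not_not.mpr ht)
    have : 0 < b := lt_of_le_of_ne hb hb0.symm
    simp only [Pi.add_apply, Pi.smul_apply, Fin.cons_zero, smul_eq_mul, mul_add]
    have h1 : 0 ≤ s * (a * s) := by nlinarith [mul_self_nonneg s]
    nlinarith [mul_pos this hy]
  · right
    intro h
    refine ht (funext fun i => ?_)
    have := congrFun h i
    simpa [Fin.tail, hb0] using this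

/-- The cohomology of the complement of the origin. -/
theorem vanishing_ne_zero (d : ℕ) :
    Vanishing.{u} (simplicesIn {x : Fin d → ℝ | x ≠ 0}) d := by
  induction d with
  | zero =>
    refine Vanishing.of_empty (fun n => Set.eq_empty_of_forall_notMem fun σ hσ => ?_) _
    exact hσ (vertices n 0) (Subsingleton.elim _ _)
  | succ d ih =>
    have hopen : ∀ s : ℝ, IsOpen {x : Fin (d + 1) → ℝ | 0 < s * x 0 ∨ Fin.tail x ≠ 0} := fun s => by
      refine (isOpen_lt (f := fun _ => (0 : ℝ)) (g := fun x : Fin (d + 1) → ℝ => s * x 0)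
        (by fun_prop) (by fun_prop)).union
        (isOpen_ne_fun (f := fun x : Fin (d + 1) → ℝ => Fin.tail x) (g := fun _ => 0) ?_
          (by fun_prop))
      exact continuous_pi fun i => continuous_apply _
    have hsub : ∀ s : ℝ, {x : Fin (d + 1) → ℝ | 0 < s * x 0 ∨ Fin.tail x ≠ 0} ⊆ {x | x ≠ 0} := by
      rintro s x hx rfl
      rcases hx with hx | hx
      · simp at hx
      · exact hx rfl
    refine vanishing_of_cover (hopen 1) (hopen (-1)) ?_ ?_ ?_ ?_
    · intro x hx
      by_cases ht : Fin.tail x = 0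
      · have : x 0 ≠ 0 := fun h => hx (by
          rw [← Fin.cons_self_tail x, h, ht]
          exact funext fun i => by refine Fin.cases ?_ (fun i => ?_) i <;> simp)
        rcases lt_or_gt_of_ne this with h | h
        · exact Or.inr (Or.inl (by linarith))
        · exact Or.inl (Or.inl (by linarith))
      · exact Or.inl (Or.inr ht)
    · rw [Set.inter_eq_right.mpr (hsub 1), vanishing_iff_spaceVanishing]
      have := contractible_ray_compl d 1 one_ne_zero
      exact (SpaceVanishing.of_contractible _).mono (by omega)
    · rw [Set.inter_eq_right.mpr (hsub (-1)), vanishing_iff_spaceVanishing]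
      have := contractible_ray_compl d (-1) (by norm_num)
      exact (SpaceVanishing.of_contractible _).mono (by omega)
    · have hX : {x : Fin (d + 1) → ℝ | x ≠ 0} ∩ ({x | 0 < 1 * x 0 ∨ Fin.tail x ≠ 0} ∩
          {x | 0 < -1 * x 0 ∨ Fin.tail x ≠ 0}) = {x | Fin.tail x ≠ 0} := by
        ext x
        constructor
        · rintro ⟨-, h1, h2⟩
          rcases h1 with h1 | h1
          · exact h2.resolve_left (by linarith)
          · exact h1
        · exact fun h => ⟨hsub 1 (Or.inr h), Or.inr h, Or.inr h⟩
      rw [hX, vanishing_iff_spaceVanishing]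
      rw [vanishing_iff_spaceVanishing] at ih
      have htail : Continuous fun x : Fin (d + 1) → ℝ => Fin.tail x :=
        continuous_pi fun i => continuous_apply _
      have hcons : Continuous fun p : ℝ × (Fin d → ℝ) => (Fin.cons p.1 p.2 : Fin (d + 1) → ℝ) :=
        continuous_pi fun i => by
          refine Fin.cases ?_ (fun i => ?_) i
          · simpa using continuous_fst
          · simp only [Fin.cons_succ]; fun_prop
      refine SpaceVanishing.of_homotopy (E' := {x : Fin d → ℝ | x ≠ 0})
        ⟨fun x => ⟨Fin.tail x.1, x.2⟩, (htail.comp continuous_subtype_val).subtype_mk _⟩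
        ⟨fun x => ⟨Fin.cons 0 x.1, x.2⟩,
          (hcons.comp (continuous_const.prodMk continuous_subtype_val)).subtype_mk _⟩
        ⟨fun p => ⟨Fin.cons ((1 - p.2.1) * p.1.1 0) (Fin.tail p.1.1), p.1.2⟩,
          (hcons.comp (Continuous.prodMk (f := fun p : {x : Fin (d + 1) → ℝ | Fin.tail x ≠ 0} ×
            unitInterval => (1 - (p.2 : ℝ)) * p.1.1 0)
            (Continuous.mul (by fun_prop)
              ((continuous_apply 0).comp (continuous_subtype_val.comp continuous_fst)))
            (htail.comp (continuous_subtype_val.comp continuous_fst)))).subtype_mk _⟩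
        (fun x => ?_) (fun x => ?_) ih
      · refine Subtype.ext ?_
        simp [Fin.cons_self_tail]
      · refine Subtype.ext ?_
        simp

/-- The cohomology of an annulus. -/
theorem vanishing_annulus (d : ℕ) :
    Vanishing.{u} (simplicesIn {x : Fin d → ℝ | 1 / 2 < ‖x‖ ∧ ‖x‖ < 1}) d := by
  have h := vanishing_ne_zero.{u} d
  rw [vanishing_iff_spaceVanishing] at h ⊢
  have hpos : ∀ x : {x : Fin d → ℝ | 1 / 2 < ‖x‖ ∧ ‖x‖ < 1}, 0 < ‖x.1‖ := fun x => by
    have := x.2.1; linarith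
  have hnorm : ∀ (x : Fin d → ℝ) (c : ℝ), 0 < ‖x‖ → 0 ≤ c → ‖(c / ‖x‖) • x‖ = c := fun x c hx hc => by
    rw [norm_smul, norm_div, norm_norm, Real.norm_of_nonneg hc, div_mul_cancel₀ _ hx.ne']
  refine SpaceVanishing.of_homotopy (E' := {x : Fin d → ℝ | x ≠ 0})
    ⟨fun x => ⟨x.1, norm_pos_iff.mp (hpos x)⟩,
      Continuous.subtype_mk (f := fun x : {x : Fin d → ℝ | 1 / 2 < ‖x‖ ∧ ‖x‖ < 1} => x.1)
        continuous_subtype_val _⟩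
    ⟨fun x => ⟨((3 / 4) / ‖x.1‖) • x.1, by
      have := hnorm x.1 (3 / 4) (norm_pos_iff.mpr x.2) (by norm_num)
      rw [Set.mem_setOf_eq, this]; norm_num⟩, ?_⟩
    ⟨fun p => ⟨(((1 - p.2.1) * ‖p.1.1‖ + p.2.1 * (3 / 4)) / ‖p.1.1‖) • p.1.1, by
      have h1 := p.1.2.1
      have h2 := p.1.2.2
      have h3 := p.2.2.1
      have h4 := p.2.2.2
      rw [Set.mem_setOf_eq, hnorm _ _ (hpos _) (by nlinarith)]
      constructor
      · nlinarith
      · nlinarith⟩, ?_⟩ (fun x => ?_) (fun x => ?_) h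
  · have h1 : Continuous fun x : {x : Fin d → ℝ | x ≠ 0} => x.1 := continuous_subtype_val
    have h2 : Continuous fun x : {x : Fin d → ℝ | x ≠ 0} => (3 / 4 : ℝ) / ‖x.1‖ :=
      continuous_const.div h1.norm fun x => (norm_pos_iff.mpr x.2).ne'
    exact (h2.smul h1).subtype_mk _
  · have h1 : Continuous fun p : {x : Fin d → ℝ | 1 / 2 < ‖x‖ ∧ ‖x‖ < 1} × unitInterval => p.1.1 :=
      continuous_subtype_val.comp continuous_fst
    have h2 : Continuous fun p : {x : Fin d → ℝ | 1 / 2 < ‖x‖ ∧ ‖x‖ < 1} × unitInterval =>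
      (p.2 : ℝ) := continuous_subtype_val.comp continuous_snd
    have h3 : Continuous fun p : {x : Fin d → ℝ | 1 / 2 < ‖x‖ ∧ ‖x‖ < 1} × unitInterval =>
        ((1 - p.2.1) * ‖p.1.1‖ + p.2.1 * (3 / 4)) / ‖p.1.1‖ :=
      (((continuous_const.sub h2).mul h1.norm).add (h2.mul continuous_const)).div h1.norm
        fun x => (hpos _).ne'
    exact (h3.smul h1).subtype_mk _
  · refine Subtype.ext ?_
    simp [(hpos x).ne']
  · refine Subtype.ext ?_
    simp

end Euclidean
end ConvexStruct

namespace ConvexStruct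

/-- The space `X` arises from its closed subspace `A` by attaching `p`-cells along the
characteristic maps `Φ`. -/
structure CellAttachment {E ι : Type*} [TopologicalSpace E] (p : ℕ) (A X : Set E)
    (Φ : ι → (Fin p → ℝ) → E) : Prop where
  continuousOn : ∀ i, ContinuousOn (Φ i) (Metric.closedBall 0 1)
  inj : ∀ i j y z, ‖y‖ < 1 → ‖z‖ < 1 → Φ i y = Φ j z → i = j ∧ y = z
  frontier : ∀ i y, ‖y‖ = 1 → Φ i y ∈ A
  interior : ∀ i y, ‖y‖ < 1 → Φ i y ∉ A
  mem_iff : ∀ x, x ∈ X ↔ x ∈ A ∨ ∃ i y, ‖y‖ < 1 ∧ Φ i y = x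
  isClosed_base : IsClosed A
  isClosed_of : ∀ K ⊆ X, IsClosed (K ∩ A) →
    (∀ i, IsClosed (K ∩ Φ i '' Metric.closedBall 0 1)) → IsClosed K
  symm : ∀ i, ∃ s : E → (Fin p → ℝ), ContinuousOn s (Φ i '' Metric.ball 0 1) ∧
    ∀ y, ‖y‖ < 1 → s (Φ i y) = y

namespace CellAttachment

variable {E ι : Type*} [TopologicalSpace E] {p : ℕ} {A X : Set E}
  {Φ : ι → (Fin p → ℝ) → E}

lemma base_subset (h : CellAttachment p A X Φ) : A ⊆ X := fun x hx => (h.mem_iff x).mpr (Or.inl hx)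

lemma map_mem (h : CellAttachment p A X Φ) (i : ι) (y : Metric.closedBall (0 : Fin p → ℝ) 1) :
    Φ i y ∈ X := by
  have hy : ‖y.1‖ ≤ 1 := mem_closedBall_zero_iff.mp y.2
  rcases hy.lt_or_eq with hy | hy
  · exact (h.mem_iff _).mpr (Or.inr ⟨i, y, hy, rfl⟩)
  · exact h.base_subset (h.frontier i y hy)

/-- Extension of continuous maps over the attached cells. -/
theorem exists_extension [T2Space E] (h : CellAttachment p A X Φ) {Z : Type*} [TopologicalSpace Z]
    (a : C(A, Z)) (c : ι → C(Metric.closedBall (0 : Fin p → ℝ) 1, Z))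
    (hac : ∀ i (y : Metric.closedBall (0 : Fin p → ℝ) 1) (hy : ‖y.1‖ = 1),
      a ⟨Φ i y, h.frontier i y hy⟩ = c i y) :
    ∃ f : C(X, Z), (∀ x : A, f ⟨x, h.base_subset x.2⟩ = a x) ∧
      ∀ i (y : Metric.closedBall (0 : Fin p → ℝ) 1), f ⟨Φ i y, h.map_mem i y⟩ = c i y := by
  classical
  have hex : ∀ x : X, x.1 ∉ A → ∃ i, ∃ y : Metric.closedBall (0 : Fin p → ℝ) 1,
      ‖y.1‖ < 1 ∧ Φ i y = x := fun x hx => by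
    obtain ⟨i, y, hy, hyx⟩ := ((h.mem_iff x).mp x.2).resolve_left hx
    exact ⟨i, ⟨y, mem_closedBall_zero_iff.mpr hy.le⟩, hy, hyx⟩
  choose i y hy hyx using hex
  let f : X → Z := fun x => if hx : x.1 ∈ A then a ⟨x, hx⟩ else c (i x hx) (y x hx)
  have hfA : ∀ x : A, f ⟨x, h.base_subset x.2⟩ = a x := fun x => dif_pos x.2
  have hfc : ∀ i (y : Metric.closedBall (0 : Fin p → ℝ) 1), f ⟨Φ i y, h.map_mem i y⟩ = c i y := fun j z => by
    have hz : ‖z.1‖ ≤ 1 := mem_closedBall_zero_iff.mp z.2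
    rcases hz.lt_or_eq with hz | hz
    · have hA := h.interior j z hz
      have : f ⟨Φ j z, h.map_mem j z⟩ = _ := dif_neg hA
      rw [this]
      obtain ⟨h1, h2⟩ := h.inj _ _ _ _ (hy ⟨Φ j z, h.map_mem j z⟩ hA) hz
        (hyx ⟨Φ j z, h.map_mem j z⟩ hA)
      rw [h1, Subtype.ext h2]
    · rw [← hac j z hz]
      exact dif_pos (h.frontier j z hz)
  refine ⟨⟨f, ?_⟩, hfA, hfc⟩
  rw [continuous_iff_isClosed]
  intro C hC
  have hK : IsClosed (Subtype.val '' (f ⁻¹' C) : Set E) := by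
    refine h.isClosed_of _ (by rintro _ ⟨x, -, rfl⟩; exact x.2) ?_ fun j => ?_
    · have : Subtype.val '' (f ⁻¹' C) ∩ A = Subtype.val '' (a ⁻¹' C) := by
        ext x
        constructor
        · rintro ⟨⟨x, hx, rfl⟩, hxA⟩
          exact ⟨⟨x, hxA⟩, by rw [Set.mem_preimage, ← hfA]; exact hx, rfl⟩
        · rintro ⟨x, hx, rfl⟩
          exact ⟨⟨⟨x, h.base_subset x.2⟩, by rw [Set.mem_preimage, hfA]; exact hx, rfl⟩, x.2⟩
      rw [this]
      exact h.isClosed_base.isClosedEmbedding_subtypeVal.isClosedMap _ (hC.preimage a.continuous)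
    · have : Subtype.val '' (f ⁻¹' C) ∩ Φ j '' Metric.closedBall 0 1 =
          (fun y : Metric.closedBall (0 : Fin p → ℝ) 1 => Φ j y) '' (c j ⁻¹' C) := by
        ext x
        constructor
        · rintro ⟨⟨x, hx, rfl⟩, z, hz, hzx⟩
          refine ⟨⟨z, hz⟩, ?_, hzx⟩
          rw [Set.mem_preimage, ← hfc]
          have hfx := congrArg f (Subtype.ext hzx : (⟨Φ j z, h.map_mem j ⟨z, hz⟩⟩ : X) = x)
          exact (congrArg (· ∈ C) hfx).mpr hx
        · rintro ⟨z, hz, rfl⟩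
          exact ⟨⟨⟨_, h.map_mem j z⟩, by rw [Set.mem_preimage, hfc]; exact hz, rfl⟩, z, z.2, rfl⟩
      rw [this]
      have : CompactSpace (Metric.closedBall (0 : Fin p → ℝ) 1) :=
        isCompact_iff_compactSpace.mp (isCompact_closedBall _ _)
      exact ((hC.preimage (c j).continuous).isCompact.image
        (h.continuousOn j).restrict).isClosed
  convert hK.preimage continuous_subtype_val using 1
  exact (Set.preimage_image_eq _ Subtype.val_injective).symm

lemma exists_norm [T2Space E] (h : CellAttachment p A X Φ) :
    ∃ r : C(X, ℝ), (∀ x : A, r ⟨x, h.base_subset x.2⟩ = 1) ∧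
      ∀ i (y : Metric.closedBall (0 : Fin p → ℝ) 1), r ⟨Φ i y, h.map_mem i y⟩ = ‖y.1‖ :=
  h.exists_extension (ContinuousMap.const _ 1)
    (fun _ => ⟨fun y => ‖y.1‖, continuous_subtype_val.norm⟩) fun _ _ hy => hy.symm

/-- The factor of the radial deformation. -/
def factor (p : ℕ) (y : Fin p → ℝ) (t : ℝ) : ℝ := min (1 + t) (1 / max ‖y‖ (1 / 2))

lemma continuous_factor (p : ℕ) : Continuous fun x : (Fin p → ℝ) × ℝ => factor p x.1 x.2 := by
  unfold factor
  refine Continuous.min (by fun_prop) (Continuous.div continuous_const (by fun_prop) fun x => ?_)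
  have : (1 / 2 : ℝ) ≤ max ‖x.1‖ (1 / 2) := le_max_right _ _
  linarith

lemma norm_factor_smul_le (y : Fin p → ℝ) {t : ℝ} (ht : 0 ≤ t) : ‖factor p y t • y‖ ≤ 1 := by
  have h0 : (0 : ℝ) < max ‖y‖ (1 / 2) := lt_max_of_lt_right (by norm_num)
  rw [norm_smul, Real.norm_of_nonneg (show 0 ≤ factor p y t from
    le_min (by linarith) (by positivity))]
  calc _ ≤ 1 / max ‖y‖ (1 / 2) * max ‖y‖ (1 / 2) := by
        refine mul_le_mul (min_le_right _ _) (le_max_left _ _) (norm_nonneg _) (by positivity)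
    _ = 1 := by field_simp

lemma factor_zero {y : Fin p → ℝ} (hy : ‖y‖ ≤ 1) : factor p y 0 = 1 := by
  have h0 : (0 : ℝ) < max ‖y‖ (1 / 2) := lt_max_of_lt_right (by norm_num)
  rw [factor, add_zero, min_eq_left]
  rw [le_div_iff₀ h0, one_mul]
  exact max_le hy (by norm_num)

lemma factor_of_norm_eq_one {y : Fin p → ℝ} (hy : ‖y‖ = 1) {t : ℝ} (ht : 0 ≤ t) :
    factor p y t = 1 := by
  rw [factor, hy, max_eq_left (by norm_num), div_one, min_eq_right (by linarith)]

lemma one_le_factor {y : Fin p → ℝ} (hy : ‖y‖ ≤ 1) {t : ℝ} (ht : 0 ≤ t) : 1 ≤ factor p y t := by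
  have h0 : (0 : ℝ) < max ‖y‖ (1 / 2) := lt_max_of_lt_right (by norm_num)
  refine le_min (by linarith) ?_
  rw [le_div_iff₀ h0, one_mul]
  exact max_le hy (by norm_num)

lemma norm_factor_one_smul {y : Fin p → ℝ} (hy : 1 / 2 < ‖y‖) : ‖factor p y 1 • y‖ = 1 := by
  have : 1 / ‖y‖ ≤ 1 + 1 := by
    rw [div_le_iff₀ (by linarith)]; linarith
  rw [factor, max_eq_left hy.le, min_eq_right this, norm_smul, norm_div, norm_one, norm_norm]
  exact div_mul_cancel₀ _ (by linarith)

/-- The radial deformation. -/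
theorem exists_push [T2Space E] (h : CellAttachment p A X Φ) :
    ∃ F : C(X × unitInterval, E), (∀ (x : A) t, F (⟨x, h.base_subset x.2⟩, t) = x) ∧
      ∀ i (y : Metric.closedBall (0 : Fin p → ℝ) 1) (t : unitInterval),
        F (⟨Φ i y, h.map_mem i y⟩, t) = Φ i (factor p y t • y.1) := by
  have hm : ∀ (y : Metric.closedBall (0 : Fin p → ℝ) 1) (t : unitInterval),
      factor p y t • y.1 ∈ Metric.closedBall (0 : Fin p → ℝ) 1 := fun y t =>
    mem_closedBall_zero_iff.mpr (norm_factor_smul_le _ t.2.1)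
  let P : ι → C(Metric.closedBall (0 : Fin p → ℝ) 1 × unitInterval, E) := fun i =>
    ⟨fun x => Φ i (factor p x.1 x.2 • x.1.1), by
      have h1 : Continuous fun x : Metric.closedBall (0 : Fin p → ℝ) 1 × unitInterval =>
          (⟨_, hm x.1 x.2⟩ : Metric.closedBall (0 : Fin p → ℝ) 1) := by
        have h2 : Continuous fun x : Metric.closedBall (0 : Fin p → ℝ) 1 × unitInterval => x.1.1 :=
          continuous_subtype_val.comp continuous_fst
        have h3 := (continuous_factor p).comp (h2.prodMk (continuous_subtype_val.comp continuous_snd))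
        exact (h3.smul h2).subtype_mk _
      exact (h.continuousOn i).restrict.comp h1⟩
  obtain ⟨f, hf1, hf2⟩ := h.exists_extension
    ((⟨Subtype.val, continuous_subtype_val⟩ : C(A, E)).comp
      (ContinuousMap.fst : C(A × unitInterval, A))).curry
    (fun i => (P i).curry) fun i y hy => by
      ext t
      change Φ i y = Φ i (factor p y t • y.1)
      rw [factor_of_norm_eq_one hy t.2.1, one_smul]
  refine ⟨f.uncurry, fun x t => ?_, fun i y t => ?_⟩
  · exact DFunLike.congr_fun (hf1 x) t
  · exact DFunLike.congr_fun (hf2 i y) t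

lemma isClosed_diff_openCell [T2Space E] (h : CellAttachment p A X Φ) (i : ι) :
    IsClosed (X \ Φ i '' Metric.ball 0 1) := by
  refine h.isClosed_of _ Set.diff_subset ?_ fun j => ?_
  · have : (X \ Φ i '' Metric.ball 0 1) ∩ A = A := by
      refine Set.inter_eq_right.mpr fun x hx => ⟨h.base_subset hx, ?_⟩
      rintro ⟨y, hy, rfl⟩
      exact h.interior i y (mem_ball_zero_iff.mp hy) hx
    rw [this]
    exact h.isClosed_base
  · by_cases hij : i = j
    · subst hij
      have : (X \ Φ i '' Metric.ball 0 1) ∩ Φ i '' Metric.closedBall 0 1 =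
          Φ i '' Metric.sphere 0 1 := by
        ext x
        constructor
        · rintro ⟨⟨-, hx⟩, y, hy, rfl⟩
          refine ⟨y, mem_sphere_zero_iff_norm.mpr ?_, rfl⟩
          refine (mem_closedBall_zero_iff.mp hy).eq_of_not_lt fun hlt => hx ?_
          exact ⟨y, mem_ball_zero_iff.mpr hlt, rfl⟩
        · rintro ⟨y, hy, rfl⟩
          have hyA := h.frontier i y (mem_sphere_zero_iff_norm.mp hy)
          refine ⟨⟨h.base_subset hyA, ?_⟩, y, Metric.sphere_subset_closedBall hy, rfl⟩
          rintro ⟨z, hz, hzy⟩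
          exact h.interior i z (mem_ball_zero_iff.mp hz) (hzy ▸ hyA)
      rw [this]
      exact ((isCompact_sphere _ _).image_of_continuousOn
        ((h.continuousOn i).mono Metric.sphere_subset_closedBall)).isClosed
    · have : (X \ Φ i '' Metric.ball 0 1) ∩ Φ j '' Metric.closedBall 0 1 =
          Φ j '' Metric.closedBall 0 1 := by
        refine Set.inter_eq_right.mpr ?_
        rintro _ ⟨y, hy, rfl⟩
        refine ⟨h.map_mem j ⟨y, hy⟩, ?_⟩
        rintro ⟨z, hz, hzy⟩
        rw [mem_ball_zero_iff] at hz
        rcases (mem_closedBall_zero_iff.mp hy).lt_or_eq with hy | hy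
        · exact hij (h.inj _ _ _ _ hz hy hzy).1
        · exact h.interior i z hz (hzy ▸ h.frontier j y hy)
      rw [this]
      exact ((isCompact_closedBall _ _).image_of_continuousOn (h.continuousOn j)).isClosed

lemma simplicesIn_iUnion [T2Space E] (h : CellAttachment p A X Φ) {B : Set (Fin p → ℝ)}
    (hB : B ⊆ Metric.ball 0 1) :
    simplicesIn (⋃ i, Φ i '' B) = fun n => ⋃ i, simplicesIn (Φ i '' B) n := by
  funext n
  refine subset_antisymm (fun σ hσ => ?_) (Set.iUnion_subset fun i =>
    simplicesIn_mono (Set.subset_iUnion (fun i => Φ i '' B) i) n)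
  have hex : ∀ t, ∃ i, ∃ y ∈ B, Φ i y = σ t := fun t => by simpa using hσ t
  have hX : ∀ t, σ t ∈ X := fun t => by
    obtain ⟨i, y, hy, hyt⟩ := hex t
    exact (h.mem_iff _).mpr (Or.inr ⟨i, y, mem_ball_zero_iff.mp (hB hy), hyt⟩)
  have hopen : ∀ i, IsOpen {t | σ t ∈ Φ i '' Metric.ball 0 1} := fun i => by
    rw [← isClosed_compl_iff]
    convert (h.isClosed_diff_openCell i).preimage (ContinuousMap.continuous σ) using 1
    ext t
    exact ⟨fun ht => ⟨hX t, ht⟩, fun ht => ht.2⟩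
  obtain ⟨i, -⟩ := hex (vertices n 0)
  have hdisj : ∀ t i, σ t ∈ Φ i '' Metric.ball 0 1 → σ t ∈ Φ i '' B := by
    rintro t i ⟨z, hz, hzt⟩
    obtain ⟨j, y, hy, hyt⟩ := hex t
    obtain ⟨h1, h2⟩ := h.inj i j z y (mem_ball_zero_iff.mp hz) (mem_ball_zero_iff.mp (hB hy))
      (hzt.trans hyt.symm)
    exact ⟨z, h2 ▸ hy, hzt⟩
  obtain ⟨i, hi⟩ : ∃ i, σ (vertices n 0) ∈ Φ i '' Metric.ball 0 1 := by
    obtain ⟨i, y, hy, hyt⟩ := hex (vertices n 0)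
    exact ⟨i, y, hB hy, hyt⟩
  have hclopen : IsClopen {t | σ t ∈ Φ i '' Metric.ball 0 1} := by
    refine ⟨?_, hopen i⟩
    rw [← isOpen_compl_iff]
    convert isOpen_iUnion fun j : {j // j ≠ i} => hopen j using 1
    ext t
    simp only [Set.mem_compl_iff, Set.mem_setOf_eq, Set.mem_iUnion]
    constructor
    · intro ht
      obtain ⟨j, y, hy, hyt⟩ := hex t
      exact ⟨⟨j, fun hj => ht (hj ▸ ⟨y, hB hy, hyt⟩)⟩, y, hB hy, hyt⟩
    · rintro ⟨⟨j, hj⟩, y, hy, hyt⟩ ⟨z, hz, hzt⟩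
      exact hj (h.inj _ _ _ _ (mem_ball_zero_iff.mp hy) (mem_ball_zero_iff.mp hz)
        (hyt.trans hzt.symm)).1
  have : PreconnectedSpace (stdSimplex ℝ (Fin (n + 1))) :=
    Subtype.preconnectedSpace (convex_stdSimplex ℝ _).isPreconnected
  have huniv := hclopen.eq_univ ⟨_, hi⟩
  refine Set.mem_iUnion_of_mem i fun t => hdisj t i ?_
  exact huniv.symm.subset (Set.mem_univ t)

lemma vanishing_image (h : CellAttachment p A X Φ) {B : Set (Fin p → ℝ)}
    (hB : B ⊆ Metric.ball 0 1) {q : ℕ} (hv : Vanishing.{u} (simplicesIn B) q) (i : ι) :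
    Vanishing.{u} (simplicesIn (Φ i '' B)) q := by
  obtain ⟨s, hs, hs'⟩ := h.symm i
  rw [vanishing_iff_spaceVanishing] at hv ⊢
  have hmem : ∀ x : Φ i '' B, s x ∈ B := by
    rintro ⟨_, y, hy, rfl⟩
    change s (Φ i y) ∈ B
    rwa [hs' y (mem_ball_zero_iff.mp (hB hy))]
  refine SpaceVanishing.of_homotopy (E' := B)
    ⟨fun x : Φ i '' B => ⟨s x, hmem x⟩, (hs.mono (Set.image_mono hB)).restrict.subtype_mk _⟩
    ⟨fun y : B => ⟨Φ i y, y, y.2, rfl⟩, ((h.continuousOn i).mono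
      (hB.trans Metric.ball_subset_closedBall)).restrict.subtype_mk _⟩
    ⟨fun x => x.1, continuous_fst⟩ (fun x => rfl) ?_ hv
  rintro ⟨_, y, hy, rfl⟩
  refine Subtype.ext ?_
  change Φ i y = Φ i (s (Φ i y))
  rw [hs' y (mem_ball_zero_iff.mp (hB hy))]

variable {H : Type*} [Group H] [MulAction H E] [ContinuousConstSMul H E] [MulAction H ι]

lemma equivariantVanishing_image [T2Space E] (h : CellAttachment p A X Φ)
    (hΦ : ∀ (g : H) i y, Φ (g • i) y = g • Φ i y)
    (hfree : ∀ (g : H) (i : ι), g • i = i → g = 1)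
    {B : Set (Fin p → ℝ)} (hB : B ⊆ Metric.ball 0 1) {q : ℕ}
    (hv : Vanishing.{u} (simplicesIn B) q) :
    EquivariantVanishing.{u} H (simplicesIn (⋃ i, Φ i '' B)) q := by
  rw [h.simplicesIn_iUnion hB]
  refine EquivariantVanishing.of_disjoint_family (faceEquivar_singularSimplices H) hfree
    (fun i => simplicesIn (Φ i '' B)) (fun i => faceClosed_simplicesIn _) ?_ ?_
    (h.vanishing_image hB hv)
  · intro g i n σ hσ t
    obtain ⟨y, hy, hyt⟩ := hσ t
    exact ⟨y, hy, by rw [hΦ, hyt]; rfl⟩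
  · intro n σ i j hi hj
    obtain ⟨y, hy, hyt⟩ := hi (vertices n 0)
    obtain ⟨z, hz, hzt⟩ := hj (vertices n 0)
    exact (h.inj _ _ _ _ (mem_ball_zero_iff.mp (hB hy)) (mem_ball_zero_iff.mp (hB hz))
      (hyt.trans hzt.symm)).1

/-- The equivariant cohomology after attaching free cells. -/
theorem equivariantVanishing [T2Space E] (h : CellAttachment p A X Φ)
    (hfreeE : ∀ (g : H) (x : E), g • x = x → g = 1)
    (hΦ : ∀ (g : H) i y, Φ (g • i) y = g • Φ i y)
    (hfree : ∀ (g : H) (i : ι), g • i = i → g = 1)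
    (hA : ∀ (g : H), ∀ x ∈ A, g • x ∈ A) (hv : EquivariantVanishing.{u} H (simplicesIn A) p) :
    EquivariantVanishing.{u} H (simplicesIn X) (p + 1) := by
  obtain ⟨r, hrA, hrΦ⟩ := h.exists_norm
  obtain ⟨F, hFA, hFΦ⟩ := h.exists_push
  have hcase : ∀ x : X, x.1 ∈ A ∨ ∃ i, ∃ y : Metric.closedBall (0 : Fin p → ℝ) 1,
      ‖y.1‖ < 1 ∧ Φ i y = x := fun x => by
    rcases (h.mem_iff x).mp x.2 with hx | ⟨i, y, hy, hyx⟩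
    · exact Or.inl hx
    · exact Or.inr ⟨i, ⟨y, mem_closedBall_zero_iff.mpr hy.le⟩, hy, hyx⟩
  have hrval : ∀ (x : X) i (y : Metric.closedBall (0 : Fin p → ℝ) 1), Φ i y = x → r x = ‖y.1‖ := 
    fun x i y hyx => by rw [← hrΦ i y]; exact congrArg r (Subtype.ext hyx.symm)
  have hFval : ∀ (x : X) i (y : Metric.closedBall (0 : Fin p → ℝ) 1) (t : unitInterval),
      Φ i y = x → F (x, t) = Φ i (factor p y t • y.1) := 
    fun x i y t hyx => by
      rw [← hFΦ i y t]; exact congrArg (fun x => F (x, t)) (Subtype.ext hyx.symm)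
  have hball : ∀ (y : Metric.closedBall (0 : Fin p → ℝ) 1) (t : unitInterval),
      factor p y t • y.1 ∈ Metric.closedBall (0 : Fin p → ℝ) 1 := fun y t =>
    mem_closedBall_zero_iff.mpr (norm_factor_smul_le _ t.2.1)
  let U : Set E := Subtype.val '' {x : X | 1 / 2 < r x}
  let V : Set E := Subtype.val '' {x : X | r x < 1}
  obtain ⟨O₁, hO₁, hO₁'⟩ := isOpen_induced_iff.mp (isOpen_lt continuous_const r.continuous :
    IsOpen {x : X | 1 / 2 < r x})
  obtain ⟨O₂, hO₂, hO₂'⟩ := isOpen_induced_iff.mp (isOpen_lt r.continuous continuous_const :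
    IsOpen {x : X | r x < 1})
  have hUO : X ∩ O₁ = U := by
    rw [← Subtype.image_preimage_coe, hO₁']
  have hVO : X ∩ O₂ = V := by
    rw [← Subtype.image_preimage_coe, hO₂']
  have hV : V = ⋃ i, Φ i '' Metric.ball 0 1 := by
    ext x
    simp only [Set.mem_iUnion]
    constructor
    · rintro ⟨x, hx, rfl⟩
      rcases hcase x with hxA | ⟨i, y, hy, hyx⟩
      · exact absurd (hrA ⟨x, hxA⟩) hx.ne
      · exact ⟨i, y, mem_ball_zero_iff.mpr hy, hyx⟩
    · rintro ⟨i, y, hy, rfl⟩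
      have := hrΦ i ⟨y, Metric.ball_subset_closedBall hy⟩
      exact ⟨_, this.trans_lt (mem_ball_zero_iff.mp hy), rfl⟩
  have hUV : U ∩ V = ⋃ i, Φ i '' {y | 1 / 2 < ‖y‖ ∧ ‖y‖ < 1} := by
    ext x
    simp only [Set.mem_iUnion]
    constructor
    · rintro ⟨⟨x, hx1, rfl⟩, ⟨x', hx, hxx⟩⟩
      obtain rfl := Subtype.ext hxx
      rcases hcase x' with hxA | ⟨i, y, hy, hyx⟩
      · exact absurd (hrA ⟨x', hxA⟩) hx.ne
      · exact ⟨i, y, ⟨by rw [← hrval x' i y hyx]; exact hx1, hy⟩, hyx⟩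
    · rintro ⟨i, y, hy, rfl⟩
      have := hrΦ i ⟨y, mem_closedBall_zero_iff.mpr hy.2.le⟩
      exact ⟨⟨_, hy.1.trans_eq this.symm, rfl⟩, ⟨_, this.trans_lt hy.2, rfl⟩⟩
  have hinv : ∀ (g : H) (x : X), ∃ hx : g • x.1 ∈ X, r ⟨g • x.1, hx⟩ = r x := by
    intro g x
    rcases hcase x with hxA | ⟨i, y, hy, hyx⟩
    · exact ⟨h.base_subset (hA g _ hxA), (hrA ⟨_, hA g _ hxA⟩).trans (hrA ⟨_, hxA⟩).symm⟩
    · have h1 : Φ (g • i) y = g • x.1 := by rw [hΦ, hyx]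
      have hm : g • x.1 ∈ X := h1 ▸ h.map_mem (g • i) y
      exact ⟨hm, (hrval ⟨_, hm⟩ (g • i) y h1).trans (hrval x i y hyx).symm⟩
  have hHX : ∀ (g : H), ∀ x ∈ X, g • x ∈ X := fun g x hx => (hinv g ⟨x, hx⟩).1
  have hHU : ∀ (g : H), ∀ x ∈ U, g • x ∈ U := by
    rintro g _ ⟨x, hx, rfl⟩
    obtain ⟨h1, h2⟩ := hinv g x
    exact ⟨⟨_, h1⟩, hx.trans_eq h2.symm, rfl⟩
  have hHV : ∀ (g : H), ∀ x ∈ V, g • x ∈ V := by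
    rintro g _ ⟨x, hx, rfl⟩
    obtain ⟨h1, h2⟩ := hinv g x
    exact ⟨⟨_, h1⟩, h2.trans_lt hx, rfl⟩
  have hAU : A ⊆ U := fun x hx => 
    ⟨⟨x, h.base_subset hx⟩, by rw [Set.mem_setOf_eq, hrA ⟨x, hx⟩]; norm_num, rfl⟩
  have hUX : U ⊆ X := by rintro _ ⟨x, -, rfl⟩; exact x.2
  have hUr : ∀ x : U, 1 / 2 < r ⟨x, hUX x.2⟩ := by
    rintro ⟨_, x, hx, rfl⟩; exact hx
  refine equivariantVanishing_of_cover hfreeE hO₁ hO₂ ?_ hUO hVO hHX hHU hHV ?_ ?_ ?_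
  · intro x hx
    by_cases h1 : r ⟨x, hx⟩ < 1
    · exact Or.inr (hVO.symm.subset ⟨⟨x, hx⟩, h1, rfl⟩).2
    · exact Or.inl (hUO.symm.subset ⟨⟨x, hx⟩, by rw [Set.mem_setOf_eq]; linarith, rfl⟩).2
  · refine EquivariantVanishing.of_relAcyclic (faceEquivar_singularSimplices H) 
      (singular_free hfreeE) (faceClosed_simplicesIn U) (smul_mem_simplicesIn hHU)
      (smul_mem_simplicesIn hA) (simplicesIn_mono hAU) ?_ (hv.mono (by omega))
    refine relAcyclic_of_homotopy
      (F.comp ⟨fun x => (⟨x.1, hUX x.1.2⟩, x.2),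
        ((continuous_subtype_val.comp continuous_fst).subtype_mk _).prodMk continuous_snd⟩)
      (fun x => ?_) (fun x t => ?_) (fun x hx t => ?_) (fun x => ?_)
    · rcases hcase ⟨x, hUX x.2⟩ with hxA | ⟨i, y, hy, hyx⟩
      · exact hFA ⟨x, hxA⟩ 0
      · refine (hFval ⟨x, hUX x.2⟩ i y 0 hyx).trans ?_
        rw [Set.Icc.coe_zero, factor_zero hy.le, one_smul]; exact hyx
    · rcases hcase ⟨x, hUX x.2⟩ with hxA | ⟨i, y, hy, hyx⟩
      · exact (hFA ⟨x, hxA⟩ t).symm ▸ hAU hxA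
      · have h1 := hFval ⟨x, hUX x.2⟩ i y t hyx
        refine ⟨⟨_, h.map_mem i ⟨_, hball y t⟩⟩, ?_, h1.symm⟩
        rw [Set.mem_setOf_eq, hrΦ, norm_smul]
        have h2 := hUr x
        rw [hrval _ i y hyx] at h2
        have h3 := one_le_factor hy.le t.2.1
        rw [Real.norm_of_nonneg (by linarith)]
        nlinarith
    · exact (hFA ⟨x, hx⟩ t).symm ▸ hx
    · rcases hcase ⟨x, hUX x.2⟩ with hxA | ⟨i, y, hy, hyx⟩
      · exact (hFA ⟨x, hxA⟩ 1).symm ▸ hxA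
      · have h1 := hFval ⟨x, hUX x.2⟩ i y 1 hyx
        have h2 := hUr x
        rw [hrval _ i y hyx] at h2
        refine h1.symm ▸ h.frontier i _ ?_
        rw [Set.Icc.coe_one, norm_factor_one_smul h2]
  · rw [hV]
    refine h.equivariantVanishing_image hΦ hfree subset_rfl ?_
    rw [vanishing_iff_spaceVanishing]
    have : ContractibleSpace (Metric.ball (0 : Fin p → ℝ) 1) :=
      (convex_ball _ _).contractibleSpace ⟨0, by simp⟩
    exact (SpaceVanishing.of_contractible _).mono (by omega)
  · rw [hUV]
    exact h.equivariantVanishing_image hΦ hfree (fun y hy => mem_ball_zero_iff.mpr hy.2)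
      (vanishing_annulus p)

end CellAttachment
end ConvexStruct

namespace ConvexStruct

section CW
variable {H E : Type u} [Group H] [TopologicalSpace E] [CWComplex (Set.univ : Set E)]
  [MulAction H E]

lemma _root_.ActsFreelyAndProperly.subgroup {G : Type u} [Group G] [MulAction G E]
    (h : ActsFreelyAndProperly G E) (H : Subgroup G) : ActsFreelyAndProperly H E where
  continuous := ⟨fun g => h.continuous.continuous_const_smul (g : G)⟩
  permutes_cells g := h.permutes_cells (g : G)
  free g x hx := Subtype.ext (h.free g x hx)
  proper := ⟨fun {K L} hK hL => by
    have := h.proper.finite_disjoint_inter_image hK hL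
    exact Set.Finite.preimage (f := ((↑) : H → G)) Subtype.val_injective.injOn this⟩

/-- The action on the cells. -/
@[reducible]
def cellMulAction (h : ActsFreelyAndProperly H E) (p : ℕ) :
    MulAction H (RelCWComplex.cell (Set.univ : Set E) p) where
  smul g i := (h.permutes_cells g p i).choose
  one_smul i := by
    refine RelCWComplex.openCell_congr p ?_
    rw [← (h.permutes_cells 1 p i).choose_spec]
    simp
  mul_smul g g' i := by
    refine RelCWComplex.openCell_congr p ?_
    refine (h.permutes_cells _ p i).choose_spec.symm.trans ?_
    refine Eq.trans ?_ (h.permutes_cells g p (h.permutes_cells g' p i).choose).choose_spec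
    rw [← (h.permutes_cells g' p i).choose_spec, Set.image_image]
    simp only [mul_smul]

lemma openCell_smul (h : ActsFreelyAndProperly H E) {p : ℕ} (g : H)
    (i : RelCWComplex.cell (Set.univ : Set E) p) :
    letI := cellMulAction h p
    RelCWComplex.openCell p (g • i) = (fun x => g • x) '' RelCWComplex.openCell p i :=
  (h.permutes_cells g p i).choose_spec.symm

lemma smul_mem_skeletonLT [T2Space E] (h : ActsFreelyAndProperly H E) {p : ℕ∞} (g : H) (x : E)
    (hx : x ∈ (RelCWComplex.skeletonLT (Set.univ : Set E) p : Set E)) :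
    g • x ∈ (RelCWComplex.skeletonLT (Set.univ : Set E) p : Set E) := by
  obtain ⟨m, hm, j, hj⟩ := CWComplex.mem_skeletonLT_iff.mp hx
  obtain ⟨j', hj'⟩ := h.permutes_cells g m j
  exact CWComplex.mem_skeletonLT_iff.mpr ⟨m, hm, j', hj' ▸ ⟨x, hj, rfl⟩⟩

lemma cell_free [T2Space E] (h : ActsFreelyAndProperly H E) (htf : ∀ g : H, IsOfFinOrder g → g = 1) {p : ℕ}
    (g : H) (i : RelCWComplex.cell (Set.univ : Set E) p)
    (hg : letI := cellMulAction h p; g • i = i) : g = 1 := by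
  letI := cellMulAction h p
  refine htf g (finite_powers.mp ?_)
  refine (h.proper.finite_disjoint_inter_image (RelCWComplex.isCompact_closedCell (i := i))
    (RelCWComplex.isCompact_closedCell (i := i))).subset ?_
  rintro _ ⟨k, rfl⟩
  have hk : g ^ k • i = i := by
    induction k with
    | zero => simp
    | succ k ih => rw [pow_succ, mul_smul, hg, ih]
  obtain ⟨x, hx⟩ := RelCWComplex.openCell_nonempty p i
  refine ⟨g ^ k • x, ⟨x, RelCWComplex.openCell_subset_closedCell p i hx, rfl⟩,
    RelCWComplex.openCell_subset_closedCell p i ?_⟩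
  have := openCell_smul h (g ^ k) i
  rw [hk] at this
  rw [this]
  exact ⟨x, hx, rfl⟩

/-- The skeleta arise by attaching cells along equivariant characteristic maps. -/
theorem exists_cellAttachment [T2Space E] (h : ActsFreelyAndProperly H E)
    (htf : ∀ g : H, IsOfFinOrder g → g = 1) (p : ℕ) :
    letI := cellMulAction h p
    ∃ Φ : RelCWComplex.cell (Set.univ : Set E) p → (Fin p → ℝ) → E,
      (∀ (g : H) i y, Φ (g • i) y = g • Φ i y) ∧
      CellAttachment p (RelCWComplex.skeletonLT (Set.univ : Set E) p : Set E)
        (RelCWComplex.skeletonLT (Set.univ : Set E) ((p + 1 : ℕ) : ℕ∞) : Set E) Φ := by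
  letI := cellMulAction h p
  have := h.continuous
  obtain ⟨Φ, hΦ, hR⟩ := exists_equivar (H := H) (X := RelCWComplex.cell (Set.univ : Set E) p)
    (Y := (Fin p → ℝ) → E) (fun g i => cell_free h htf g i)
    (fun i Φ => ∃ (g : H) (j : RelCWComplex.cell (Set.univ : Set E) p), g • j = i ∧
      Φ = fun y => g • RelCWComplex.map p j y)
    (by
      rintro g _ _ ⟨g', j, rfl, rfl⟩
      exact ⟨g * g', j, mul_smul _ _ _, funext fun y => (mul_smul _ _ _).symm⟩)
    (fun i => ⟨_, 1, i, one_smul _ _, rfl⟩)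
  have himage : ∀ i, Φ i '' Metric.ball 0 1 = RelCWComplex.openCell p i := fun i => by
    obtain ⟨g, j, hgj, hΦi⟩ := hR i
    rw [hΦi, ← hgj, openCell_smul, RelCWComplex.openCell, Set.image_image]
  have hopen : ∀ i y, ‖y‖ < 1 → Φ i y ∈ RelCWComplex.openCell p i := fun i y hy => by
    rw [← himage]
    exact ⟨y, mem_ball_zero_iff.mpr hy, rfl⟩
  have hcont : ∀ i, ContinuousOn (Φ i) (Metric.closedBall 0 1) := fun i => by
    obtain ⟨g, j, -, hΦi⟩ := hR i
    rw [hΦi]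
    exact (RelCWComplex.continuousOn p j).const_smul g
  refine ⟨Φ, fun g i y => congrFun (hΦ g i) y, hcont, ?_, ?_, ?_, ?_,
    (RelCWComplex.skeletonLT _ _).closed, ?_, ?_⟩
  · intro i j y z hy hz hyz
    have hij : i = j := by
      by_contra hij
      have hne : (⟨p, i⟩ : Σ n, RelCWComplex.cell (Set.univ : Set E) n) ≠ ⟨p, j⟩ := fun h => 
        hij (by simpa using h)
      exact Set.disjoint_left.mp (RelCWComplex.disjoint_openCell_of_ne hne) (hopen i y hy)
        (hyz ▸ hopen j z hz)
    subst hij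
    refine ⟨rfl, ?_⟩
    obtain ⟨g, j, -, hΦi⟩ := hR i
    rw [hΦi] at hyz
    refine (RelCWComplex.map p j).injOn ?_ ?_ (MulAction.injective g hyz)
    · rw [RelCWComplex.source_eq]; exact mem_ball_zero_iff.mpr hy
    · rw [RelCWComplex.source_eq]; exact mem_ball_zero_iff.mpr hz
  · intro i y hy
    obtain ⟨g, j, -, hΦi⟩ := hR i
    rw [hΦi]
    exact smul_mem_skeletonLT h g _ (RelCWComplex.cellFrontier_subset_skeletonLT p j
      ⟨y, mem_sphere_zero_iff_norm.mpr hy, rfl⟩)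
  · intro i y hy hmem
    exact Set.disjoint_left.mp (RelCWComplex.disjoint_skeletonLT_openCell le_rfl) hmem
      (hopen i y hy)
  · intro x
    rw [SetLike.mem_coe, SetLike.mem_coe, CWComplex.mem_skeletonLT_iff,
      CWComplex.mem_skeletonLT_iff]
    constructor
    · rintro ⟨m, hm, j, hj⟩
      have hm : m < p + 1 := by exact_mod_cast hm
      rcases Nat.lt_succ_iff_lt_or_eq.mp hm with hm | rfl
      · exact Or.inl ⟨m, by exact_mod_cast hm, j, hj⟩
      · rw [← himage] at hj
        obtain ⟨y, hy, hyx⟩ := hj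
        exact Or.inr ⟨j, y, mem_ball_zero_iff.mp hy, hyx⟩
    · rintro (⟨m, hm, j, hj⟩ | ⟨i, y, hy, rfl⟩)
      · exact ⟨m, hm.trans (by exact_mod_cast p.lt_succ_self), j, hj⟩
      · exact ⟨p, by exact_mod_cast p.lt_succ_self, i, hopen i y hy⟩
  · intro K hK hKA hKc
    refine CWComplex.isClosed_of_disjoint_openCell_or_isClosed_inter_closedCell
      (C := (Set.univ : Set E)) (Set.subset_univ _) fun m _ j => ?_
    rcases lt_trichotomy m p with hm | rfl | hm
    · right
      have : K ∩ RelCWComplex.closedCell m j =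
          (K ∩ (RelCWComplex.skeletonLT (Set.univ : Set E) p : Set E)) ∩
            RelCWComplex.closedCell m j := by
        have hsub : RelCWComplex.closedCell m j ⊆
            (RelCWComplex.skeletonLT (Set.univ : Set E) p : Set E) :=
          (RelCWComplex.closedCell_subset_skeletonLT m j).trans
            (RelCWComplex.skeletonLT_mono (by exact_mod_cast hm))
        rw [Set.inter_assoc, Set.inter_eq_right.mpr hsub]
      rw [this]
      exact hKA.inter RelCWComplex.isClosed_closedCell
    · right
      have : K ∩ RelCWComplex.closedCell m j =
          (K ∩ Φ j '' Metric.closedBall 0 1) ∩ RelCWComplex.closedCell m j := by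
        have hsub : RelCWComplex.closedCell m j ⊆ Φ j '' Metric.closedBall 0 1 := by
          rw [← RelCWComplex.closure_openCell_eq_closedCell, ← himage]
          refine closure_minimal (Set.image_mono Metric.ball_subset_closedBall) ?_
          exact ((isCompact_closedBall _ _).image_of_continuousOn (hcont j)).isClosed
        rw [Set.inter_assoc, Set.inter_eq_right.mpr hsub]
      rw [this]
      exact (hKc j).inter RelCWComplex.isClosed_closedCell
    · left
      refine (RelCWComplex.disjoint_skeletonLT_openCell ?_).mono_left hK
      exact_mod_cast hm
  · intro i
    obtain ⟨g, j, -, hΦi⟩ := hR i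
    refine ⟨fun x => (RelCWComplex.map p j).symm (g⁻¹ • x), ?_, fun y hy => ?_⟩
    · refine (RelCWComplex.continuousOn_symm p j).comp (continuous_const_smul g⁻¹).continuousOn ?_
      rintro _ ⟨y, hy, rfl⟩
      rw [hΦi]
      simp only [inv_smul_smul]
      refine (RelCWComplex.map p j).map_source ?_
      rwa [RelCWComplex.source_eq]
    · simp only [hΦi, inv_smul_smul]
      refine (RelCWComplex.map p j).left_inv ?_
      rw [RelCWComplex.source_eq]
      exact mem_ball_zero_iff.mpr hy

/-- The equivariant cohomology of the skeleta. -/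
theorem equivariantVanishing_skeletonLT [T2Space E] [ContinuousConstSMul H E]
    (h : ActsFreelyAndProperly H E) (htf : ∀ g : H, IsOfFinOrder g → g = 1) (p : ℕ) :
    EquivariantVanishing.{u} H
      (simplicesIn (RelCWComplex.skeletonLT (Set.univ : Set E) p : Set E)) p := by
  induction p with
  | zero =>
    refine EquivariantVanishing.of_empty (fun n => Set.eq_empty_of_forall_notMem fun σ hσ => ?_) 0
    have := hσ (vertices n 0)
    rw [Nat.cast_zero, CWComplex.skeletonLT_zero_eq_empty] at this
    exact this
  | succ p ih =>
    letI := cellMulAction h p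
    obtain ⟨Φ, hΦ, hatt⟩ := exists_cellAttachment h htf p
    exact hatt.equivariantVanishing h.free hΦ (fun g i => cell_free h htf g i)
      (fun g x hx => smul_mem_skeletonLT h g x hx) ih

/-- The equivariant cohomology of a finite dimensional complex. -/
theorem equivariantVanishing_of_hasCWDimension [T2Space E] [ContinuousConstSMul H E]
    (h : ActsFreelyAndProperly H E) (htf : ∀ g : H, IsOfFinOrder g → g = 1) {e : ℕ}
    (he : HasCWDimension E e) :
    EquivariantVanishing.{u} H (simplicesIn (Set.univ : Set E)) (e + 1) := by
  have : (RelCWComplex.skeletonLT (Set.univ : Set E) ((e + 1 : ℕ) : ℕ∞) : Set E) = Set.univ := by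
    refine Set.eq_univ_of_forall fun x => ?_
    have hx : x ∈ ⋃ (n : ℕ) (j : RelCWComplex.cell (Set.univ : Set E) n),
        RelCWComplex.openCell n j := by
      rw [CWComplex.iUnion_openCell_eq_complex]; trivial
    simp only [Set.mem_iUnion] at hx
    obtain ⟨m, j, hj⟩ := hx
    refine CWComplex.mem_skeletonLT_iff.mpr ⟨m, ?_, j, hj⟩
    by_contra hm
    have := he.isEmpty_cell m (by
      have : ¬ m < e + 1 := fun h => hm (by exact_mod_cast h)
      omega)
    exact this.elim j
  rw [← this]
  exact equivariantVanishing_skeletonLT h htf (e + 1)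

end CW
end ConvexStruct

namespace ExtVanishing
open Abelian Limits
universe w v' u'
variable {C : Type u'} [Category.{v'} C] [Abelian C] [HasExt.{w} C]

lemma of_iso_left {X X' : C} (e : X ≅ X') {N : C} {i : ℕ}
    (h : Subsingleton (Abelian.Ext.{w} X N i)) : Subsingleton (Abelian.Ext.{w} X' N i) := by
  refine subsingleton_of_forall_eq 0 fun x => ?_
  have h1 : (Ext.mk₀ e.hom).comp x (zero_add i) = 0 := Subsingleton.elim _ _
  have h2 : (Ext.mk₀ e.inv).comp ((Ext.mk₀ e.hom).comp x (zero_add i)) (zero_add i) = x := by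
    rw [Ext.mk₀_comp_mk₀_assoc, e.inv_hom_id, Ext.mk₀_id_comp]
  rw [← h2, h1, Ext.comp_zero]

lemma of_iso_right {N N' : C} (e : N ≅ N') {X : C} {i : ℕ}
    (h : Subsingleton (Abelian.Ext.{w} X N i)) : Subsingleton (Abelian.Ext.{w} X N' i) := by
  refine subsingleton_of_forall_eq 0 fun x => ?_
  have h1 : x.comp (Ext.mk₀ e.inv) (add_zero i) = 0 := Subsingleton.elim _ _
  have h2 : (x.comp (Ext.mk₀ e.inv) (add_zero i)).comp (Ext.mk₀ e.hom) (add_zero i) = x := by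
    rw [Ext.comp_assoc_of_third_deg_zero, Ext.mk₀_comp_mk₀, e.inv_hom_id, Ext.comp_mk₀_id]
  rw [← h2, h1, Ext.zero_comp]

variable {S : ShortComplex C} (hS : S.ShortExact) {N : C}
include hS

lemma left {i : ℕ} (h₂ : Subsingleton (Abelian.Ext.{w} S.X₂ N i))
    (h₃ : Subsingleton (Abelian.Ext.{w} S.X₃ N (i + 1))) :
    Subsingleton (Abelian.Ext.{w} S.X₁ N i) := by
  refine subsingleton_of_forall_eq 0 fun x => ?_
  obtain ⟨y, rfl⟩ := Ext.contravariant_sequence_exact₁ hS N x (add_comm 1 i)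
    (Subsingleton.elim _ _)
  rw [Subsingleton.elim y 0, Ext.comp_zero]

lemma right {i : ℕ} (h₁ : Subsingleton (Abelian.Ext.{w} S.X₁ N i))
    (h₂ : Subsingleton (Abelian.Ext.{w} S.X₂ N (i + 1))) :
    Subsingleton (Abelian.Ext.{w} S.X₃ N (i + 1)) := by
  refine subsingleton_of_forall_eq 0 fun x => ?_
  obtain ⟨y, rfl⟩ := Ext.contravariant_sequence_exact₃ hS N x
    (Subsingleton.elim _ _) (add_comm 1 i)
  rw [Subsingleton.elim y 0, Ext.comp_zero]

lemma right_one (h₁ : ∀ f : S.X₁ ⟶ N, ∃ g : S.X₂ ⟶ N, S.f ≫ g = f)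
    (h₂ : Subsingleton (Abelian.Ext.{w} S.X₂ N 1)) :
    Subsingleton (Abelian.Ext.{w} S.X₃ N 1) := by
  refine subsingleton_of_forall_eq 0 fun x => ?_
  obtain ⟨y, rfl⟩ := Ext.contravariant_sequence_exact₃ hS N x
    (Subsingleton.elim _ _) (add_zero 1)
  obtain ⟨f, rfl⟩ := (Ext.mk₀_bijective _ _).2 y
  obtain ⟨g, rfl⟩ := h₁ f
  rw [← Ext.mk₀_comp_mk₀, hS.extClass_comp_assoc]

lemma exists_extension (h₃ : Subsingleton (Abelian.Ext.{w} S.X₃ N 1)) (f : S.X₁ ⟶ N) :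
    ∃ g : S.X₂ ⟶ N, S.f ≫ g = f := by
  obtain ⟨y, hy⟩ := Ext.contravariant_sequence_exact₁ hS N (Ext.mk₀ f) (add_zero 1)
    (Subsingleton.elim _ _)
  obtain ⟨g, rfl⟩ := (Ext.mk₀_bijective _ _).2 y
  rw [Ext.mk₀_comp_mk₀] at hy
  exact ⟨g, (Ext.mk₀_bijective _ _).1 hy⟩

omit hS

section Complex
variable (K : ChainComplex C ℕ)

/-- The short complex relating consecutive objects of opcycles. -/
abbrev opcyclesSequence (j : ℕ) : ShortComplex C where
  X₁ := K.opcycles (j + 1)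
  X₂ := K.X j
  X₃ := K.opcycles j
  f := K.fromOpcycles (j + 1) j
  g := K.pOpcycles j
  zero := by
    rw [← cancel_epi (K.pOpcycles (j + 1))]
    simp

lemma shortExact_opcyclesSequence {j : ℕ} (h : K.ExactAt (j + 1)) :
    (opcyclesSequence K j).ShortExact where
  exact := by
    have h1 : (ShortComplex.mk (K.d (j + 1) j) (K.pOpcycles j) (by simp)).Exact :=
      ShortComplex.exact_of_g_is_cokernel _ (K.opcyclesIsCokernel (j + 1) j (by simp))
    let φ : ShortComplex.mk (K.d (j + 1) j) (K.pOpcycles j) (by simp) ⟶ opcyclesSequence K j :=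
      { τ₁ := K.pOpcycles (j + 1)
        τ₂ := 𝟙 _
        τ₃ := 𝟙 _ }
    have : Epi φ.τ₁ := inferInstanceAs (Epi (K.pOpcycles (j + 1)))
    have : IsIso φ.τ₂ := inferInstanceAs (IsIso (𝟙 _))
    have : Mono φ.τ₃ := inferInstanceAs (Mono (𝟙 _))
    exact (ShortComplex.exact_iff_of_epi_of_isIso_of_mono φ).mp h1
  mono_f := by
    have h2 := (K.exactAt_iff' (j + 2) (j + 1) j (by simp) (by simp)).mp h
    rw [ShortComplex.exact_iff_mono_fromOpcycles] at h2
    have h3 : Mono ((K.opcyclesIsoSc' (j + 2) (j + 1) j (by simp) (by simp)).inv ≫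
        K.fromOpcycles (j + 1) j) := by
      rw [K.opcyclesIsoSc'_inv_fromOpcycles (j + 2) (j + 1) j (by simp) (by simp)]
      exact h2
    exact (MorphismProperty.cancel_left_of_respectsIso (MorphismProperty.monomorphisms C) _ _).mp h3
  epi_g := inferInstanceAs (Epi (K.pOpcycles j))

/-- Dimension shifting along a projective complex. -/
theorem subsingleton_ext_opcycles [∀ j, Projective (K.X j)] {n e : ℕ} (hex : ∀ i, n < i → K.ExactAt i)
    (hN : ∀ j, e ≤ j → ∀ f : K.X (j + 1) ⟶ N, K.d (j + 2) (j + 1) ≫ f = 0 →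
      ∃ g : K.X j ⟶ N, K.d (j + 1) j ≫ g = f) (i : ℕ) {j : ℕ} (hj : n ≤ j) (hij : e ≤ j + i) :
    Subsingleton (Abelian.Ext.{w} (K.opcycles j) N (i + 1)) := by
  induction i generalizing j with
  | zero =>
    refine right_one (shortExact_opcyclesSequence K (hex (j + 1) (by omega))) (fun f => ?_)
      (Ext.subsingleton_of_projective _ _ _)
    obtain ⟨g, hg⟩ := hN j hij (K.pOpcycles (j + 1) ≫ f) (by simp)
    refine ⟨g, ?_⟩
    rw [← cancel_epi (K.pOpcycles (j + 1)), ← hg]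
    simp
  | succ i ih =>
    exact right (shortExact_opcyclesSequence K (hex (j + 1) (by omega)))
      (ih (by omega) (by omega)) (Ext.subsingleton_of_projective _ _ _)

/-- The short complex from homology to opcycles. -/
abbrev homologySequence (n : ℕ) : ShortComplex C where
  X₁ := K.homology n
  X₂ := K.opcycles n
  X₃ := cokernel (K.homologyι n)
  f := K.homologyι n
  g := cokernel.π _
  zero := cokernel.condition _

lemma shortExact_homologySequence (n : ℕ) : (homologySequence K n).ShortExact where
  exact := ShortComplex.exact_of_g_is_cokernel _ (cokernelIsCokernel _)
  mono_f := inferInstanceAs (Mono (K.homologyι n))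
  epi_g := inferInstanceAs (Epi (cokernel.π _))

lemma exists_mono_cokernel_homologyι (n : ℕ) :
    ∃ (m : ℕ) (f : cokernel (K.homologyι n) ⟶ K.X m), Mono f := by
  have h := ShortComplex.exact_of_f_is_kernel
    (ShortComplex.mk (K.homologyι n) (K.fromOpcycles n ((ComplexShape.down ℕ).next n)) (by simp))
    (K.homologyIsKernel n _ rfl)
  exact ⟨_, _, h.mono_cokernelDesc⟩

end Complex
end ExtVanishing

section Hereditary
variable {R : Type u} [CommRing R] [IsDomain R] [IsPrincipalIdealRing R]

lemma Module.Baer.of_surjective {I Q : Type u} [AddCommGroup I] [Module R I] [AddCommGroup Q]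
    [Module R Q] (hI : Module.Baer R I) (π : I →ₗ[R] Q) (hπ : Function.Surjective π) :
    Module.Baer R Q := by
  intro J g
  obtain ⟨g₁, hg₁⟩ := Module.projective_lifting_property π g hπ
  obtain ⟨g₂, hg₂⟩ := hI J g₁
  refine ⟨π ∘ₗ g₂, fun x hx => ?_⟩
  rw [LinearMap.comp_apply, hg₂ x hx, ← hg₁, LinearMap.comp_apply]

/-- Submodules of projective modules over a principal ideal domain are projective. -/
theorem Module.Projective.of_injective_pid {B F : Type u} [AddCommGroup B] [Module R B]
    [AddCommGroup F] [Module R F] [Module.Projective R F] (j : B →ₗ[R] F)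
    (hj : Function.Injective j) : Module.Projective R B := by
  refine Module.Projective.of_lifting_property'' fun Y hY => ?_
  obtain ⟨I, i, hI, hi⟩ : ∃ (I : ModuleCat.{u} R) (i : (B →₀ R) →ₗ[R] I),
      Module.Baer R I ∧ Function.Injective i := by
    let M := ModuleCat.of R (B →₀ R)
    have h : CategoryTheory.Injective (ModuleCat.of R (Injective.under M : ModuleCat.{u} R)) :=
      inferInstanceAs (CategoryTheory.Injective (Injective.under M))
    exact ⟨Injective.under M, (Injective.ι M).hom,
      Module.Baer.of_injective (Module.injective_module_of_injective_object R _),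
      (ModuleCat.mono_iff_injective _).mp inferInstance⟩
  let K : Submodule R I := (LinearMap.ker Y).map i
  have hQ : Module.Injective R (I ⧸ K) := (hI.of_surjective K.mkQ K.mkQ_surjective).injective
  let φ : B →ₗ[R] I ⧸ K := (LinearMap.ker Y).mapQ K i (Submodule.le_comap_map i _) ∘ₗ
    (Y.quotKerEquivOfSurjective hY).symm.toLinearMap
  have hφ (a : B →₀ R) : φ (Y a) = K.mkQ (i a) := by
    have h : (Y.quotKerEquivOfSurjective hY).symm (Y a) = (LinearMap.ker Y).mkQ a := by
      rw [LinearEquiv.symm_apply_eq]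
      rfl
    change (LinearMap.ker Y).mapQ K i (Submodule.le_comap_map i _)
      ((Y.quotKerEquivOfSurjective hY).symm (Y a)) = _
    rw [h]
    rfl
  obtain ⟨φ', hφ'⟩ := hQ.out j hj φ
  obtain ⟨ψ, hψ⟩ := Module.projective_lifting_property K.mkQ φ' K.mkQ_surjective
  have key (a : B →₀ R) : ∃ c ∈ LinearMap.ker Y, i c = ψ (j (Y a)) - i a := by
    have h : ψ (j (Y a)) - i a ∈ K := by
      rw [← Submodule.ker_mkQ K, LinearMap.mem_ker, map_sub, ← LinearMap.comp_apply, hψ, hφ', hφ,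
        sub_self]
    exact h
  have hr (b : B) : ψ (j b) ∈ LinearMap.range i := by
    obtain ⟨a, rfl⟩ := hY b
    obtain ⟨c, -, hc⟩ := key a
    exact ⟨c + a, by rw [map_add, hc, sub_add_cancel]⟩
  refine ⟨(LinearEquiv.ofInjective i hi).symm.toLinearMap ∘ₗ
    (ψ ∘ₗ j).codRestrict (LinearMap.range i) hr, ?_⟩
  ext b
  obtain ⟨a, rfl⟩ := hY b
  obtain ⟨c, hc, hca⟩ := key a
  have h : (LinearEquiv.ofInjective i hi).symm
      ((ψ ∘ₗ j).codRestrict (LinearMap.range i) hr (Y a)) = c + a := by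
    rw [LinearEquiv.symm_apply_eq]
    ext
    rw [LinearEquiv.ofInjective_apply, map_add, hca, sub_add_cancel]
    rfl
  change Y ((LinearEquiv.ofInjective i hi).symm _) = Y a
  rw [h, map_add, LinearMap.mem_ker.mp hc, zero_add]

end Hereditary

instance : IsPrincipalIdealRing IntU.{u} :=
  IsPrincipalIdealRing.of_surjective (ULift.ringEquiv.{0, u} (R := ℤ)).symm.toRingHom
    (ULift.ringEquiv.{0, u} (R := ℤ)).symm.surjective

namespace RepExt
open MonoidalCategory ExtVanishing Limits Abelian
variable {k G : Type u} [CommRing k] [Group G]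

instance : HasExt.{u} (Rep.{u} k G) := hasExt_of_enoughProjectives _

instance (B : Rep.{u} k G) [Module.Projective k B.V] : (ihom B).PreservesEpimorphisms where
  preserves {X Y} f hf := by
    rw [Rep.epi_iff_surjective] at hf ⊢
    intro (g : B.V →ₗ[k] Y.V)
    obtain ⟨h, hh⟩ := Module.projective_lifting_property f.hom.toLinearMap g hf
    exact ⟨h, hh⟩

instance (B P : Rep.{u} k G) [Module.Projective k B.V] [Projective P] : Projective (B ⊗ P) :=
  (ihom.adjunction B).map_projective P inferInstance

lemma shortExact_tensorLeft (B : Rep.{u} k G) [Module.Projective k B.V]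
    {S : ShortComplex (Rep.{u} k G)} (hS : S.ShortExact) :
    (S.map (tensorLeft B)).ShortExact where
  exact := by
    have := (ihom.adjunction B).leftAdjoint_preservesColimits.{0, 0}
    have := hS.epi_g
    exact hS.exact.map_of_epi_of_preservesCokernel (tensorLeft B) inferInstance inferInstance
  mono_f := by
    have h := hS.mono_f
    rw [Rep.mono_iff_injective] at h ⊢
    exact Module.Flat.lTensor_preserves_injective_linearMap (M := B.V) S.f.hom.toLinearMap h
  epi_g := by
    have := (ihom.adjunction B).leftAdjoint_preservesColimits.{0, 0}
    have := hS.epi_g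
    exact inferInstanceAs (Epi ((tensorLeft B).map S.g))

/-- If `B` is projective over the ground ring, then vanishing of `Ext^i(X, Hom(B, N))` implies
vanishing of `Ext^i(B ⊗ X, N)`. -/
theorem subsingleton_ext_tensor (B N : Rep.{u} k G) [Module.Projective k B.V] (i : ℕ) :
    ∀ X : Rep.{u} k G, Subsingleton (Abelian.Ext.{u} X ((ihom B).obj N) (i + 1)) →
      Subsingleton (Abelian.Ext.{u} (B ⊗ X) N (i + 1)) := by
  induction i with
  | zero =>
    intro X h
    have hS : (ShortComplex.mk (kernel.ι (Projective.π X)) (Projective.π X)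
      (kernel.condition _)).ShortExact :=
      { exact := ShortComplex.exact_of_f_is_kernel _ (kernelIsKernel _) }
    refine right_one (shortExact_tensorLeft B hS) (fun f => ?_)
      (Ext.subsingleton_of_projective (B ⊗ Projective.over X) N 0)
    obtain ⟨g, hg⟩ := exists_extension hS h ((ihom.adjunction B).homEquiv _ _ f)
    refine ⟨((ihom.adjunction B).homEquiv _ _).symm g, ?_⟩
    refine ((ihom.adjunction B).homEquiv_naturality_left_symm _ _).symm.trans ?_
    exact (Equiv.symm_apply_eq _).mpr hg
  | succ i ih =>
    intro X h
    have hS : (ShortComplex.mk (kernel.ι (Projective.π X)) (Projective.π X)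
      (kernel.condition _)).ShortExact :=
      { exact := ShortComplex.exact_of_f_is_kernel _ (kernelIsKernel _) }
    refine right (shortExact_tensorLeft B hS) (ih _ ?_)
      (Ext.subsingleton_of_projective (B ⊗ Projective.over X) N _)
    exact left hS (Ext.subsingleton_of_projective (Projective.over X) _ _) h

/-- The evaluation isomorphism for a representation of rank one. -/
lemma nonempty_iso_ihom_tensor (L : Rep.{u} k G) (hL : Nonempty (L.V ≃ₗ[k] k)) :
    Nonempty ((ihom L).obj (𝟙_ (Rep.{u} k G)) ⊗ L ≅ 𝟙_ (Rep.{u} k G)) := by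
  obtain ⟨l⟩ := hL
  have : Module.Invertible k L.V := Module.Invertible.congr l.symm
  let f : (ihom L).obj (𝟙_ (Rep.{u} k G)) ⊗ L ⟶ 𝟙_ (Rep.{u} k G) :=
    (β_ _ _).hom ≫ (ihom.ev L).app _
  have hf : f.hom.toLinearMap = contractLeft k L.V := by
    refine TensorProduct.ext' fun x y => ?_
    rfl
  have hb : Function.Bijective f.hom := by
    have := Module.Invertible.bijective (R := k) (M := L.V)
    rw [← hf] at this
    exact this
  have := (Rep.mono_iff_injective f).mpr hb.1
  have := (Rep.epi_iff_surjective f).mpr hb.2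
  have := isIso_of_mono_of_epi f
  exact ⟨asIso f⟩

/-- Vanishing of the cohomology of `G` above some degree, with a class of coefficients closed under
internal homs, improves to the bound given by a complex of representations with a single top
homology of rank one. -/
theorem subsingleton_ext_unit [IsDomain k] [IsPrincipalIdealRing k]
    (K : ChainComplex (Rep.{u} k G) ℕ) [∀ j, Projective (K.X j)]
    (hK : ∀ j, Module.Projective k (K.X j).V) {n e : ℕ} (hne : n ≤ e)
    (hex : ∀ i, n < i → K.ExactAt i) (hL : Nonempty ((K.homology n).V ≃ₗ[k] k))
    (P : Rep.{u} k G → Prop)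
    (hP : ∀ B N : Rep.{u} k G, Module.Projective k B.V → P N → P ((ihom B).obj N))
    (hN : ∀ N : Rep.{u} k G, ∀ j, e ≤ j → ∀ f : K.X (j + 1) ⟶ N, K.d (j + 2) (j + 1) ≫ f = 0 →
      ∃ g : K.X j ⟶ N, K.d (j + 1) j ≫ g = f)
    (m : ℕ) (hm : ∀ i, m < i → ∀ N, P N →
      Subsingleton (Abelian.Ext.{u} (𝟙_ (Rep.{u} k G)) N i)) (i : ℕ) (hi : e - n < i)
    (N : Rep.{u} k G) (hPN : P N) :
    Subsingleton (Abelian.Ext.{u} (𝟙_ (Rep.{u} k G)) N i) := by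
  obtain ⟨d, hd⟩ : ∃ d, m < i + d := ⟨m + 1, by omega⟩
  induction d generalizing i N with
  | zero => exact hm i hd N hPN
  | succ d ih =>
    obtain ⟨i, rfl⟩ : ∃ i', i = i' + 1 := ⟨i - 1, by omega⟩
    have hB : Module.Projective k (cokernel (K.homologyι n)).V := by
      obtain ⟨j, f, hf⟩ := exists_mono_cokernel_homologyι K n
      have := hK j
      exact .of_injective_pid f.hom.toLinearMap ((Rep.mono_iff_injective f).mp hf)
    have hBext (N' : Rep.{u} k G) (hN' : P N') :
        Subsingleton (Abelian.Ext.{u} (cokernel (K.homologyι n)) N' (i + 1 + 1)) :=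
      of_iso_left (ρ_ _) (subsingleton_ext_tensor _ N' (i + 1) _
        (ih (i + 1 + 1) (by omega) _ (hP _ N' hB hN') (by omega)))
    have hLext (N' : Rep.{u} k G) (hN' : P N') :
        Subsingleton (Abelian.Ext.{u} (K.homology n) N' (i + 1)) :=
      left (shortExact_homologySequence K n)
        (subsingleton_ext_opcycles K hex (hN N') i le_rfl (by omega)) (hBext N' hN')
    obtain ⟨ε⟩ := nonempty_iso_ihom_tensor _ hL
    have : Module.Projective k ((ihom (K.homology n)).obj (𝟙_ (Rep.{u} k G))).V := by
      obtain ⟨l⟩ := hL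
      have : Module.Invertible k (K.homology n).V := Module.Invertible.congr l.symm
      exact inferInstanceAs (Module.Projective k (Module.Dual k (K.homology n).V))
    exact of_iso_left ε (subsingleton_ext_tensor _ N i _ (hLext _ (hP _ N this hPN)))

end RepExt

section FreeOn
variable {k G : Type u} [CommRing k] [Group G]

/-- The representation `A` is free as a module on a family permuted by the group. -/
structure IsPermutationBasis (A : Rep.{u} k G) {S : Type u} [MulAction G S] (b : S → A.V) :
    Prop where
  smul : ∀ g s, A.ρ g (b s) = b (g • s)
  ext : ∀ {M : Type u} [AddCommGroup M] [Module k M] {f f' : A.V →ₗ[k] M},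
    (∀ s, f (b s) = f' (b s)) → f = f'
  exists_lift : ∀ {M : Type u} [AddCommGroup M] [Module k M] (φ : S → M),
    ∃ f : A.V →ₗ[k] M, ∀ s, f (b s) = φ s

namespace IsPermutationBasis
variable {A : Rep.{u} k G} {S : Type u} [MulAction G S] {b : S → A.V}
  (h : IsPermutationBasis A b)
include h

lemma module_projective : Module.Projective k A.V := by
  refine Module.Projective.of_lifting_property'' fun f hf => ?_
  choose r hr using hf
  obtain ⟨l, hl⟩ := h.exists_lift fun s => r (b s)
  exact ⟨l, h.ext fun s => by simp [hl, hr]⟩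

lemma exists_hom {N : Rep.{u} k G} (φ : S → N.V) (hφ : ∀ g s, φ (g • s) = N.ρ g (φ s)) :
    ∃ f : A ⟶ N, ∀ s, f.hom (b s) = φ s := by
  obtain ⟨l, hl⟩ := h.exists_lift φ
  refine ⟨Rep.ofHom ⟨l, fun g => h.ext fun s => ?_⟩, hl⟩
  simp [h.smul, hl, hφ]

lemma hom_ext {N : Rep.{u} k G} {f f' : A ⟶ N} (hf : ∀ s, f.hom (b s) = f'.hom (b s)) :
    f = f' := by
  have : f.hom.toLinearMap = f'.hom.toLinearMap := h.ext hf
  ext x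
  exact LinearMap.congr_fun this x

/-- A permutation representation on a free `G`-set is projective. -/
lemma projective (hS : ∀ (g : G) (s : S), g • s = s → g = 1) : Projective A where
  factors {Y X} f e he := by
    rw [Rep.epi_iff_surjective] at he
    choose r hr using he
    let q : S → S := fun s => Quotient.out (Quotient.mk (MulAction.orbitRel G S) s)
    have hq (g : G) (s : S) : q (g • s) = q s := congrArg Quotient.out
      (Quotient.sound (s := MulAction.orbitRel G S) (MulAction.orbitRel_apply.mpr ⟨g, rfl⟩))
    have hex (s : S) : ∃ g : G, g • q s = s := by
      have := Quotient.mk_out (s := MulAction.orbitRel G S) s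
      obtain ⟨g, hg⟩ := MulAction.orbitRel_apply.mp this
      exact ⟨g⁻¹, by rw [inv_smul_eq_iff]; exact hg.symm⟩
    choose c hc using hex
    have hcg (g : G) (s : S) : c (g • s) = g * c s := by
      have h1 := hc (g • s)
      rw [hq] at h1
      have h2 : ((g * c s)⁻¹ * c (g • s)) • q s = q s := by
        rw [mul_smul, h1, mul_inv_rev, mul_smul, inv_smul_smul, inv_smul_eq_iff, hc]
      exact (inv_mul_eq_one.mp (hS _ _ h2)).symm
    obtain ⟨l, hl⟩ := h.exists_hom (N := Y)
      (fun s => Y.ρ (c s) (r (f.hom (b (q s))))) (fun g s => by rw [hq, hcg, map_mul]; rfl)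
    refine ⟨l, h.hom_ext fun s => ?_⟩
    rw [Rep.comp_apply, hl, Rep.hom_comm_apply, hr, ← Rep.hom_comm_apply, h.smul, hc]

end IsPermutationBasis
end FreeOn

section RepComplex
variable {k G : Type u} [CommRing k] [Group G]

/-- A chain complex of modules with a group action, as a complex of representations. -/
def repComplex (K : ChainComplex (ModuleCat.{u} k) ℕ) (α : G →* End K) :
    ChainComplex (Rep.{u} k G) ℕ where
  X i := Rep.of (X := K.X i)
    { toFun g := ((α g : K ⟶ K).f i).hom
      map_one' := by rw [map_one]; rfl
      map_mul' g h := by rw [map_mul]; rfl }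
  d i j := Rep.ofHom ⟨(K.d i j).hom, fun g => congrArg ModuleCat.Hom.hom ((α g : K ⟶ K).comm i j)⟩
  shape i j hij := by
    ext x
    exact ConcreteCategory.congr_hom (K.shape i j hij) x
  d_comp_d' i j l _ _ := by
    ext x
    exact ConcreteCategory.congr_hom (K.d_comp_d i j l) x

variable (K : ChainComplex (ModuleCat.{u} k) ℕ) (α : G →* End K)

lemma exactAt_repComplex {i : ℕ} (h : K.ExactAt i) : (repComplex K α).ExactAt i := by
  have h' : (((repComplex K α).sc i).map (forget₂ (Rep.{u} k G) (ModuleCat.{u} k))).Exact := h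
  exact (ShortComplex.exact_map_iff_of_faithful _ _).mp h'

lemma nonempty_homology_repComplex (i : ℕ) :
    Nonempty (((repComplex K α).homology i).V ≃ₗ[k] K.homology i) := by
  have e : K.homology i ≅ (forget₂ (Rep.{u} k G) (ModuleCat.{u} k)).obj
    ((repComplex K α).homology i) :=
    ShortComplex.mapHomologyIso ((repComplex K α).sc i) (forget₂ (Rep.{u} k G) (ModuleCat.{u} k))
  exact ⟨e.toLinearEquiv.symm⟩

end RepComplex

section Singular
variable (k : Type u) [CommRing k] (E : Type u) [TopologicalSpace E]

/-- The singular chain complex with coefficients in `k`. -/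
abbrev singularChains : ChainComplex (ModuleCat.{u} k) ℕ :=
  ((AlgebraicTopology.singularChainComplexFunctor (ModuleCat.{u} k)).obj (ModuleCat.of k k)).obj
    (TopCat.of E)

variable {E}

/-- The basis element of the singular chains given by a singular simplex. -/
def singularBasis {n : ℕ} (σ : (singularSimplices E).obj n) : (singularChains k E).X n :=
  ((TopCat.toSSet.obj (TopCat.of E)).ιChainComplex (R := ModuleCat.of k k)
    (((TopCat.of E).toSSetObjEquiv (.op (SimplexCategory.mk n))).symm σ)).hom (1 : k)

lemma singularBasis_ext {n : ℕ} {M : Type u} [AddCommGroup M] [Module k M]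
    {f f' : (singularChains k E).X n →ₗ[k] M}
    (h : ∀ σ : (singularSimplices E).obj n, f (singularBasis k σ) = f' (singularBasis k σ)) :
    f = f' := by
  suffices ModuleCat.ofHom f = ModuleCat.ofHom f' from congrArg ModuleCat.Hom.hom this
  refine SSet.chainComplex_hom_ext (X := TopCat.toSSet.obj (TopCat.of E)) fun x => ?_
  ext
  have := h ((TopCat.of E).toSSetObjEquiv _ x)
  rw [singularBasis, Equiv.symm_apply_apply] at this
  exact this

lemma exists_singularBasis_lift {n : ℕ} {M : Type u} [AddCommGroup M] [Module k M]
    (φ : (singularSimplices E).obj n → M) :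
    ∃ f : (singularChains k E).X n →ₗ[k] M, ∀ σ, f (singularBasis k σ) = φ σ := by
  let c : Limits.Cofan (fun _ : (TopCat.toSSet.obj (TopCat.of E)).obj (.op (.mk n)) =>
    ModuleCat.of k k) := Limits.Cofan.mk (ModuleCat.of k M) fun x =>
      ModuleCat.ofHom (LinearMap.toSpanSingleton k M (φ ((TopCat.of E).toSSetObjEquiv _ x)))
  refine ⟨(((TopCat.toSSet.obj (TopCat.of E)).isColimitChainComplexXCofan
    (ModuleCat.of k k) n).desc c).hom, fun σ => ?_⟩
  have := ConcreteCategory.congr_hom (((TopCat.toSSet.obj (TopCat.of E)).isColimitChainComplexXCofan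
    (ModuleCat.of k k) n).fac c ⟨((TopCat.of E).toSSetObjEquiv _).symm σ⟩) (1 : k)
  refine Eq.trans this ?_
  change LinearMap.toSpanSingleton k M (φ ((TopCat.of E).toSSetObjEquiv (.op (.mk n))
    (((TopCat.of E).toSSetObjEquiv (.op (.mk n))).symm σ))) 1 = _
  rw [Equiv.apply_symm_apply, LinearMap.toSpanSingleton_apply, one_smul]

lemma moduleCat_sum_apply {M N : ModuleCat.{u} k} {ι : Type} [Fintype ι] (f : ι → (M ⟶ N))
    (x : M) : (∑ i, f i).hom x = ∑ i, (f i).hom x := by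
  rw [ModuleCat.hom_sum, LinearMap.sum_apply]

lemma d_singularBasis {n : ℕ} (σ : (singularSimplices E).obj (n + 1)) :
    ((singularChains k E).d (n + 1) n).hom (singularBasis k σ) =
      ∑ j : Fin (n + 2), (-1 : ℤ) ^ (j : ℕ) •
        singularBasis k ((singularSimplices E).face j σ) := by
  have := ConcreteCategory.congr_hom (SSet.ιChainComplex_d (TopCat.toSSet.obj (TopCat.of E))
    (ModuleCat.of k k) (((TopCat.of E).toSSetObjEquiv (.op (.mk (n + 1)))).symm σ)) (1 : k)
  refine Eq.trans this ?_
  exact moduleCat_sum_apply k (ι := Fin (n + 2)) _ _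

variable {k} {G : Type u} [Group G] [MulAction G E] [ContinuousConstSMul G E]

variable (G E) in
/-- The action of a group on a space as a homomorphism to endomorphisms. -/
def topAction : G →* End (TopCat.of E) where
  toFun g := TopCat.ofHom ⟨fun x => g • x, continuous_const_smul g⟩
  map_one' := TopCat.hom_ext (ContinuousMap.ext fun x => one_smul G x)
  map_mul' g h := TopCat.hom_ext (ContinuousMap.ext fun x => mul_smul g h x)

variable (k G E) in
/-- The singular chain complex as a complex of representations. -/
abbrev singularRep : ChainComplex (Rep.{u} k G) ℕ :=
  repComplex (singularChains k E) (((AlgebraicTopology.singularChainComplexFunctor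
    (ModuleCat.{u} k)).obj (ModuleCat.of k k)).mapEnd (TopCat.of E) |>.comp (topAction E G))

variable (k G) in
/-- The basis of the singular chains given by the singular simplices. -/
def singularRepBasis {n : ℕ} (σ : (singularSimplices E).obj n) : ((singularRep k E G).X n).V :=
  singularBasis k σ

lemma isPermutationBasis_singular (n : ℕ) : IsPermutationBasis ((singularRep k E G).X n)
    (S := (singularSimplices E).obj n) (singularRepBasis k G) where
  smul g σ := by
    have := ConcreteCategory.congr_hom (SSet.ι_chainComplexMap_f _ _
      (TopCat.toSSet.map (topAction E G g)) (ModuleCat.of k k)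
      (((TopCat.of E).toSSetObjEquiv (.op (.mk n))).symm σ)) (1 : k)
    exact this
  ext h := singularBasis_ext k h
  exists_lift φ := exists_singularBasis_lift k φ

lemma exists_comp_eq_of_equivariantVanishing {e : ℕ}
    (h : EquivariantVanishing.{u} G (simplicesIn (Set.univ : Set E)) (e + 1))
    (N : Rep.{u} k G) (j : ℕ) (hj : e ≤ j) (f : (singularRep k E G).X (j + 1) ⟶ N)
    (hf : (singularRep k E G).d (j + 2) (j + 1) ≫ f = 0) :
    ∃ g : (singularRep k E G).X j ⟶ N, (singularRep k E G).d (j + 1) j ≫ g = f := by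
  let _ : DistribMulAction G N.V :=
    { smul g x := N.ρ g x
      one_smul x := by change N.ρ 1 x = x; rw [map_one]; rfl
      mul_smul g h x := by change N.ρ (g * h) x = _; rw [map_mul]; rfl
      smul_zero g := map_zero (N.ρ g)
      smul_add g := map_add (N.ρ g) }
  have hcob {i : ℕ} (l : (singularRep k E G).X i ⟶ N) (σ : (singularSimplices E).obj (i + 1)) :
      ((singularRep k E G).d (i + 1) i ≫ l).hom (singularRepBasis k G σ) =
        cob (fun τ => l.hom (singularRepBasis k G τ)) σ := by
    rw [Rep.comp_apply]
    refine (congrArg l.hom (d_singularBasis k σ)).trans ?_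
    exact (map_sum l.hom _ _).trans (Finset.sum_congr rfl fun τ _ => map_zsmul l.hom _ _)
  have hb := isPermutationBasis_singular (k := k) (E := E) (G := G)
  obtain ⟨ψ, hψ, hψf⟩ := h N.V (j + 1) (by omega) (fun σ => f.hom (singularRepBasis k G σ))
    (fun g σ => by
      change f.hom _ = _
      rw [← (hb _).smul]
      exact Rep.hom_comm_apply f g _)
    (fun σ _ => by rw [← hcob, hf]; rfl)
  obtain ⟨l, hl⟩ := (hb j).exists_hom ψ hψ
  refine ⟨l, (hb (j + 1)).hom_ext fun σ => ?_⟩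
  rw [hcob, funext hl]
  exact (hψf σ fun _ => trivial).symm

end Singular

namespace RepExt
open MonoidalCategory Limits Abelian
open scoped TensorProduct

section Cocycles
variable {C : Type*} [Category* C] [Preadditive C]

/-- Every map on the middle object that vanishes on the first one extends to the last one. -/
def ExtendsAlong {X₂ X₁ X₀ : C} (a : X₂ ⟶ X₁) (b : X₁ ⟶ X₀) (M : C) : Prop :=
  ∀ f : X₁ ⟶ M, a ≫ f = 0 → ∃ g : X₀ ⟶ M, b ≫ g = f

lemma extendsAlong_map_iff {D : Type*} [Category* D] [Preadditive D] {F : C ⥤ D}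
    {G : D ⥤ C} [G.PreservesZeroMorphisms] (adj : F ⊣ G) {X₂ X₁ X₀ : C} (a : X₂ ⟶ X₁)
    (b : X₁ ⟶ X₀) (M : D) :
    ExtendsAlong (F.map a) (F.map b) M ↔ ExtendsAlong a b (G.obj M) := by
  have hz (X : C) : adj.homEquiv X M 0 = 0 := by
    rw [adj.homEquiv_unit, Functor.map_zero, comp_zero]
  constructor
  · intro h f hf
    obtain ⟨g, hg⟩ := h ((adj.homEquiv _ _).symm f) (by
      apply (adj.homEquiv _ _).injective
      rw [adj.homEquiv_naturality_left, Equiv.apply_symm_apply, hf, hz])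
    exact ⟨adj.homEquiv _ _ g, by rw [← adj.homEquiv_naturality_left, hg, Equiv.apply_symm_apply]⟩
  · intro h f hf
    obtain ⟨g, hg⟩ := h (adj.homEquiv _ _ f) (by
      rw [← adj.homEquiv_naturality_left, hf, hz])
    exact ⟨(adj.homEquiv _ _).symm g, by
      rw [← adj.homEquiv_naturality_left_symm, hg, Equiv.symm_apply_apply]⟩

end Cocycles

lemma subsingleton_ext_iff {C : Type*} [Category* C] [Abelian C] [HasExt.{u} C] {X : C}
    (P : ProjectiveResolution X) (M : C) (i : ℕ) :
    Subsingleton (Abelian.Ext.{u} X M (i + 1)) ↔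
      ExtendsAlong (P.complex.d (i + 2) (i + 1)) (P.complex.d (i + 1) i) M := by
  constructor
  · intro h f hf
    exact (P.extMk_eq_zero_iff f (i + 2) rfl hf i rfl).mp (Subsingleton.elim _ _)
  · intro h
    refine subsingleton_of_forall_eq 0 fun x => ?_
    obtain ⟨f, hf, rfl⟩ := P.extMk_surjective x (i + 2) rfl
    exact (P.extMk_eq_zero_iff f (i + 2) rfl hf i rfl).mpr (h f hf)

variable {k G : Type u} [CommRing k] [Group G]

lemma isZero_extTrivial_iff (M : Rep.{u} k G) (i : ℕ) :
    IsZero (extTrivial k G (i + 1) M) ↔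
      Subsingleton (Abelian.Ext.{u} (𝟙_ (Rep.{u} k G)) M (i + 1)) := by
  let P : ProjectiveResolution (Rep.trivial k G k) := projectiveResolution _
  rw [extTrivial, (P.isoExt (R := k) (i + 1) M).isZero_iff, ← HomologicalComplex.exactAt_iff_isZero_homology,
    HomologicalComplex.exactAt_iff' _ i (i + 1) (i + 2) (by simp) (by simp),
    ShortComplex.moduleCat_exact_iff]
  exact (subsingleton_ext_iff P M i).symm

section Modules

lemma exists_linearMap_characterModule_ne_zero {V : Type u} [AddCommGroup V] [Module k V] {v : V}
    (hv : v ≠ 0) : ∃ c : V →ₗ[k] CharacterModule k, c v ≠ 0 := by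
  obtain ⟨c, hc⟩ := CharacterModule.exists_character_apply_ne_zero_of_ne_zero hv
  refine ⟨CharacterModule.curry (CharacterModule.dual (TensorProduct.rid k V).toLinearMap c),
    fun h => hc ?_⟩
  have h1 : c (TensorProduct.rid k V (v ⊗ₜ[k] (1 : k))) = 0 := DFunLike.congr_fun h (1 : k)
  rwa [TensorProduct.rid_tmul, one_smul] at h1

lemma extendsAlong_characterModule_iff {X₂ X₁ X₀ : ModuleCat.{u} k} (a : X₂ ⟶ X₁) (b : X₁ ⟶ X₀)
    (w : a ≫ b = 0) :
    ExtendsAlong a b (ModuleCat.of k (CharacterModule k)) ↔ (ShortComplex.mk a b w).Exact := by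
  rw [ShortComplex.moduleCat_exact_iff]
  constructor
  · intro h y hy
    by_contra hn
    obtain ⟨c, hc⟩ := exists_linearMap_characterModule_ne_zero (k := k)
      (v := (LinearMap.range a.hom).mkQ y) (by
        rwa [Ne, Submodule.mkQ_apply, Submodule.Quotient.mk_eq_zero])
    obtain ⟨g, hg⟩ := h (ModuleCat.ofHom (c ∘ₗ (LinearMap.range a.hom).mkQ)) (by
      ext1
      refine LinearMap.ext fun x => ?_
      change c ((LinearMap.range a.hom).mkQ (a.hom x)) = 0
      rw [Submodule.mkQ_apply, (Submodule.Quotient.mk_eq_zero _).mpr (LinearMap.mem_range_self _ x),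
        map_zero])
    apply hc
    have := ConcreteCategory.congr_hom hg y
    refine this.symm.trans ?_
    change g.hom (b.hom y) = 0
    rw [show b.hom y = 0 from hy, map_zero]
  · intro h f hf
    have hJ : Module.Injective k (CharacterModule k) :=
      Module.Flat.iff_characterModule_injective.mp inferInstance
    have hker : LinearMap.ker b.hom ≤ LinearMap.ker f.hom := by
      intro y hy
      obtain ⟨x, rfl⟩ := h y hy
      exact ConcreteCategory.congr_hom hf x
    obtain ⟨g, hg⟩ := hJ.out ((LinearMap.ker b.hom).liftQ b.hom le_rfl)
      (LinearMap.ker_eq_bot.mp (Submodule.ker_liftQ_eq_bot _ _ _ le_rfl))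
      ((LinearMap.ker b.hom).liftQ f.hom hker)
    refine ⟨ModuleCat.ofHom g, ?_⟩
    ext1
    exact LinearMap.ext fun x => hg (Submodule.Quotient.mk x)

end Modules

/-- The representation dual to `A`. -/
abbrev charRep (A : Rep.{u} k G) : Rep.{u} k G :=
  (ihom A).obj ((Rep.trivialFunctor k G).obj (ModuleCat.of k (CharacterModule k)))

instance : (Rep.trivialFunctor.{u} k G).PreservesZeroMorphisms where

instance (A : Rep.{u} k G) : (ihom A).PreservesZeroMorphisms where

lemma isZero_torTrivial_iff (A : Rep.{u} k G) (i : ℕ) :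
    IsZero (torTrivial k G (i + 1) A) ↔
      Subsingleton (Abelian.Ext.{u} (𝟙_ (Rep.{u} k G)) (charRep A) (i + 1)) := by
  let P : ProjectiveResolution (Rep.trivial k G k) := projectiveResolution _
  rw [torTrivial, (Rep.torIso A P (i + 1)).isZero_iff,
    ← HomologicalComplex.exactAt_iff_isZero_homology,
    HomologicalComplex.exactAt_iff' _ (i + 2) (i + 1) i (by simp) (by simp)]
  refine (extendsAlong_characterModule_iff _ _ _).symm.trans ?_
  refine Iff.trans ?_ (subsingleton_ext_iff P (charRep A) i).symm
  exact extendsAlong_map_iff ((ihom.adjunction A).comp (Rep.coinvariantsAdjunction k G)) _ _ _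

lemma nonempty_ihom_charRep_iso (B A : Rep.{u} k G) :
    Nonempty ((ihom B).obj (charRep A) ≅ charRep (B ⊗ A)) := by
  let l : (B.V →ₗ[k] A.V →ₗ[k] CharacterModule k) ≃ₗ[k] (B.V ⊗[k] A.V →ₗ[k] CharacterModule k) :=
    TensorProduct.lift.equiv (.id k) B.V A.V (CharacterModule k)
  let f : (ihom B).obj (charRep A) ⟶ charRep (B ⊗ A) := Rep.ofHom ⟨l.toLinearMap, fun g => by
    refine LinearMap.ext fun x => ?_
    exact TensorProduct.ext' fun b a => rfl⟩
  have := (Rep.mono_iff_injective f).mpr l.injective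
  have := (Rep.epi_iff_surjective f).mpr l.surjective
  have := isIso_of_mono_of_epi f
  exact ⟨asIso f⟩

section Finite

/-- A finite cyclic group with vanishing integral homology in an odd degree is trivial. -/
lemma card_eq_one_of_isZero_groupHomology {C : Type u} [CommGroup C] [Fintype C] (g : C)
    (hg : ∀ x, x ∈ Subgroup.zpowers g) (i : ℕ) (hi : Odd i)
    (h : IsZero (groupHomology (Rep.trivial IntU.{u} C IntU.{u}) i)) : Fintype.card C = 1 := by
  classical
  let A := Rep.trivial IntU.{u} C IntU.{u}
  have h0 : (1 : IntU.{u}) ∈ LinearMap.ker (A.applyAsHom g - 𝟙 A).hom.toLinearMap := by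
    rw [LinearMap.mem_ker]
    exact sub_self (1 : IntU.{u})
  have h1 : (1 : IntU.{u}) ∈ LinearMap.range A.ρ.norm := by
    refine (Rep.FiniteCyclicGroup.groupHomologyπOdd_eq_zero_iff A g hg i hi ⟨_, h0⟩).mp ?_
    have := ModuleCat.subsingleton_of_isZero h
    exact Subsingleton.elim _ _
  obtain ⟨x, hx⟩ := h1
  have h2 : A.ρ.norm x = Fintype.card C • x := by
    rw [Representation.norm, LinearMap.sum_apply]
    exact (Finset.sum_const x).trans (by rw [Finset.card_univ])
  rw [h2] at hx
  have h3 : (Fintype.card C : ℤ) * (x : IntU.{u}).down = 1 := by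
    rw [← nsmul_eq_mul]
    exact congrArg ULift.down hx
  have := Int.eq_one_or_neg_one_of_mul_eq_one h3
  omega

/-- A group of finite homological dimension is torsion-free. -/
theorem eq_one_of_isOfFinOrder {H : Type u} [Group H] (m : ℕ)
    (h : ∀ i, m < i → ∀ M : Rep.{u} IntU.{u} H, IsZero (torTrivial IntU.{u} H i M)) (g : H)
    (hg : IsOfFinOrder g) : g = 1 := by
  classical
  have hC : IsZero (groupHomology
      (Rep.trivial IntU.{u} (Subgroup.zpowers g) IntU.{u}) (2 * m + 1)) :=
    (h (2 * m + 1) (by omega) (Rep.ind (Subgroup.zpowers g).subtype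
      (Rep.trivial IntU.{u} (Subgroup.zpowers g) IntU.{u}))).of_iso
      ((groupHomology.indIso (Subgroup.zpowers g)
        (Rep.trivial IntU.{u} (Subgroup.zpowers g) IntU.{u}) (2 * m + 1)).symm ≪≫
        groupHomologyIsoTor _ _)
  have : Finite (Subgroup.zpowers g) := hg.finite_zpowers
  have := Fintype.ofFinite (Subgroup.zpowers g)
  let inst : CommGroup (Subgroup.zpowers g) :=
    { (inferInstance : Group (Subgroup.zpowers g)) with
      mul_comm := by
        rintro ⟨_, n, rfl⟩ ⟨_, p, rfl⟩
        exact Subtype.ext (zpow_mul_comm g n p) }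
  have hcard := card_eq_one_of_isZero_groupHomology (C := Subgroup.zpowers g)
    ⟨g, Subgroup.mem_zpowers g⟩ (by
      rintro ⟨x, n, rfl⟩
      exact ⟨n, rfl⟩) (2 * m + 1) ⟨m, rfl⟩ hC
  rw [Fintype.card_eq_one_iff] at hcard
  obtain ⟨y, hy⟩ := hcard
  exact congrArg Subtype.val ((hy ⟨g, Subgroup.mem_zpowers g⟩).trans (hy 1).symm)

end Finite

end RepExt

instance : IsDomain IntU.{u} :=
  (ULift.ringEquiv.{0, u} (R := ℤ)).toMulEquiv.isDomain ℤ

namespace RepExt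
open MonoidalCategory Limits Abelian

lemma nonempty_linearEquiv_intU {V : Type u} [AddCommGroup V] [Module IntU.{u} V] (f : V ≃+ ℤ) :
    Nonempty (V ≃ₗ[IntU.{u}] IntU.{u}) := by
  let g : V ≃+ IntU.{u} := f.trans (ULift.ringEquiv.{0, u} (R := ℤ)).symm.toAddEquiv
  refine ⟨g.toLinearEquiv fun r x => ?_⟩
  have hr : r = ((r.down : ℤ) : IntU.{u}) := by
    refine ULift.down_injective ?_
    rw [ULift.down_intCast, Int.cast_id]
  rw [hr, Int.cast_smul_eq_zsmul, map_zsmul, Int.cast_smul_eq_zsmul]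

section Action
variable {H E : Type u} [Group H] [TopologicalSpace E] [T2Space E]
  [CWComplex (Set.univ : Set E)] [MulAction H E]

/-- For a torsion-free group acting freely and properly, vanishing of cohomology in high degrees
with a class of coefficients closed under internal homs improves to the height of the action. -/
theorem subsingleton_ext_of_actsFreelyAndProperly (h : ActsFreelyAndProperly H E)
    {e n : ℕ} (he : HasCWDimension E e) (hn : n ≤ e)
    (hvanish : ∀ i : ℕ, n < i → Subsingleton (singularHomology IntU.{u} i E))
    (htop : Nonempty (singularHomology IntU.{u} n E ≃+ ℤ))
    (htf : ∀ g : H, IsOfFinOrder g → g = 1) (P : Rep.{u} IntU.{u} H → Prop)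
    (hP : ∀ B N : Rep.{u} IntU.{u} H, P N → P ((ihom B).obj N)) (m : ℕ)
    (hm : ∀ i, m < i → ∀ N, P N → Subsingleton (Abelian.Ext.{u} (𝟙_ (Rep.{u} IntU.{u} H)) N i))
    (i : ℕ) (hi : e - n < i) (N : Rep.{u} IntU.{u} H) (hN : P N) :
    Subsingleton (Abelian.Ext.{u} (𝟙_ (Rep.{u} IntU.{u} H)) N i) := by
  have := h.continuous
  have hb := isPermutationBasis_singular (k := IntU.{u}) (E := E) (G := H)
  have hproj (j : ℕ) : Projective ((singularRep IntU.{u} E H).X j) :=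
    (hb j).projective (ConvexStruct.singular_free h.free j)
  refine subsingleton_ext_unit (singularRep IntU.{u} E H) (fun j => (hb j).module_projective)
    hn (fun i hi => exactAt_repComplex _ _ ?_) ?_ P (fun B N _ => hP B N)
    (exists_comp_eq_of_equivariantVanishing
      (ConvexStruct.equivariantVanishing_of_hasCWDimension h htf he)) m hm i hi N hN
  · rw [HomologicalComplex.exactAt_iff_isZero_homology]
    have : Subsingleton ((singularChains IntU.{u} E).homology i) := hvanish i hi
    exact ModuleCat.isZero_of_subsingleton _
  · obtain ⟨f⟩ := htop
    obtain ⟨l⟩ := nonempty_homology_repComplex (singularChains IntU.{u} E)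
      (((AlgebraicTopology.singularChainComplexFunctor (ModuleCat.{u} IntU.{u})).obj
        (ModuleCat.of IntU.{u} IntU.{u})).mapEnd (TopCat.of E) |>.comp (topAction E H)) n
    obtain ⟨l'⟩ := nonempty_linearEquiv_intU f
    exact ⟨l.trans l'⟩

end Action
section Subgroups
variable {G E : Type u} [Group G] [TopologicalSpace E] [T2Space E]
  [CWComplex (Set.univ : Set E)] [MulAction G E] (hGE : ActsFreelyAndProperly G E)
  {e : ℕ} (he : HasCWDimension E e) {n : ℕ} (hn : n ≤ e)
  (hvanish : ∀ i : ℕ, n < i → Subsingleton (singularHomology IntU.{u} i E))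
  (htop : Nonempty (singularHomology IntU.{u} n E ≃+ ℤ))
include hGE he hn hvanish htop

theorem hasJumpCohomology_of_actsFreelyAndProperly : HasJumpCohomology IntU.{u} G (e - n) := by
  intro H hH
  obtain ⟨m, hm, hmt⟩ := sInf_lt_iff.mp hH
  lift m to ℕ using hmt.ne
  have hext (i : ℕ) (hi : m < i) (N : Rep.{u} IntU.{u} H) :
      Subsingleton (Abelian.Ext.{u} (𝟙_ (Rep.{u} IntU.{u} H)) N i) := by
    obtain ⟨i, rfl⟩ : ∃ i', i = i' + 1 := ⟨i - 1, by omega⟩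
    exact (isZero_extTrivial_iff N i).mp (hm _ (by exact_mod_cast hi) N)
  have htf := eq_one_of_isOfFinOrder m fun i hi N => by
    obtain ⟨i, rfl⟩ : ∃ i', i = i' + 1 := ⟨i - 1, by omega⟩
    exact (isZero_torTrivial_iff N i).mpr (hext _ hi _)
  refine sInf_le fun i hi N => ?_
  replace hi : e - n < i := by exact_mod_cast hi
  obtain ⟨i, rfl⟩ : ∃ i', i = i' + 1 := ⟨i - 1, by omega⟩
  exact (isZero_extTrivial_iff N i).mpr (subsingleton_ext_of_actsFreelyAndProperly
    (hGE.subgroup H) he hn hvanish htop htf (fun _ => True) (fun _ _ _ => trivial) m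
    (fun i hi N _ => hext i hi N) _ hi N trivial)

theorem hasJumpHomology_of_actsFreelyAndProperly : HasJumpHomology IntU.{u} G (e - n) := by
  intro H hH
  obtain ⟨m, hm, hmt⟩ := sInf_lt_iff.mp hH
  lift m to ℕ using hmt.ne
  have htor (i : ℕ) (hi : m < i) (N : Rep.{u} IntU.{u} H) : IsZero (torTrivial IntU.{u} H i N) :=
    hm i (by exact_mod_cast hi) N
  refine sInf_le fun i hi N => ?_
  replace hi : e - n < i := by exact_mod_cast hi
  obtain ⟨i, rfl⟩ : ∃ i', i = i' + 1 := ⟨i - 1, by omega⟩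
  refine (isZero_torTrivial_iff N i).mpr (subsingleton_ext_of_actsFreelyAndProperly
    (hGE.subgroup H) he hn hvanish htop (eq_one_of_isOfFinOrder m htor)
    (fun N => ∃ A, Nonempty (N ≅ charRep A)) ?_ m ?_ _ hi _ ⟨N, ⟨Iso.refl _⟩⟩)
  · rintro B M ⟨A, ⟨ε⟩⟩
    obtain ⟨ε'⟩ := nonempty_ihom_charRep_iso B A
    exact ⟨B ⊗ A, ⟨(ihom B).mapIso ε ≪≫ ε'⟩⟩
  · rintro i hi M ⟨A, ⟨ε⟩⟩
    obtain ⟨i, rfl⟩ : ∃ i', i = i' + 1 := ⟨i - 1, by omega⟩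
    exact ExtVanishing.of_iso_right ε.symm ((isZero_torTrivial_iff A i).mp (htor _ hi A))

end Subgroups
end RepExt

end

theorem proposition2p5 (G E : Type u) [Group G] [TopologicalSpace E] [T2Space E]
    [CWComplex (Set.univ : Set E)] [MulAction G E] (hGE : ActsFreelyAndProperly G E)
    (e : ℕ) (he : HasCWDimension E e) (n : ℕ) (hn : n ≤ e)
    (hvanish : ∀ i : ℕ, n < i → Subsingleton (singularHomology IntU.{u} i E))
    (htop : Nonempty (singularHomology IntU.{u} n E ≃+ ℤ)) :
    HasJumpCohomology IntU.{u} G (e - n) ∧ HasJumpHomology IntU.{u} G (e - n) := by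
  exact ⟨RepExt.hasJumpCohomology_of_actsFreelyAndProperly hGE he hn hvanish htop,
    RepExt.hasJumpHomology_of_actsFreelyAndProperly hGE he hn hvanish htop⟩
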